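/- Notation. For $n\ge 0$ let $[n]=\{1,\dots,n\}$ and $[-n,n]=\{-n,\dots,n\}$. Let $\mathfrak S_n$ be the group of permutations of $[n]$, with simple transpositions $s_i=(i,i+1)$, $1\le i\le n-1$, and let $\mathfrak S^B_n$ be the group of signed permutations, i.e. permutations $\sigma$ of $[-n,n]$ with $\sigma(-i)=-\sigma(i)$ for all $i$, generated by $s^B_0=(1,-1)$ and $s^B_i=(i,i+1)(-i,-i-1)$, $1\le i\le n-1$. Products of permutations are compositions, and $\ell$ denotes the length with respect to these generators. Let $H_n(0)$ and $H^B_n(0)$ be the $0$-Hecke algebras over $\mathbb C$ of types $A_{n-1}$ and $B_n$, with generators $\bar\pi_i$ ($1\le i\le n-1$), respectively $\bar\pi^B_i$ ($0\le i\le n-1$), subject to the braid relations and $\bar\pi^2=-\bar\pi$ for every generator $\bar\pi$. For a signed permutation $\delta$ with reduced word $s^B_{i_1}\cdots s^B_{i_k}$ put $\bar\pi^B_\delta=\bar\pi^B_{i_1}\cdots\bar\pi^B_{i_k}$. The algebra $H^B_m(0)\otimes H_n(0)$ is viewed as the subalgebra of $H^B_{m+n}(0)$ generated by the $\bar\pi^B_i$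 with $i\neq m$, via $\bar\pi^B_i\otimes 1\mapsto\bar\pi^B_i$ and $1\otimes\bar\pi_j\mapsto\bar\pi^B_{m+j}$. A $B_n$ poset is a partial order $\preceq_P$ on $[-n,n]$ such that $i\preceq_P j$ if and only if $-j\preceq_P -i$. For a poset $P$ on $[n]$, let $\Sigma_R(P)$ be the set of $\gamma\in\mathfrak S_n$ such that $\gamma(1)\preceq_E\cdots\preceq_E\gamma(n)$ for some linear extension $E$ of $P$. For a $B_n$ poset $P$, let $\Sigma^B_R(P)$ be the set of $\gamma\in\mathfrak S^B_n$ for which there is a linear extension $E$ of $P$ that is itself a $B_n$ poset and satisfies $i\prec_E j\Leftrightarrow\gamma^{-1}(i)<\gamma^{-1}(j)$ for all $i,j\in[-n,n]$. The poset module $M_P$ of a poset $P$ on $[n]$ is the right $H_n(0)$-module with $\mathbb C$-basis $\Sigma_R(P)$ and action $$\gamma\cdot\bar\pi_i=\begin{cases}-\gamma&\text{if }\gamma(i)>\gamma(i+1),\\ \gamma s_i&\text{if }\gamma(i)<\gamma(i+1)\text{ and }\gamma s_i\in\Sigma_R(P),\\ 0&\text{otherwise,}\end{cases}$$ and the $B_n$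 poset module $M^B_P$ of a $B_n$ poset $P$ is the right $H^B_n(0)$-module with $\mathbb C$-basis $\Sigma^B_R(P)$ and the action given by the same formula with $\bar\pi^B_i$, $s^B_i$, $\Sigma^B_R(P)$ and $0\le i\le n-1$, where $\gamma(0)=0$. For a $B_m$ poset $P_1$ and a poset $P_2$ on $[n]$, let $P_1\sqcup_B P_2$ be the $B_{m+n}$ poset on $[-(m+n),m+n]$ in which $i\preceq j$ if and only if - $i,j\in[-m,m]$ and $i\preceq_{P_1}j$, or - $i,j\in[m+1,m+n]$ and $i-m\preceq_{P_2}j-m$, or - $i,j\in[-(m+n),-(m+1)]$ and $-j-m\preceq_{P_2}-i-m$. For $\sigma\in\mathfrak S^B_m$ and $\rho\in\mathfrak S_n$ let $\sigma\bullet_B\rho\in\mathfrak S^B_{m+n}$ be given by $i\mapsto\sigma(i)$ for $|i|\le m$, $i\mapsto\rho(i-m)+m$ for $i>m$, and $i\mapsto-\rho(-i-m)-m$ for $i<-m$. Let $D_{m,n}\subseteq\mathfrak S^B_{m+n}$ be the set of minimal length representatives of the right cosets of the parabolic subgroup generated by the $s^B_i$ with $i\ne m$, and for $X\subseteq\mathfrak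 S^B_m$, $Y\subseteq\mathfrak S_n$ let $X\star_B Y=\{(\sigma\bullet_B\rho)\,\delta:\sigma\in X,\ \rho\in Y,\ \delta\in D_{m,n}\}$. Theorem. Let $m,n\ge 0$, let $P_1$ be a $B_m$ poset and let $P_2$ be a poset on $[n]$. Then: 1. $\Sigma^B_R(P_1)\star_B \Sigma_R(P_2)=\Sigma^B_R(P_1\sqcup_BP_2)$, and the map $(\sigma,\rho,\delta)\mapsto(\sigma\bullet_B\rho)\,\delta$ is a bijection from $\Sigma^B_R(P_1)\times\Sigma_R(P_2)\times D_{m,n}$ onto $\Sigma^B_R(P_1\sqcup_BP_2)$. 2. There is an isomorphism of right $H^B_{m+n}(0)$-modules $$(M^B_{P_1}\otimes M_{P_2})\uparrow_{H^B_m(0)\otimes H_n(0)}^{H^B_{m+n}(0)}=(M^B_{P_1}\otimes M_{P_2})\otimes_{H^B_m(0)\otimes H_n(0)}H^B_{m+n}(0)\;\cong\;M^B_{P_1\sqcup_BP_2}$$ which sends $(\gamma\otimes\gamma')\otimes\bar\pi^B_\delta$ to the basis element $(\gamma\bullet_B\gamma')\,\delta$ for all $\gamma\in\Sigma^B_R(P_1)$,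 $\gamma'\in\Sigma_R(P_2)$ and $\delta\in D_{m,n}$. -/

import Mathlib

open scoped TensorProduct

set_option linter.unusedSimpArgs false

namespace PosetModuleB

/-! ### 0-Hecke algebras -/

/-- The product in a monoid of the letters of a word in the index set `S`. -/
def wordProd {S R : Type*} [Monoid R] (f : S → R) (l : List S) : R := (l.map f).prod

/-- The defining relations of the 0-Hecke algebra of a Coxeter matrix `M` (the entry `0` of `M`
encodes `∞`): each generator `x` satisfies `x * x = -x`, and distinct generators `s`, `t`
satisfy the braid relation of length `M s t`. -/
inductive ZeroHeckeRel {S : Type} (M : CoxeterMatrix S) :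
    FreeAlgebra ℂ S → FreeAlgebra ℂ S → Prop
  | quad (s : S) : ZeroHeckeRel M
      (FreeAlgebra.ι ℂ s * FreeAlgebra.ι ℂ s) (-FreeAlgebra.ι ℂ s)
  | braid (s t : S) (hst : s ≠ t) (hM : M s t ≠ 0) : ZeroHeckeRel M
      (wordProd (FreeAlgebra.ι ℂ) (CoxeterSystem.alternatingWord s t (M s t)))
      (wordProd (FreeAlgebra.ι ℂ) (CoxeterSystem.alternatingWord t s (M s t)))

/-- The 0-Hecke algebra over `ℂ` of a Coxeter matrix. -/
def ZeroHecke {S : Type} (M : CoxeterMatrix S) : Type := RingQuot (ZeroHeckeRel M)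

noncomputable instance {S : Type} (M : CoxeterMatrix S) : Ring (ZeroHecke M) :=
  inferInstanceAs (Ring (RingQuot (ZeroHeckeRel M)))

noncomputable instance {S : Type} (M : CoxeterMatrix S) : Algebra ℂ (ZeroHecke M) :=
  inferInstanceAs (Algebra ℂ (RingQuot (ZeroHeckeRel M)))

namespace ZeroHecke

variable {S : Type} (M : CoxeterMatrix S)

/-- The generators of the 0-Hecke algebra (the ones that square to their negative). -/
noncomputable def gen (s : S) : ZeroHecke M :=
  RingQuot.mkAlgHom ℂ (ZeroHeckeRel M) (FreeAlgebra.ι ℂ s)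

theorem map_wordProd {R R' : Type*} [Semiring R] [Semiring R'] [Algebra ℂ R] [Algebra ℂ R']
    (φ : R →ₐ[ℂ] R') (f : S → R) (l : List S) :
    φ (wordProd f l) = wordProd (fun s => φ (f s)) l := by
  simp [wordProd, map_list_prod, Function.comp_def]

theorem gen_quad (s : S) : gen M s * gen M s = -gen M s := by
  have h := RingQuot.mkAlgHom_rel ℂ (ZeroHeckeRel.quad (M := M) s)
  rw [map_mul] at h
  exact h.trans (map_neg (RingQuot.mkAlgHom ℂ (ZeroHeckeRel M)) _)

theorem gen_braid (s t : S) (hst : s ≠ t) (hM : M s t ≠ 0) :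
    wordProd (gen M) (CoxeterSystem.alternatingWord s t (M s t)) =
      wordProd (gen M) (CoxeterSystem.alternatingWord t s (M s t)) := by
  have h := RingQuot.mkAlgHom_rel ℂ (ZeroHeckeRel.braid (M := M) s t hst hM)
  rw [map_wordProd, map_wordProd] at h
  exact h

/-- The universal property of the 0-Hecke algebra. -/
noncomputable def lift {R : Type} [Ring R] [Algebra ℂ R] (f : S → R)
    (hq : ∀ s, f s * f s = -f s)
    (hb : ∀ s t, s ≠ t → M s t ≠ 0 →
      wordProd f (CoxeterSystem.alternatingWord s t (M s t)) =
        wordProd f (CoxeterSystem.alternatingWord t s (M s t))) :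
    ZeroHecke M →ₐ[ℂ] R :=
  RingQuot.liftAlgHom ℂ (s := ZeroHeckeRel M) ⟨FreeAlgebra.lift ℂ f, by
    intro x y h
    cases h with
    | quad s => rw [map_mul, map_neg, FreeAlgebra.lift_ι_apply]; exact hq s
    | braid s t hst hM =>
      rw [map_wordProd, map_wordProd]
      simp only [FreeAlgebra.lift_ι_apply]
      exact hb s t hst hM⟩

theorem lift_gen {R : Type} [Ring R] [Algebra ℂ R] (f : S → R)
    (hq : ∀ s, f s * f s = -f s)
    (hb : ∀ s t, s ≠ t → M s t ≠ 0 →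
      wordProd f (CoxeterSystem.alternatingWord s t (M s t)) =
        wordProd f (CoxeterSystem.alternatingWord t s (M s t))) (s : S) :
    lift M f hq hb (gen M s) = f s := by
  unfold lift gen
  exact (RingQuot.liftAlgHom_mkAlgHom_apply ℂ (FreeAlgebra.lift ℂ f) _ _).trans
    (FreeAlgebra.lift_ι_apply f s)

/-- Two families of generators that commute generate commuting images. -/
theorem commute_of_gen {S S' : Type} {M : CoxeterMatrix S} {M' : CoxeterMatrix S'} {R : Type*} [Ring R] [Algebra ℂ R]
    (f : ZeroHecke M →ₐ[ℂ] R) (g : ZeroHecke M' →ₐ[ℂ] R)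
    (h : ∀ s t, Commute (f (gen M s)) (g (gen M' t))) (x : ZeroHecke M) (y : ZeroHecke M') :
    Commute (f x) (g y) := by
  obtain ⟨x, rfl⟩ := RingQuot.mkAlgHom_surjective ℂ (ZeroHeckeRel M) x
  obtain ⟨y, rfl⟩ := RingQuot.mkAlgHom_surjective ℂ (ZeroHeckeRel M') y
  have alg : ∀ (c : ℂ) (r : R), Commute (algebraMap ℂ R c) r := fun c r => Algebra.commutes c r
  induction x using FreeAlgebra.induction with
  | grade0 c =>
    have : f (RingQuot.mkAlgHom ℂ (ZeroHeckeRel M) (algebraMap ℂ _ c)) = algebraMap ℂ R c :=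
      (f.comp (RingQuot.mkAlgHom ℂ (ZeroHeckeRel M))).commutes c
    rw [this]; exact alg _ _
  | grade1 s =>
    induction y using FreeAlgebra.induction with
    | grade0 c =>
      have : g (RingQuot.mkAlgHom ℂ (ZeroHeckeRel M') (algebraMap ℂ _ c)) = algebraMap ℂ R c :=
        (g.comp (RingQuot.mkAlgHom ℂ (ZeroHeckeRel M'))).commutes c
      rw [this]; exact (alg _ _).symm
    | grade1 t => exact h s t
    | mul a b ha hb =>
      have : g (RingQuot.mkAlgHom ℂ (ZeroHeckeRel M') (a * b)) = _ :=
        map_mul (g.comp (RingQuot.mkAlgHom ℂ (ZeroHeckeRel M'))) a b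
      rw [this]; exact ha.mul_right hb
    | add a b ha hb =>
      have : g (RingQuot.mkAlgHom ℂ (ZeroHeckeRel M') (a + b)) = _ :=
        map_add (g.comp (RingQuot.mkAlgHom ℂ (ZeroHeckeRel M'))) a b
      rw [this]; exact ha.add_right hb
  | mul a b ha hb =>
    have : f (RingQuot.mkAlgHom ℂ (ZeroHeckeRel M) (a * b)) = _ :=
      map_mul (f.comp (RingQuot.mkAlgHom ℂ (ZeroHeckeRel M))) a b
    rw [this]; exact ha.mul_left hb
  | add a b ha hb =>
    have : f (RingQuot.mkAlgHom ℂ (ZeroHeckeRel M) (a + b)) = _ :=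
      map_add (f.comp (RingQuot.mkAlgHom ℂ (ZeroHeckeRel M))) a b
    rw [this]; exact ha.add_left hb

theorem wordProd_map {S' R : Type*} [Monoid R] (e : S → S') (f : S' → R) (l : List S) :
    wordProd f (l.map e) = wordProd (fun s => f (e s)) l := by
  simp [wordProd, Function.comp_def]

theorem alternatingWord_map {S' : Type*} (e : S → S') (s t : S) (k : ℕ) :
    (CoxeterSystem.alternatingWord s t k).map e =
      CoxeterSystem.alternatingWord (e s) (e t) k := by
  induction k generalizing s t with
  | zero => rfl
  | succ k ih => simp [CoxeterSystem.alternatingWord, ← ih]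

/-- The homomorphism of 0-Hecke algebras induced by an embedding of Coxeter diagrams. -/
noncomputable def map {S S' : Type} {M : CoxeterMatrix S} {M' : CoxeterMatrix S'} (e : S → S')
    (he : Function.Injective e) (hM : ∀ s t, M' (e s) (e t) = M s t) :
    ZeroHecke M →ₐ[ℂ] ZeroHecke M' :=
  lift M (fun s => gen M' (e s)) (fun s => gen_quad M' (e s)) (by
    intro s t hst h0
    rw [← wordProd_map e (gen M'), ← wordProd_map e (gen M'), alternatingWord_map,
      alternatingWord_map, ← hM s t]
    exact gen_braid M' (e s) (e t) (he.ne hst) (by rw [hM]; exact h0))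

theorem map_gen {S S' : Type} {M : CoxeterMatrix S} {M' : CoxeterMatrix S'} (e : S → S')
    (he : Function.Injective e) (hM : ∀ s t, M' (e s) (e t) = M s t) (s : S) :
    map e he hM (gen M s) = gen M' (e s) := lift_gen _ _ _ _ _

end ZeroHecke

/-- The Coxeter matrix of type `Bₙ` with nodes `0, 1, …, n - 1`, where the bond labelled `4`
joins the nodes `0` and `1`. -/
def coxB (n : ℕ) : CoxeterMatrix (Fin n) where
  M := Matrix.of fun i j : Fin n =>
    if i = j then 1
    else if (i : ℕ) + 1 = j ∨ (j : ℕ) + 1 = i then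
      if (i : ℕ) = 0 ∨ (j : ℕ) = 0 then 4 else 3
    else 2
  isSymm := by
    ext i j
    simp only [Matrix.transpose_apply, Matrix.of_apply, eq_comm (a := j), or_comm]
  diagonal := by simp
  off_diagonal := by
    intro i j h
    simp only [Matrix.of_apply, if_neg h]
    split_ifs <;> decide

/-- `Hₙ(0)`, the 0-Hecke algebra of type `A_{n-1}`; the index `j : Fin (n - 1)` stands for the
simple transposition that exchanges `j + 1` and `j + 2`. -/
abbrev HA (n : ℕ) : Type := ZeroHecke (CoxeterMatrix.A (n - 1))

/-- `Hᴮₙ(0)`, the 0-Hecke algebra of type `Bₙ`, with generators indexed by `0, …, n - 1`. -/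
abbrev HB (n : ℕ) : Type := ZeroHecke (coxB n)

/-- The embedding of the nodes of `A_{n-1}` as the nodes `m + 1, …, m + n - 1` of `B_{m+n}`. -/
def shiftNode (m n : ℕ) (j : Fin (n - 1)) : Fin (m + n) := ⟨m + j + 1, by omega⟩

theorem shiftNode_injective (m n : ℕ) : Function.Injective (shiftNode m n) := by
  intro i j h
  simpa [shiftNode, Fin.ext_iff] using h

theorem coxB_castAdd (m n : ℕ) (i j : Fin m) :
    coxB (m + n) (Fin.castAdd n i) (Fin.castAdd n j) = coxB m i j := by
  simp [coxB]

theorem coxB_shiftNode (m n : ℕ) (i j : Fin (n - 1)) :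
    coxB (m + n) (shiftNode m n i) (shiftNode m n j) = CoxeterMatrix.A (n - 1) i j := by
  simp only [coxB, CoxeterMatrix.A, shiftNode, Matrix.of_apply, Fin.ext_iff]
  have h1 : m + (i : ℕ) + 1 ≠ 0 := by omega
  have h2 : m + (j : ℕ) + 1 ≠ 0 := by omega
  have h3 : m + (i : ℕ) + 1 = m + j + 1 ↔ (i : ℕ) = j := by omega
  have h4 : m + (i : ℕ) + 1 + 1 = m + j + 1 ∨ m + (j : ℕ) + 1 + 1 = m + i + 1 ↔
    (j : ℕ) + 1 = i ∨ (i : ℕ) + 1 = j := by omega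
  simp only [h1, h2, h3, h4, or_self, if_false]

theorem coxB_castAdd_shiftNode (m n : ℕ) (i : Fin m) (j : Fin (n - 1)) :
    coxB (m + n) (Fin.castAdd n i) (shiftNode m n j) = 2 := by
  simp only [coxB, shiftNode, Matrix.of_apply, Fin.ext_iff, Fin.val_castAdd]
  split_ifs <;> omega

/-- The embedding `Hᴮₘ(0) → Hᴮ_{m+n}(0)` on the first `m` generators. -/
noncomputable def embB (m n : ℕ) : HB m →ₐ[ℂ] HB (m + n) :=
  ZeroHecke.map (Fin.castAdd n) (Fin.castAdd_injective m n) (coxB_castAdd m n)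

/-- The embedding `Hₙ(0) → Hᴮ_{m+n}(0)` on the last `n - 1` generators. -/
noncomputable def embA (m n : ℕ) : HA n →ₐ[ℂ] HB (m + n) :=
  ZeroHecke.map (shiftNode m n) (shiftNode_injective m n) (coxB_shiftNode m n)

/-- The canonical homomorphism `Hᴮₘ(0) ⊗ Hₙ(0) → Hᴮ_{m+n}(0)`, by which the tensor product is
regarded as the subalgebra generated by all generators but the one with index `m`. -/
noncomputable def embBA (m n : ℕ) : HB m ⊗[ℂ] HA n →ₐ[ℂ] HB (m + n) :=
  Algebra.TensorProduct.lift (embB m n) (embA m n) (by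
    refine ZeroHecke.commute_of_gen _ _ fun i j => ?_
    have h := ZeroHecke.gen_braid (coxB (m + n)) (Fin.castAdd n i) (shiftNode m n j)
      (by simp only [shiftNode, ne_eq, Fin.ext_iff, Fin.val_castAdd]; omega)
      (by rw [coxB_castAdd_shiftNode]; decide)
    rw [coxB_castAdd_shiftNode] at h
    simp only [CoxeterSystem.alternatingWord, wordProd, List.concat_eq_append, List.nil_append,
      List.cons_append, List.map_cons, List.map_nil, List.prod_cons, List.prod_nil, mul_one] at h
    rw [embB, embA, ZeroHecke.map_gen, ZeroHecke.map_gen]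
    exact h)

/-! ### Right modules: outer tensor products and induction

A right module over `A` is a module over the opposite algebra `Aᵐᵒᵖ`; the element `m · a` is
written `MulOpposite.op a • m`. -/

section RightModules

variable {A B : Type} [Ring A] [Algebra ℂ A] [Ring B] [Algebra ℂ B]

/-- The outer tensor product over `ℂ` of a right `A`-module and a right `B`-module. -/
def OuterTensor (V W : Type) [AddCommGroup V] [Module ℂ V] [AddCommGroup W] [Module ℂ W] : Type :=
  V ⊗[ℂ] W

section
variable (V W : Type) [AddCommGroup V] [Module ℂ V] [AddCommGroup W] [Module ℂ W]

noncomputable instance : AddCommGroup (OuterTensor V W) :=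
  inferInstanceAs (AddCommGroup (V ⊗[ℂ] W))

noncomputable instance : Module ℂ (OuterTensor V W) :=
  inferInstanceAs (Module ℂ (V ⊗[ℂ] W))

end

/-- The pure tensor `v ⊗ w` in the outer tensor product. -/
noncomputable def OuterTensor.tmul {V W : Type} [AddCommGroup V] [Module ℂ V] [AddCommGroup W]
    [Module ℂ W] (v : V) (w : W) : OuterTensor V W := v ⊗ₜ[ℂ] w

section
variable (V W : Type) [AddCommGroup V] [Module ℂ V] [AddCommGroup W] [Module ℂ W]
  [Module Aᵐᵒᵖ V] [IsScalarTower ℂ Aᵐᵒᵖ V] [Module Bᵐᵒᵖ W] [IsScalarTower ℂ Bᵐᵒᵖ W]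

/-- The algebra homomorphism by which `(A ⊗ B)ᵐᵒᵖ` acts on the outer tensor product. -/
noncomputable def OuterTensor.action : (A ⊗[ℂ] B)ᵐᵒᵖ →ₐ[ℂ] Module.End ℂ (OuterTensor V W) :=
  (Module.endTensorEndAlgHom (R := ℂ) (S := ℂ) (A := ℂ) (M := V) (N := W)).comp
    ((Algebra.TensorProduct.map (Algebra.lsmul ℂ ℂ V : Aᵐᵒᵖ →ₐ[ℂ] Module.End ℂ V)
      (Algebra.lsmul ℂ ℂ W : Bᵐᵒᵖ →ₐ[ℂ] Module.End ℂ W)).comp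
      (Algebra.TensorProduct.opAlgEquiv ℂ ℂ A B).symm.toAlgHom)

/-- The right `A ⊗ B`-module structure `(v ⊗ w) · (a ⊗ b) = (v · a) ⊗ (w · b)`. -/
noncomputable instance : Module (A ⊗[ℂ] B)ᵐᵒᵖ (OuterTensor V W) :=
  Module.compHom _ (OuterTensor.action (A := A) (B := B) V W).toRingHom

theorem OuterTensor.op_tmul_smul_tmul (a : A) (b : B) (v : V) (w : W) :
    MulOpposite.op (a ⊗ₜ[ℂ] b) • OuterTensor.tmul v w =
      OuterTensor.tmul (MulOpposite.op a • v) (MulOpposite.op b • w) := by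
  change OuterTensor.action V W (MulOpposite.op (a ⊗ₜ[ℂ] b)) (v ⊗ₜ[ℂ] w) = _
  rfl

end

/-- The submodule of `B ⊗ V` by which one divides to obtain the balanced tensor product: it is
spanned by the elements `(f a * b) ⊗ v - b ⊗ (v · a)`. Here `B ⊗ V` is a right `B`-module by
right multiplication on the factor `B`. -/
def inducedRel (f : A →ₐ[ℂ] B) (V : Type) [AddCommGroup V] [Module ℂ V] [Module Aᵐᵒᵖ V] :
    Submodule Bᵐᵒᵖ (B ⊗[ℂ] V) :=
  Submodule.span Bᵐᵒᵖ
    {x | ∃ (a : A) (b : B) (v : V), x = (f a * b) ⊗ₜ[ℂ] v - b ⊗ₜ[ℂ] (MulOpposite.op a • v)}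

/-- The induced right `B`-module `V ⊗_A B` of a right `A`-module `V` along `f : A → B`. (The two
factors are written in the reverse order, so that Mathlib provides the action of `B`.) -/
abbrev Induced (f : A →ₐ[ℂ] B) (V : Type) [AddCommGroup V] [Module ℂ V] [Module Aᵐᵒᵖ V] : Type :=
  (B ⊗[ℂ] V) ⧸ inducedRel f V

/-- The element `v ⊗ b` of the induced module `V ⊗_A B`. -/
def Induced.tmul (f : A →ₐ[ℂ] B) {V : Type} [AddCommGroup V] [Module ℂ V] [Module Aᵐᵒᵖ V]
    (v : V) (b : B) : Induced f V := (inducedRel f V).mkQ (b ⊗ₜ[ℂ] v)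

theorem Induced.smul_tmul (f : A →ₐ[ℂ] B) {V : Type} [AddCommGroup V] [Module ℂ V]
    [Module Aᵐᵒᵖ V] (v : V) (a : A) (b c : B) :
    Induced.tmul f (MulOpposite.op a • v) b = Induced.tmul f v (f a * b) ∧
      MulOpposite.op c • Induced.tmul f v b = Induced.tmul f v (b * c) := by
  constructor
  · refine ((Submodule.Quotient.eq _).2 ?_).symm
    exact Submodule.subset_span ⟨a, b, v, rfl⟩
  · rw [Induced.tmul, Induced.tmul, ← map_smul, TensorProduct.smul_tmul', op_smul_eq_mul]

end RightModules


/-! ### The 0-Hecke action on the span of a set of group elements -/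

section SetAction

variable {W S : Type} [Group W] (s : S → W) (D : S → W → Prop)

open Classical in
/-- The operator `π_i` on the vector space with basis `X ⊆ W`, for given simple generators `s`
and a given descent predicate `D`: a basis element `x` is sent to `-x` if `i` is a descent of
`x`, and otherwise to `x * s i` or `0` according to whether `x * s i` lies in `X`. -/
noncomputable def setOp (X : Set W) (i : S) : (X →₀ ℂ) →ₗ[ℂ] (X →₀ ℂ) :=
  Finsupp.linearCombination ℂ fun x : X =>
    if D i x then -Finsupp.single x 1
    else if h : (x : W) * s i ∈ X then Finsupp.single ⟨x * s i, h⟩ 1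
    else 0

open Classical in
/-- An auxiliary deformation of the regular representation. -/
noncomputable def twOp (q : S → W → ℂ) (i : S) : (W →₀ ℂ) →ₗ[ℂ] (W →₀ ℂ) :=
  Finsupp.linearCombination ℂ fun x : W =>
    if D i x then -Finsupp.single x 1 else q i x • Finsupp.single (x * s i) 1

variable {s D}

theorem twOp_pos {q : S → W → ℂ} {i : S} {x : W} (h : D i x) (c : ℂ) :
    twOp s D q i (Finsupp.single x c) = -Finsupp.single x c := by
  simp [twOp, h]

theorem twOp_neg {q : S → W → ℂ} {i : S} {x : W} (h : ¬ D i x) (c : ℂ) :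
    twOp s D q i (Finsupp.single x c) = Finsupp.single (x * s i) (q i x * c) := by
  simp [twOp, h, mul_comm]

theorem twOp_single (q : S → W → ℂ) (i : S) (x : W) (c : ℂ) [Decidable (D i x)] :
    twOp s D q i (Finsupp.single x c) =
      if D i x then -Finsupp.single x c else Finsupp.single (x * s i) (q i x * c) := by
  split_ifs with h
  · exact twOp_pos h c
  · exact twOp_neg h c

theorem twOp_quad (q : S → W → ℂ) (i : S) (hD : ∀ x, ¬ D i x → D i (x * s i)) :
    twOp s D q i * twOp s D q i = -twOp s D q i := by
  classical
  refine Finsupp.lhom_ext' fun x => LinearMap.ext_ring ?_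
  by_cases h : D i x
  · simp [twOp_pos h]
  · simp [twOp_neg h, twOp_pos (hD x h)]

theorem twOp_comm (q : S → W → ℂ) (i j : S) (hij : s i * s j = s j * s i)
    (hDi : ∀ x, D i (x * s j) ↔ D i x) (hDj : ∀ x, D j (x * s i) ↔ D j x)
    (hqi : ∀ x, q i (x * s j) = q i x) (hqj : ∀ x, q j (x * s i) = q j x) :
    twOp s D q i * twOp s D q j = twOp s D q j * twOp s D q i := by
  classical
  have hx : ∀ x, x * s i * s j = x * s j * s i := fun x => by rw [mul_assoc, hij, mul_assoc]
  refine Finsupp.lhom_ext' fun x => LinearMap.ext_ring ?_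
  by_cases h : D i x <;> by_cases h' : D j x <;>
    simp [-Finsupp.single_mul, twOp_single, h, h', hDi, hDj, hqi, hqj, hx, mul_comm]

theorem twOp_braid3 {L : Type} [LinearOrder L] (q : S → W → ℂ) (i j : S)
    (hij : s i * s j * s i = s j * s i * s j)
    (a b c : W → L) (Q : L → L → ℂ)
    (hab : ∀ x, a x ≠ b x) (hac : ∀ x, a x ≠ c x) (hbc : ∀ x, b x ≠ c x)
    (hDi : ∀ x, D i x ↔ b x < a x) (hDj : ∀ x, D j x ↔ c x < b x)
    (hqi : ∀ x, q i x = Q (a x) (b x)) (hqj : ∀ x, q j x = Q (b x) (c x))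
    (ha1 : ∀ x, a (x * s i) = b x) (hb1 : ∀ x, b (x * s i) = a x) (hc1 : ∀ x, c (x * s i) = c x)
    (ha2 : ∀ x, a (x * s j) = a x) (hb2 : ∀ x, b (x * s j) = c x) (hc2 : ∀ x, c (x * s j) = b x) :
    twOp s D q i * twOp s D q j * twOp s D q i = twOp s D q j * twOp s D q i * twOp s D q j := by
  classical
  have hx : ∀ x, x * s i * s j * s i = x * s j * s i * s j := fun x => by
    rw [mul_assoc, mul_assoc, ← mul_assoc (s i), hij, ← mul_assoc, ← mul_assoc]
  refine Finsupp.lhom_ext' fun x => LinearMap.ext_ring ?_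
  rcases (hab x).lt_or_gt with h1 | h1 <;> rcases (hac x).lt_or_gt with h2 | h2 <;>
    rcases (hbc x).lt_or_gt with h3 | h3 <;>
    first
    | exact absurd (h1.trans h3) h2.not_gt
    | exact absurd (h3.trans h1) h2.not_gt
    | simp [-Finsupp.single_mul, twOp_single, hDi, hDj, hqi, hqj, ha1, hb1, hc1, ha2, hb2, hc2, hx, h1, h2, h3,
        h1.not_gt, h2.not_gt, h3.not_gt, mul_comm, mul_left_comm]

theorem twOp_braid4 (q : S → W → ℂ) (i j : S)
    (hij : s i * s j * s i * s j = s j * s i * s j * s i)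
    (a b : W → ℤ) (Q : ℤ → ℤ → ℂ) (hQ : ∀ u v, Q (-v) (-u) = Q u v)
    (ha : ∀ x, a x ≠ 0) (hb : ∀ x, b x ≠ 0) (hab : ∀ x, a x ≠ b x) (hab' : ∀ x, a x ≠ - b x)
    (hDi : ∀ x, D i x ↔ a x < 0) (hDj : ∀ x, D j x ↔ b x < a x)
    (hqi : ∀ x, q i x = Q (-a x) (a x)) (hqj : ∀ x, q j x = Q (a x) (b x))
    (ha1 : ∀ x, a (x * s i) = - a x) (hb1 : ∀ x, b (x * s i) = b x)
    (ha2 : ∀ x, a (x * s j) = b x) (hb2 : ∀ x, b (x * s j) = a x) :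
    twOp s D q i * twOp s D q j * twOp s D q i * twOp s D q j =
      twOp s D q j * twOp s D q i * twOp s D q j * twOp s D q i := by
  classical
  have hx : ∀ x, x * s i * s j * s i * s j = x * s j * s i * s j * s i := fun x => by
    simpa [mul_assoc] using congrArg (x * ·) hij
  have hQ1 : ∀ u v, Q (-v) u = Q (-u) v := fun u v => by simpa using hQ (-u) v
  refine Finsupp.lhom_ext' fun x => LinearMap.ext_ring ?_
  have key : ∀ u v : ℤ, u ≠ 0 → v ≠ 0 → u ≠ v → u ≠ -v → a x = u → b x = v →
      (twOp s D q i * twOp s D q j * twOp s D q i * twOp s D q j) (Finsupp.single x 1) =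
      (twOp s D q j * twOp s D q i * twOp s D q j * twOp s D q i) (Finsupp.single x 1) := by
    intro u v hu hv huv huv' hau hbv
    rcases hu.lt_or_gt with h1 | h1 <;> rcases hv.lt_or_gt with h2 | h2 <;>
      rcases huv.lt_or_gt with h3 | h3 <;> rcases huv'.lt_or_gt with h4 | h4 <;>
      first
      | omega
      | (have h5 := h1.not_gt
         have h6 := h2.not_gt
         have h7 := h3.not_gt
         have h8 := h4.not_gt
         have h9 : (-u < v) ∨ ¬ (-u < v) := em _
         have h10 : (v < -u) ∨ ¬ (v < -u) := em _
         rcases h9 with h9 | h9 <;> rcases h10 with h10 | h10 <;>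
         first
         | omega
         | simp [-Finsupp.single_mul, twOp_single, hDi, hDj, hqi, hqj, ha1, hb1, ha2, hb2, hx, hau, hbv, h1, h2, h3, h4,
            h5, h6, h7, h8, h9, h10, hQ, mul_comm, mul_left_comm, mul_assoc (G := ℂ), hQ1 u v])
  exact key _ _ (ha x) (hb x) (hab x) (hab' x) rfl rfl

/-- The inclusion of the span of `X` intertwines `setOp` and `twOp`. -/
theorem setOp_incl {X : Set W} {q : S → W → ℂ} {i : S}
    (h1 : ∀ x ∈ X, ¬ D i x → x * s i ∈ X → q i x = 1)
    (h0 : ∀ x ∈ X, ¬ D i x → x * s i ∉ X → q i x = 0) (v : X →₀ ℂ) :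
    Finsupp.lmapDomain ℂ ℂ Subtype.val (setOp s D X i v) =
      twOp s D q i (Finsupp.lmapDomain ℂ ℂ Subtype.val v) := by
  classical
  have : (Finsupp.lmapDomain ℂ ℂ Subtype.val).comp (setOp s D X i) =
      (twOp s D q i).comp (Finsupp.lmapDomain ℂ ℂ Subtype.val) := by
    refine Finsupp.lhom_ext' fun x => LinearMap.ext_ring ?_
    by_cases h : D i x
    · have : setOp s D X i (Finsupp.single x 1) = -Finsupp.single x 1 := by simp [setOp, h]
      simp only [LinearMap.comp_apply, Finsupp.lsingle_apply, this, map_neg]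
      simp [Finsupp.mapDomain_single, twOp_pos h]
    · by_cases h' : (x : W) * s i ∈ X
      · simp [setOp, h, h', twOp_neg h, h1 x x.2 h h', Finsupp.mapDomain_single]
      · simp [setOp, h, h', twOp_neg h, h0 x x.2 h h', Finsupp.mapDomain_single]
  exact LinearMap.congr_fun this v

theorem setOp_word {X : Set W} {q : S → W → ℂ}
    (h1 : ∀ i, ∀ x ∈ X, ¬ D i x → x * s i ∈ X → q i x = 1)
    (h0 : ∀ i, ∀ x ∈ X, ¬ D i x → x * s i ∉ X → q i x = 0) (l : List S) (v : X →₀ ℂ) :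
    Finsupp.lmapDomain ℂ ℂ Subtype.val
        ((wordProd (fun i => MulOpposite.op (setOp s D X i)) l).unop v) =
      (wordProd (fun i => MulOpposite.op (twOp s D q i)) l).unop
        (Finsupp.lmapDomain ℂ ℂ Subtype.val v) := by
  induction l generalizing v with
  | nil => rfl
  | cons i l ih =>
    have := ih (setOp s D X i v)
    rw [setOp_incl (h1 i) (h0 i)] at this
    exact this

theorem lmapDomain_val_injective {W : Type} (X : Set W) :
    Function.Injective (Finsupp.lmapDomain ℂ ℂ (Subtype.val : X → W)) :=
  Finsupp.mapDomain_injective Subtype.val_injective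

/-- The relations of the 0-Hecke algebra pass from `twOp` to `setOp`. -/
theorem setOp_quad {X : Set W} (i : S) (hD : ∀ x, ¬ D i x → D i (x * s i)) :
    MulOpposite.op (setOp s D X i) * MulOpposite.op (setOp s D X i) =
      -MulOpposite.op (setOp s D X i) := by
  classical
  rw [← MulOpposite.op_mul, ← MulOpposite.op_neg]
  congr 1
  refine Finsupp.lhom_ext' fun x => LinearMap.ext_ring ?_
  by_cases h : D i x
  · simp [setOp, h]
  · by_cases h' : (x : W) * s i ∈ X
    · simp [setOp, h, h', hD x h]
    · simp [setOp, h, h']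

theorem setOp_braid {X : Set W} {q : S → W → ℂ}
    (h1 : ∀ i, ∀ x ∈ X, ¬ D i x → x * s i ∈ X → q i x = 1)
    (h0 : ∀ i, ∀ x ∈ X, ¬ D i x → x * s i ∉ X → q i x = 0) (l l' : List S)
    (h : wordProd (fun i => MulOpposite.op (twOp s D q i)) l =
      wordProd (fun i => MulOpposite.op (twOp s D q i)) l') :
    wordProd (fun i => MulOpposite.op (setOp s D X i)) l =
      wordProd (fun i => MulOpposite.op (setOp s D X i)) l' := by
  apply MulOpposite.unop_injective
  ext1 v
  refine LinearMap.ext_ring ?_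
  apply lmapDomain_val_injective X
  simp only [LinearMap.comp_apply]
  rw [setOp_word h1 h0, setOp_word h1 h0, h]

end SetAction

/-! ### Permutations and signed permutations -/

/-- The set `[n] = {1, …, n}`. -/
abbrev PInt (n : ℕ) : Type := {i : ℤ // 1 ≤ i ∧ i ≤ n}

/-- The set `[-n, n]`. -/
abbrev SInt (n : ℕ) : Type := {i : ℤ // -(n : ℤ) ≤ i ∧ i ≤ n}

instance (n : ℕ) : Neg (SInt n) := ⟨fun i => ⟨-i.1, by have := i.2; omega⟩⟩

@[simp] theorem SInt.val_neg {n : ℕ} (i : SInt n) : (-i).1 = -i.1 := rfl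

/-- The group of signed permutations of `[n]`, as permutations `σ` of `[-n, n]` with
`σ (-i) = -σ i` for all `i`; in particular `σ 0 = 0`. -/
def SPerm (n : ℕ) : Subgroup (Equiv.Perm (SInt n)) where
  carrier := {σ | ∀ i, σ (-i) = -σ i}
  one_mem' := fun _ => rfl
  mul_mem' := by
    intro σ τ hσ hτ i
    rw [Equiv.Perm.mul_apply, hτ i, hσ (τ i), Equiv.Perm.mul_apply]
  inv_mem' := by
    intro σ hσ i
    rw [Equiv.Perm.inv_eq_iff_eq, hσ]
    exact congrArg Neg.neg (σ.apply_symm_apply i).symm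

/-- The simple transposition exchanging `j + 1` and `j + 2`. -/
def simpleA (n : ℕ) (j : Fin (n - 1)) : Equiv.Perm (PInt n) :=
  Equiv.swap ⟨(j : ℕ) + 1, by omega⟩ ⟨(j : ℕ) + 2, by omega⟩

/-- `j + 1` and `j + 2` form a descent of `γ`: one has `γ (j + 1) > γ (j + 2)`. -/
def DescA (n : ℕ) (j : Fin (n - 1)) (γ : Equiv.Perm (PInt n)) : Prop :=
  γ ⟨(j : ℕ) + 2, by omega⟩ < γ ⟨(j : ℕ) + 1, by omega⟩

/-- The element `i` of `[-n, n]`. -/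
def lo {n : ℕ} (i : Fin n) : SInt n := ⟨(i : ℕ), by omega⟩

/-- The element `i + 1` of `[-n, n]`. -/
def hi {n : ℕ} (i : Fin n) : SInt n := ⟨(i : ℕ) + 1, by omega⟩

/-- The permutation of `[-n, n]` underlying the simple generator `i` of type `B`: it exchanges
`1` and `-1` for `i = 0`, and otherwise `i` and `i + 1` as well as `-i` and `-(i + 1)`. -/
def simpleBPerm (n : ℕ) (i : Fin n) : Equiv.Perm (SInt n) :=
  if (i : ℕ) = 0 then Equiv.swap (-hi i) (hi i)
  else Equiv.swap (lo i) (hi i) * Equiv.swap (-lo i) (-hi i)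

theorem simpleBPerm_val (n : ℕ) (i : Fin n) (x : SInt n) :
    (simpleBPerm n i x).1 =
      if x.1 = (i : ℕ) + 1 then (if (i : ℕ) = 0 then -1 else ((i : ℕ) : ℤ))
      else if x.1 = -((i : ℕ) + 1) then (if (i : ℕ) = 0 then 1 else -((i : ℕ) : ℤ))
      else if x.1 = (i : ℕ) ∧ (i : ℕ) ≠ 0 then (i : ℕ) + 1
      else if x.1 = -(i : ℕ) ∧ (i : ℕ) ≠ 0 then -((i : ℕ) + 1)
      else x.1 := by
  unfold simpleBPerm
  by_cases h : (i : ℕ) = 0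
  · simp only [h, if_true, Equiv.swap_apply_def, Subtype.ext_iff, lo, hi, SInt.val_neg]
    split_ifs <;> simp_all
  · simp only [h, if_false, Equiv.Perm.mul_apply, Equiv.swap_apply_def, Subtype.ext_iff, lo, hi,
      SInt.val_neg, apply_ite (Subtype.val (p := fun i : ℤ => -(n : ℤ) ≤ i ∧ i ≤ n))]
    split_ifs <;> omega

/-- The simple generators of the group of signed permutations. -/
def simpleB (n : ℕ) (i : Fin n) : SPerm n := ⟨simpleBPerm n i, by
  intro x
  rw [Subtype.ext_iff, SInt.val_neg, simpleBPerm_val, simpleBPerm_val, SInt.val_neg]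
  split_ifs <;> omega⟩

/-- `i` is a descent of the signed permutation `γ`: one has `γ i > γ (i + 1)`, where
`γ 0 = 0`. -/
def DescB (n : ℕ) (i : Fin n) (γ : SPerm n) : Prop := γ.1 (hi i) < γ.1 (lo i)

/-- The length of a signed permutation: the least length of a word in the simple generators
that represents it. -/
noncomputable def lengthB {n : ℕ} (w : SPerm n) : ℕ :=
  sInf {k | ∃ l : List (Fin n), l.length = k ∧ wordProd (simpleB n) l = w}

/-- The minimal length representatives of the right cosets `W_I δ`, where `W` is the group of
signed permutations of `[m + n]` and `W_I` is its parabolic subgroup generated by all simple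
generators but the one with index `m`. -/
def minReps (m n : ℕ) : Set (SPerm (m + n)) :=
  {δ | ∀ w ∈ Subgroup.closure {s | ∃ i : Fin (m + n), (i : ℕ) ≠ m ∧ s = simpleB (m + n) i},
    lengthB δ ≤ lengthB (w * δ)}

/-! ### Posets and their sets of linear extensions -/

/-- A poset on `[n]`. (This is not a type class, so that `≤` always denotes the order of the
integers, and the order of a poset `P` is written `P.le`.) -/
structure APoset (n : ℕ) extends PartialOrder (PInt n)

/-- A `Bₙ` poset: a partial order on `[-n, n]` such that `i ≤ j` if and only if `-j ≤ -i`. -/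
structure BPoset (n : ℕ) extends PartialOrder (SInt n) where
  le_iff_neg : ∀ i j, le i j ↔ le (-j) (-i)

/-- `E` is a linear extension of `P`: a total order that contains `P`. -/
def IsLinExt {X : Type} (P E : PartialOrder X) : Prop :=
  (∀ i j, E.le i j ∨ E.le j i) ∧ ∀ i j, P.le i j → E.le i j

/-- The set `Σ_R(P)` of the permutations `γ` of `[n]` such that `γ 1 ≤ γ 2 ≤ ⋯ ≤ γ n` in some
linear extension of `P`. -/
def SigmaA {n : ℕ} (P : APoset n) : Set (Equiv.Perm (PInt n)) :=
  {γ | ∃ E : APoset n, IsLinExt P.toPartialOrder E.toPartialOrder ∧ ∀ i j, i ≤ j → E.le (γ i) (γ j)}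

/-- The set `Σᴮ_R(P)` of the signed permutations `γ` for which there is a type-`B` linear
extension `E` of `P` (a linear extension that is a `Bₙ` poset) such that `i < j` in `E` if and
only if `γ⁻¹ i < γ⁻¹ j`. -/
def SigmaB {n : ℕ} (P : BPoset n) : Set (SPerm n) :=
  {γ | ∃ E : BPoset n, IsLinExt P.toPartialOrder E.toPartialOrder ∧
    ∀ i j, E.lt i j ↔ (γ⁻¹).1 i < (γ⁻¹).1 j}

theorem mem_SigmaA_iff {n : ℕ} (P : APoset n) (γ : Equiv.Perm (PInt n)) :
    γ ∈ SigmaA P ↔ ∀ i j, P.le (γ i) (γ j) → i ≤ j := by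
  constructor
  · rintro ⟨E, hE, h⟩ i j hij
    by_contra hlt
    have h1 := h j i (not_le.1 hlt).le
    have h2 := γ.injective (E.le_antisymm _ _ (hE.2 _ _ hij) h1)
    exact hlt h2.le
  · intro h
    refine ⟨⟨PartialOrder.lift γ.symm γ.symm.injective⟩, ⟨fun i j => le_total (γ.symm i) (γ.symm j), ?_⟩, ?_⟩
    · intro i j hij
      exact h _ _ (by simpa using hij)
    · intro i j hij
      change γ.symm (γ i) ≤ γ.symm (γ j)
      simpa using hij

theorem SPerm.inv_neg {n : ℕ} (γ : SPerm n) (i : SInt n) : (γ⁻¹).1 (-i) = -(γ⁻¹).1 i :=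
  (γ⁻¹).2 i

theorem SInt.neg_le_neg_iff {n : ℕ} (i j : SInt n) : -j ≤ -i ↔ i ≤ j := by
  simp [← Subtype.coe_le_coe]

theorem mem_SigmaB_iff {n : ℕ} (P : BPoset n) (γ : SPerm n) :
    γ ∈ SigmaB P ↔ ∀ i j, P.le (γ.1 i) (γ.1 j) → i ≤ j := by
  have hi' : ∀ i, (γ⁻¹).1 (γ.1 i) = i := fun i => γ.1.symm_apply_apply i
  constructor
  · rintro ⟨E, hE, h⟩ i j hij
    by_contra hlt
    have h1 := (h (γ.1 j) (γ.1 i)).2 (by rw [hi', hi']; exact not_le.1 hlt)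
    exact ((E.lt_iff_le_not_ge _ _).1 h1).2 (hE.2 _ _ hij)
  · intro h
    refine ⟨{ PartialOrder.lift (γ⁻¹).1 (γ⁻¹).1.injective with le_iff_neg := ?_ },
      ⟨fun i j => le_total ((γ⁻¹).1 i) ((γ⁻¹).1 j), ?_⟩, ?_⟩
    · intro i j
      change (γ⁻¹).1 i ≤ (γ⁻¹).1 j ↔ (γ⁻¹).1 (-j) ≤ (γ⁻¹).1 (-i)
      rw [SPerm.inv_neg, SPerm.inv_neg, SInt.neg_le_neg_iff]
    · intro i j hij
      refine h ((γ⁻¹).1 i) ((γ⁻¹).1 j) ?_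
      have hk : ∀ i, γ.1 ((γ⁻¹).1 i) = i := fun i => γ.1.apply_symm_apply i
      rw [hk, hk]; exact hij
    · intro i j
      rfl

/-! ### Poset modules -/

theorem wordProd_alt2 {R S : Type} [Monoid R] (T : S → R) (i j : S) (h : T i * T j = T j * T i) :
    wordProd (fun i => MulOpposite.op (T i)) (CoxeterSystem.alternatingWord i j 2) =
      wordProd (fun i => MulOpposite.op (T i)) (CoxeterSystem.alternatingWord j i 2) := by
  simp [CoxeterSystem.alternatingWord, wordProd, ← MulOpposite.op_mul, h]

theorem wordProd_alt3 {R S : Type} [Monoid R] (T : S → R) (i j : S)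
    (h : T i * T j * T i = T j * T i * T j) :
    wordProd (fun i => MulOpposite.op (T i)) (CoxeterSystem.alternatingWord i j 3) =
      wordProd (fun i => MulOpposite.op (T i)) (CoxeterSystem.alternatingWord j i 3) := by
  simp [CoxeterSystem.alternatingWord, wordProd, ← MulOpposite.op_mul, h]

theorem wordProd_alt4 {R S : Type} [Monoid R] (T : S → R) (i j : S)
    (h : T i * T j * T i * T j = T j * T i * T j * T i) :
    wordProd (fun i => MulOpposite.op (T i)) (CoxeterSystem.alternatingWord i j 4) =
      wordProd (fun i => MulOpposite.op (T i)) (CoxeterSystem.alternatingWord j i 4) := by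
  simp [CoxeterSystem.alternatingWord, wordProd, ← MulOpposite.op_mul, h]

section ModuleA

variable {n : ℕ}

theorem simpleA_val (j : Fin (n - 1)) (x : PInt n) :
    (simpleA n j x).1 = if x.1 = (j : ℕ) + 1 then ((j : ℕ) : ℤ) + 2
      else if x.1 = (j : ℕ) + 2 then ((j : ℕ) : ℤ) + 1 else x.1 := by
  simp only [simpleA, Equiv.swap_apply_def, Subtype.ext_iff]
  split_ifs <;> rfl

/-- Evaluation at `k + 1`, for an index `k < n`. -/
def evA (k : ℕ) (hk : k < n) (γ : Equiv.Perm (PInt n)) : PInt n := γ ⟨(k : ℤ) + 1, by omega⟩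

theorem evA_mul (k : ℕ) (hk : k < n) (l : ℕ) (hl : l < n) (γ : Equiv.Perm (PInt n))
    (j : Fin (n - 1))
    (h : l = if k = (j : ℕ) then (j : ℕ) + 1 else if k = (j : ℕ) + 1 then (j : ℕ) else k) :
    evA k hk (γ * simpleA n j) = evA l hl γ := by
  unfold evA
  rw [Equiv.Perm.mul_apply]
  congr 1
  rw [Subtype.ext_iff, simpleA_val]
  split_ifs at h ⊢ <;> simp_all <;> omega

theorem evA_ne (k : ℕ) (hk : k < n) (l : ℕ) (hl : l < n) (h : k ≠ l) (γ : Equiv.Perm (PInt n)) :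
    evA k hk γ ≠ evA l hl γ := by
  intro h'
  have := Subtype.ext_iff.1 (γ.injective h')
  simp at this
  exact h this

theorem DescA_iff (j : Fin (n - 1)) (γ : Equiv.Perm (PInt n)) :
    DescA n j γ ↔ evA (j + 1) (by omega) γ < evA j (by omega) γ := by
  unfold DescA evA
  have : (⟨(j : ℕ) + 2, by omega⟩ : PInt n) = ⟨((j + 1 : ℕ) : ℤ) + 1, by omega⟩ := by
    rw [Subtype.mk.injEq]; push_cast; ring
  rw [this]

open Classical in
/-- The deformation parameter attached to a poset. -/
noncomputable def qA (P : APoset n) (j : Fin (n - 1)) (γ : Equiv.Perm (PInt n)) : ℂ :=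
  if P.le (evA j (by omega) γ) (evA (j + 1) (by omega) γ) then 0 else 1

theorem simpleA_cases (j : Fin (n - 1)) (x y : PInt n) (h : simpleA n j x = y) :
    (x.1 = (j : ℕ) + 1 ∧ y.1 = (j : ℕ) + 2) ∨ (x.1 = (j : ℕ) + 2 ∧ y.1 = (j : ℕ) + 1) ∨
      (x.1 ≠ (j : ℕ) + 1 ∧ x.1 ≠ (j : ℕ) + 2 ∧ y.1 = x.1) := by
  rw [← h, simpleA_val]
  split_ifs <;> omega

theorem simpleA_comm (i j : Fin (n - 1)) (h : (i : ℕ) + 1 < j) :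
    simpleA n i * simpleA n j = simpleA n j * simpleA n i := by
  ext x
  simp only [Equiv.Perm.mul_apply]
  have a1 := simpleA_cases j x _ rfl
  have a2 := simpleA_cases i (simpleA n j x) _ rfl
  have b1 := simpleA_cases i x _ rfl
  have b2 := simpleA_cases j (simpleA n i x) _ rfl
  omega

theorem simpleA_braid (i j : Fin (n - 1)) (h : (i : ℕ) + 1 = j) :
    simpleA n i * simpleA n j * simpleA n i = simpleA n j * simpleA n i * simpleA n j := by
  ext x
  simp only [Equiv.Perm.mul_apply]
  have a1 := simpleA_cases i x _ rfl
  have a2 := simpleA_cases j (simpleA n i x) _ rfl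
  have a3 := simpleA_cases i (simpleA n j (simpleA n i x)) _ rfl
  have b1 := simpleA_cases j x _ rfl
  have b2 := simpleA_cases i (simpleA n j x) _ rfl
  have b3 := simpleA_cases j (simpleA n i (simpleA n j x)) _ rfl
  rcases a1 with a1 | a1 | a1 <;> rcases a2 with a2 | a2 | a2 <;> try omega

theorem twOpA_comm (P : APoset n) (i j : Fin (n - 1)) (h : (i : ℕ) + 1 < j) :
    twOp (simpleA n) (DescA n) (qA P) i * twOp (simpleA n) (DescA n) (qA P) j =
      twOp (simpleA n) (DescA n) (qA P) j * twOp (simpleA n) (DescA n) (qA P) i := by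
  have e1 : ∀ γ, evA i (by omega) (γ * simpleA n j) = evA i (by omega) γ := fun γ =>
    evA_mul _ _ _ _ γ j (by split_ifs <;> omega)
  have e2 : ∀ γ, evA (i + 1) (by omega) (γ * simpleA n j) = evA (i + 1) (by omega) γ := fun γ =>
    evA_mul _ _ _ _ γ j (by split_ifs <;> omega)
  have e3 : ∀ γ, evA j (by omega) (γ * simpleA n i) = evA j (by omega) γ := fun γ =>
    evA_mul _ _ _ _ γ i (by split_ifs <;> omega)
  have e4 : ∀ γ, evA (j + 1) (by omega) (γ * simpleA n i) = evA (j + 1) (by omega) γ := fun γ =>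
    evA_mul _ _ _ _ γ i (by split_ifs <;> omega)
  refine twOp_comm _ _ _ (simpleA_comm i j h) ?_ ?_ ?_ ?_
  · intro γ; rw [DescA_iff, DescA_iff, e1, e2]
  · intro γ; rw [DescA_iff, DescA_iff, e3, e4]
  · intro γ; rw [qA, qA, e1, e2]
  · intro γ; rw [qA, qA, e3, e4]

open Classical in
theorem twOpA_braid (P : APoset n) (i j : Fin (n - 1)) (h : (i : ℕ) + 1 = j) :
    twOp (simpleA n) (DescA n) (qA P) i * twOp (simpleA n) (DescA n) (qA P) j *
        twOp (simpleA n) (DescA n) (qA P) i =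
      twOp (simpleA n) (DescA n) (qA P) j * twOp (simpleA n) (DescA n) (qA P) i *
        twOp (simpleA n) (DescA n) (qA P) j := by
  obtain ⟨j, hj⟩ := j
  simp only at h
  subst h
  refine twOp_braid3 (qA P) i ⟨i + 1, hj⟩ (simpleA_braid _ _ rfl) (evA i (by omega))
    (evA (i + 1) (by omega)) (evA (i + 1 + 1) (by omega)) (fun u v => if P.le u v then 0 else 1)
    (evA_ne _ _ _ _ (by omega)) (evA_ne _ _ _ _ (by omega)) (evA_ne _ _ _ _ (by omega))
    (DescA_iff i) (DescA_iff ⟨i + 1, hj⟩) (fun _ => rfl) (fun _ => rfl) ?_ ?_ ?_ ?_ ?_ ?_ <;>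
  · intro γ
    refine evA_mul _ _ _ _ γ _ ?_
    try dsimp only
    split_ifs <;> omega

theorem coxA_cases (i j : Fin (n - 1)) (h : i ≠ j) :
    (CoxeterMatrix.A (n - 1) i j = 3 ∧ ((i : ℕ) + 1 = j ∨ (j : ℕ) + 1 = i)) ∨
      (CoxeterMatrix.A (n - 1) i j = 2 ∧ ((i : ℕ) + 1 < j ∨ (j : ℕ) + 1 < i)) := by
  simp only [CoxeterMatrix.A, Matrix.of_apply, if_neg h]
  have h := Fin.ext_iff.not.1 h
  split_ifs with h'
  · exact Or.inl ⟨rfl, h'.symm⟩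
  · exact Or.inr ⟨rfl, by omega⟩

/-- The operators of the poset module of a poset on `[n]` satisfy the relations of `Hₙ(0)`. -/
theorem setOpA_braid (P : APoset n) (i j : Fin (n - 1)) (h : i ≠ j) :
    wordProd (fun i => MulOpposite.op (setOp (simpleA n) (DescA n) (SigmaA P) i))
        (CoxeterSystem.alternatingWord i j (CoxeterMatrix.A (n - 1) i j)) =
      wordProd (fun i => MulOpposite.op (setOp (simpleA n) (DescA n) (SigmaA P) i))
        (CoxeterSystem.alternatingWord j i (CoxeterMatrix.A (n - 1) i j)) := by
  refine setOp_braid (q := qA P) ?_ ?_ _ _ ?_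
  · intro j γ _ _ hs
    rw [qA, if_neg]
    intro hle
    have := (mem_SigmaA_iff P _).1 hs ⟨((j + 1 : ℕ) : ℤ) + 1, by omega⟩ ⟨((j : ℕ) : ℤ) + 1, by omega⟩
    change P.le (evA (j + 1) (by omega) (γ * simpleA n j)) (evA j (by omega) (γ * simpleA n j)) →
      _ at this
    rw [evA_mul (j + 1) _ j (by omega) γ j (by simp), evA_mul j _ (j + 1) (by omega) γ j (by simp)]
      at this
    have := this hle
    rw [Subtype.mk_le_mk] at this
    omega
  · intro j γ hγ _ hs
    rw [qA, if_pos]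
    by_contra hle
    refine hs ((mem_SigmaA_iff P _).2 fun x y hxy => ?_)
    rw [Equiv.Perm.mul_apply, Equiv.Perm.mul_apply] at hxy
    have h1 := (mem_SigmaA_iff P _).1 hγ _ _ hxy
    by_contra hlt
    refine hle ?_
    rw [← Subtype.coe_le_coe] at h1 hlt
    have h2 : (simpleA n j x).1 = (j : ℕ) + 1 ∧ (simpleA n j y).1 = ((j + 1 : ℕ) : ℤ) + 1 := by
      rw [simpleA_val, simpleA_val] at h1 ⊢
      split_ifs at h1 ⊢ <;> omega
    unfold evA
    convert hxy using 2
    · exact Subtype.ext h2.1.symm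
    · exact Subtype.ext h2.2.symm
  · rcases coxA_cases i j h with ⟨h1, h2 | h2⟩ | ⟨h1, h2 | h2⟩ <;> rw [h1]
    · exact wordProd_alt3 _ _ _ (twOpA_braid P i j h2)
    · exact wordProd_alt3 _ _ _ (twOpA_braid P j i h2).symm
    · exact wordProd_alt2 _ _ _ (twOpA_comm P i j h2)
    · exact wordProd_alt2 _ _ _ (twOpA_comm P j i h2).symm

theorem setOpA_quad (P : APoset n) (i : Fin (n - 1)) :
    MulOpposite.op (setOp (simpleA n) (DescA n) (SigmaA P) i) *
      MulOpposite.op (setOp (simpleA n) (DescA n) (SigmaA P) i) =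
      -MulOpposite.op (setOp (simpleA n) (DescA n) (SigmaA P) i) := by
  refine setOp_quad i fun γ h => ?_
  rw [DescA_iff] at h ⊢
  rw [evA_mul i _ (i + 1) (by omega) γ i (by simp), evA_mul (i + 1) _ i (by omega) γ i (by simp)]
  exact lt_of_le_of_ne (not_lt.1 h) (evA_ne _ _ _ _ (by omega) γ)

/-- The poset module `M_P` of a poset `P` on `[n]`: the complex vector space with basis
`Σ_R(P)`. -/
abbrev ModA (P : APoset n) : Type := SigmaA P →₀ ℂ

/-- The basis element of `M_P` given by `γ ∈ Σ_R(P)`. -/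
noncomputable def ModA.basisElt {P : APoset n} (γ : SigmaA P) : ModA P :=
  Finsupp.single γ (1 : ℂ)

/-- The homomorphism by which `Hₙ(0)` acts from the right on `M_P`: the generator `π_i` acts by
the operator `setOp`. -/
noncomputable def ModA.action (P : APoset n) :
    HA n →ₐ[ℂ] (Module.End ℂ (ModA P))ᵐᵒᵖ :=
  ZeroHecke.lift _
    (fun i => MulOpposite.op (setOp (simpleA n) (DescA n) (SigmaA P) i))
    (setOpA_quad P) (fun i j h _ => setOpA_braid P i j h)

noncomputable instance (P : APoset n) : Module (HA n)ᵐᵒᵖ (ModA P) :=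
  Module.compHom _ (AlgHom.opComm (ModA.action P)).toRingHom

instance (P : APoset n) : IsScalarTower ℂ (HA n)ᵐᵒᵖ (ModA P) where
  smul_assoc c x v := by
    change AlgHom.opComm (ModA.action P) (c • x) v = c • AlgHom.opComm (ModA.action P) x v
    rw [map_smul]; rfl

open Classical in
/-- The action of the generators on the basis of `M_P`. -/
theorem ModA.gen_smul (P : APoset n) (i : Fin (n - 1)) (γ : SigmaA P) :
    MulOpposite.op (ZeroHecke.gen _ i : HA n) • ModA.basisElt γ =
      if DescA n i γ then -ModA.basisElt γ
      else if h : (γ : Equiv.Perm (PInt n)) * simpleA n i ∈ SigmaA P then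
        ModA.basisElt ⟨γ * simpleA n i, h⟩
      else 0 := by
  have h1 : ModA.action P (ZeroHecke.gen _ i) = _ := ZeroHecke.lift_gen _ _ _ _ i
  change (ModA.action P (ZeroHecke.gen _ i)).unop (Finsupp.single γ 1) = _
  rw [h1]
  refine (Finsupp.linearCombination_single ℂ (1 : ℂ) γ).trans ?_
  rw [one_smul]
  rfl

end ModuleA

section ModuleB

variable {n : ℕ}

theorem simpleBPerm_cases (i : Fin n) (x y : SInt n) (h : simpleBPerm n i x = y) :
    (x.1 = (i : ℕ) + 1 ∧ (i : ℕ) = 0 ∧ y.1 = -1) ∨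
      (x.1 = (i : ℕ) + 1 ∧ (i : ℕ) ≠ 0 ∧ y.1 = (i : ℕ)) ∨
      (x.1 = -((i : ℕ) + 1) ∧ (i : ℕ) = 0 ∧ y.1 = 1) ∨
      (x.1 = -((i : ℕ) + 1) ∧ (i : ℕ) ≠ 0 ∧ y.1 = -(i : ℕ)) ∨
      (x.1 = (i : ℕ) ∧ (i : ℕ) ≠ 0 ∧ y.1 = (i : ℕ) + 1) ∨
      (x.1 = -(i : ℕ) ∧ (i : ℕ) ≠ 0 ∧ y.1 = -((i : ℕ) + 1)) ∨
      (x.1 ≠ (i : ℕ) + 1 ∧ x.1 ≠ -((i : ℕ) + 1) ∧ (x.1 = (i : ℕ) → (i : ℕ) = 0) ∧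
        (x.1 = -(i : ℕ) → (i : ℕ) = 0) ∧ y.1 = x.1) := by
  rw [← h, simpleBPerm_val]
  split_ifs <;> omega

theorem simpleBPerm_eq (i : Fin n) (x y : SInt n)
    (h : ∀ z : ℤ, ((x.1 = (i : ℕ) + 1 ∧ (i : ℕ) = 0 ∧ z = -1) ∨
      (x.1 = (i : ℕ) + 1 ∧ (i : ℕ) ≠ 0 ∧ z = (i : ℕ)) ∨
      (x.1 = -((i : ℕ) + 1) ∧ (i : ℕ) = 0 ∧ z = 1) ∨
      (x.1 = -((i : ℕ) + 1) ∧ (i : ℕ) ≠ 0 ∧ z = -(i : ℕ)) ∨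
      (x.1 = (i : ℕ) ∧ (i : ℕ) ≠ 0 ∧ z = (i : ℕ) + 1) ∨
      (x.1 = -(i : ℕ) ∧ (i : ℕ) ≠ 0 ∧ z = -((i : ℕ) + 1)) ∨
      (x.1 ≠ (i : ℕ) + 1 ∧ x.1 ≠ -((i : ℕ) + 1) ∧ (x.1 = (i : ℕ) → (i : ℕ) = 0) ∧
        (x.1 = -(i : ℕ) → (i : ℕ) = 0) ∧ z = x.1)) → z = y.1) :
    (simpleBPerm n i x).1 = y.1 :=
  h _ (simpleBPerm_cases i x _ rfl)

theorem simpleB_comm (i j : Fin n) (h : (i : ℕ) + 1 < j) :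
    simpleB n i * simpleB n j = simpleB n j * simpleB n i := by
  apply Subtype.ext
  ext x
  change (simpleBPerm n i (simpleBPerm n j x)).1 = (simpleBPerm n j (simpleBPerm n i x)).1
  have a1 := simpleBPerm_cases j x _ rfl
  have a2 := simpleBPerm_cases i (simpleBPerm n j x) _ rfl
  have b1 := simpleBPerm_cases i x _ rfl
  have b2 := simpleBPerm_cases j (simpleBPerm n i x) _ rfl
  rcases a1 with a1 | a1 | a1 | a1 | a1 | a1 | a1 <;>
    rcases a2 with a2 | a2 | a2 | a2 | a2 | a2 | a2 <;> try omega

theorem simpleB_braid3 (i j : Fin n) (h : (i : ℕ) + 1 = j) (h0 : (i : ℕ) ≠ 0) :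
    simpleB n i * simpleB n j * simpleB n i = simpleB n j * simpleB n i * simpleB n j := by
  apply Subtype.ext
  ext x
  change (simpleBPerm n i (simpleBPerm n j (simpleBPerm n i x))).1 =
    (simpleBPerm n j (simpleBPerm n i (simpleBPerm n j x))).1
  have h1 : (j : ℕ) ≠ 0 := by omega
  have key : ∀ (k : Fin n) (x : SInt n), (k : ℕ) ≠ 0 → _ := fun k x hk => by
    have := simpleBPerm_cases k x _ rfl
    simp only [hk, false_and, and_false, false_or, ne_eq, not_false_iff, true_and,
      imp_false] at this
    exact this
  rcases key i x h0 with a1 | a1 | a1 | a1 | a1 <;>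
    rcases key j (simpleBPerm n i x) h1 with a2 | a2 | a2 | a2 | a2 <;>
    first
    | (exfalso; omega)
    | (rcases key i (simpleBPerm n j (simpleBPerm n i x)) h0 with a3 | a3 | a3 | a3 | a3 <;>
        first
        | (exfalso; omega)
        | (rcases key j x h1 with b1 | b1 | b1 | b1 | b1 <;>
            first
            | (exfalso; omega)
            | (rcases key i (simpleBPerm n j x) h0 with b2 | b2 | b2 | b2 | b2 <;>
                first
                | (exfalso; omega)
                | (rcases key j (simpleBPerm n i (simpleBPerm n j x)) h1 with
                      b3 | b3 | b3 | b3 | b3 <;> omega))))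

theorem simpleB_braid4 (i j : Fin n) (h : (j : ℕ) = 1) (h0 : (i : ℕ) = 0) :
    simpleB n i * simpleB n j * simpleB n i * simpleB n j =
      simpleB n j * simpleB n i * simpleB n j * simpleB n i := by
  apply Subtype.ext
  ext x
  change (simpleBPerm n i (simpleBPerm n j (simpleBPerm n i (simpleBPerm n j x)))).1 =
    (simpleBPerm n j (simpleBPerm n i (simpleBPerm n j (simpleBPerm n i x)))).1
  have hi' : ∀ y : SInt n, (simpleBPerm n i y).1 =
      if y.1 = 1 then -1 else if y.1 = -1 then 1 else y.1 := by
    intro y; rw [simpleBPerm_val]; simp [h0]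
  have hj' : ∀ y : SInt n, (simpleBPerm n j y).1 =
      if y.1 = 2 then 1 else if y.1 = -2 then -1 else if y.1 = 1 then 2
      else if y.1 = -1 then -2 else y.1 := by
    intro y; rw [simpleBPerm_val]; simp [h]
  simp only [hi', hj']
  by_cases c1 : x.1 = 1
  · simp [c1]
  by_cases c2 : x.1 = -1
  · simp [c2]
  by_cases c3 : x.1 = 2
  · simp [c3]
  by_cases c4 : x.1 = -2
  · simp [c4]
  simp [c1, c2, c3, c4]

/-- The value of a signed permutation as an integer. -/
def evB (x : SInt n) (γ : SPerm n) : ℤ := (γ.1 x).1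

theorem evB_neg (x : SInt n) (γ : SPerm n) : evB (-x) γ = -evB x γ := by
  unfold evB
  rw [γ.2 x, SInt.val_neg]

theorem evB_zero (x : SInt n) (hx : x.1 = 0) (γ : SPerm n) : evB x γ = 0 := by
  have h : -x = x := Subtype.ext (by rw [SInt.val_neg, hx]; rfl)
  have := evB_neg x γ
  rw [h] at this
  omega

theorem evB_ne (x y : SInt n) (h : x.1 ≠ y.1) (γ : SPerm n) : evB x γ ≠ evB y γ := by
  intro h'
  exact h (congrArg Subtype.val (γ.1.injective (Subtype.ext h')))

theorem evB_ne_neg (x y : SInt n) (h : x.1 ≠ -y.1) (γ : SPerm n) : evB x γ ≠ -evB y γ := by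
  rw [← evB_neg]
  exact evB_ne _ _ h γ

theorem evB_ne_zero (x : SInt n) (h : x.1 ≠ 0) (γ : SPerm n) : evB x γ ≠ 0 := by
  have := evB_ne_neg x x (by omega) γ
  omega

theorem evB_mul (x y : SInt n) (γ : SPerm n) (i : Fin n) (h : (simpleBPerm n i x).1 = y.1) :
    evB x (γ * simpleB n i) = evB y γ := by
  have : simpleBPerm n i x = y := Subtype.ext h
  rw [← this]
  rfl

theorem DescB_iff (i : Fin n) (γ : SPerm n) : DescB n i γ ↔ evB (hi i) γ < evB (lo i) γ := Iff.rfl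

theorem DescB_zero_iff (i : Fin n) (h : (i : ℕ) = 0) (γ : SPerm n) :
    DescB n i γ ↔ evB (hi i) γ < 0 := by
  rw [DescB_iff, evB_zero (lo i) (by simp [lo, h])]

open Classical in
/-- The deformation parameter attached to a pair of integers. -/
noncomputable def QB (P : BPoset n) (u v : ℤ) : ℂ :=
  if ∃ x y : SInt n, x.1 = u ∧ y.1 = v ∧ P.le x y then 0 else 1

theorem QB_neg (P : BPoset n) (u v : ℤ) : QB P (-v) (-u) = QB P u v := by
  unfold QB
  have : (∃ x y : SInt n, x.1 = -v ∧ y.1 = -u ∧ P.le x y) ↔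
      ∃ x y : SInt n, x.1 = u ∧ y.1 = v ∧ P.le x y := by
    constructor <;> rintro ⟨x, y, hx, hy, h⟩ <;>
      exact ⟨-y, -x, by rw [SInt.val_neg]; omega, by rw [SInt.val_neg]; omega,
        (P.le_iff_neg _ _).1 h⟩
  exact @if_congr _ _ _ (Classical.propDecidable _) (Classical.propDecidable _) _ _ _ _ this rfl rfl

theorem QB_ev (P : BPoset n) (x y : SInt n) (γ : SPerm n) :
    (¬ P.le (γ.1 x) (γ.1 y) → QB P (evB x γ) (evB y γ) = 1) ∧
      (P.le (γ.1 x) (γ.1 y) → QB P (evB x γ) (evB y γ) = 0) := by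
  constructor
  · intro h
    rw [QB, if_neg]
    rintro ⟨a, b, ha, hb, hab⟩
    rw [Subtype.ext ha, Subtype.ext hb] at hab
    exact h hab
  · intro h
    rw [QB, if_pos]
    exact ⟨_, _, rfl, rfl, h⟩

/-- The deformation parameter attached to a `Bₙ` poset. -/
noncomputable def qB (P : BPoset n) (i : Fin n) (γ : SPerm n) : ℂ :=
  if (i : ℕ) = 0 then QB P (-evB (hi i) γ) (evB (hi i) γ) else QB P (evB (lo i) γ) (evB (hi i) γ)

theorem twOpB_comm (P : BPoset n) (i j : Fin n) (h : (i : ℕ) + 1 < j) :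
    twOp (simpleB n) (DescB n) (qB P) i * twOp (simpleB n) (DescB n) (qB P) j =
      twOp (simpleB n) (DescB n) (qB P) j * twOp (simpleB n) (DescB n) (qB P) i := by
  have e1 : ∀ γ, evB (lo i) (γ * simpleB n j) = evB (lo i) γ := fun γ =>
    evB_mul _ _ γ j (by refine simpleBPerm_eq _ _ _ fun z hz => ?_; simp only [lo, hi, true_implies] at hz ⊢; omega)
  have e2 : ∀ γ, evB (hi i) (γ * simpleB n j) = evB (hi i) γ := fun γ =>
    evB_mul _ _ γ j (by refine simpleBPerm_eq _ _ _ fun z hz => ?_; simp only [lo, hi, true_implies] at hz ⊢; omega)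
  have e3 : ∀ γ, evB (lo j) (γ * simpleB n i) = evB (lo j) γ := fun γ =>
    evB_mul _ _ γ i (by refine simpleBPerm_eq _ _ _ fun z hz => ?_; simp only [lo, hi, true_implies] at hz ⊢; omega)
  have e4 : ∀ γ, evB (hi j) (γ * simpleB n i) = evB (hi j) γ := fun γ =>
    evB_mul _ _ γ i (by refine simpleBPerm_eq _ _ _ fun z hz => ?_; simp only [lo, hi, true_implies] at hz ⊢; omega)
  refine twOp_comm _ _ _ (simpleB_comm i j h) ?_ ?_ ?_ ?_
  · intro γ; rw [DescB_iff, DescB_iff, e1, e2]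
  · intro γ; rw [DescB_iff, DescB_iff, e3, e4]
  · intro γ; rw [qB, qB, e1, e2]
  · intro γ; rw [qB, qB, e3, e4]

theorem lo_succ (i j : Fin n) (h : (i : ℕ) + 1 = j) : lo j = hi i :=
  Subtype.ext (by simp only [lo, hi]; omega)

theorem twOpB_braid3 (P : BPoset n) (i j : Fin n) (h : (i : ℕ) + 1 = j) (h0 : (i : ℕ) ≠ 0) :
    twOp (simpleB n) (DescB n) (qB P) i * twOp (simpleB n) (DescB n) (qB P) j *
        twOp (simpleB n) (DescB n) (qB P) i =
      twOp (simpleB n) (DescB n) (qB P) j * twOp (simpleB n) (DescB n) (qB P) i *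
        twOp (simpleB n) (DescB n) (qB P) j := by
  have hl := lo_succ i j h
  refine twOp_braid3 (qB P) i j (simpleB_braid3 _ _ h h0) (evB (lo i)) (evB (hi i)) (evB (hi j))
    (QB P) (evB_ne _ _ ?_) (evB_ne _ _ ?_) (evB_ne _ _ ?_)
    (DescB_iff i) (fun γ => by rw [DescB_iff, hl]) (fun γ => by rw [qB, if_neg h0])
    (fun γ => by rw [qB, if_neg (by omega), hl]) ?_ ?_ ?_ ?_ ?_ ?_
  · simp only [lo, hi]; omega
  · simp only [lo, hi]; omega
  · simp only [hi]; omega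
  all_goals
    intro γ
    refine evB_mul _ _ γ _ ?_
    refine simpleBPerm_eq _ _ _ fun z hz => ?_
    simp only [lo, hi, SInt.val_neg, true_implies] at hz ⊢
    omega

theorem twOpB_braid4 (P : BPoset n) (i j : Fin n) (h : (j : ℕ) = 1) (h0 : (i : ℕ) = 0) :
    twOp (simpleB n) (DescB n) (qB P) i * twOp (simpleB n) (DescB n) (qB P) j *
        twOp (simpleB n) (DescB n) (qB P) i * twOp (simpleB n) (DescB n) (qB P) j =
      twOp (simpleB n) (DescB n) (qB P) j * twOp (simpleB n) (DescB n) (qB P) i *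
        twOp (simpleB n) (DescB n) (qB P) j * twOp (simpleB n) (DescB n) (qB P) i := by
  have hl := lo_succ i j (by omega)
  refine twOp_braid4 (qB P) i j (simpleB_braid4 _ _ h h0) (evB (hi i)) (evB (hi j))
    (QB P) (QB_neg P) (evB_ne_zero _ ?_) (evB_ne_zero _ ?_) (evB_ne _ _ ?_) (evB_ne_neg _ _ ?_)
    (DescB_zero_iff i h0) (fun γ => by rw [DescB_iff, hl]) (fun γ => by rw [qB, if_pos h0])
    (fun γ => by rw [qB, if_neg (by omega), hl]) ?_ ?_ ?_ ?_
  · simp only [hi]; omega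
  · simp only [hi]; omega
  · simp only [hi]; omega
  · simp only [hi]; omega
  · intro γ
    rw [← evB_neg]
    refine evB_mul _ _ γ _ ?_
    refine simpleBPerm_eq _ _ _ fun z hz => ?_
    simp only [lo, hi, SInt.val_neg, true_implies] at hz ⊢
    omega
  all_goals
    intro γ
    refine evB_mul _ _ γ _ ?_
    refine simpleBPerm_eq _ _ _ fun z hz => ?_
    simp only [lo, hi, SInt.val_neg, true_implies] at hz ⊢
    omega

theorem setOpB_h1 (P : BPoset n) (i : Fin n) (γ : SPerm n)
    (hs : γ * simpleB n i ∈ SigmaB P) : qB P i γ = 1 := by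
  have hs' := (mem_SigmaB_iff P _).1 hs
  rw [qB]
  split_ifs with h0
  · rw [← evB_neg]
    refine (QB_ev P _ _ γ).1 fun hle => ?_
    have e1 : simpleBPerm n i (hi i) = -hi i := by
      rw [Subtype.ext_iff, simpleBPerm_val]; simp [hi, h0]
    have e2 : simpleBPerm n i (-hi i) = hi i := by
      rw [Subtype.ext_iff, simpleBPerm_val]; simp [hi, h0]
    have := hs' (hi i) (-hi i)
    change P.le (γ.1 (simpleBPerm n i _)) (γ.1 (simpleBPerm n i _)) → _ at this
    rw [e1, e2] at this
    have := this hle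
    rw [← Subtype.coe_le_coe, SInt.val_neg] at this
    simp only [hi] at this
    omega
  · refine (QB_ev P _ _ γ).1 fun hle => ?_
    have e1 : simpleBPerm n i (hi i) = lo i := by
      rw [Subtype.ext_iff, simpleBPerm_val]; simp [hi, lo, h0]
    have e2 : simpleBPerm n i (lo i) = hi i := by
      apply Subtype.ext; refine simpleBPerm_eq _ _ _ fun z hz => ?_; simp only [lo, hi, true_implies] at hz ⊢; omega
    have := hs' (hi i) (lo i)
    change P.le (γ.1 (simpleBPerm n i _)) (γ.1 (simpleBPerm n i _)) → _ at this
    rw [e1, e2] at this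
    have := this hle
    rw [← Subtype.coe_le_coe] at this
    simp only [hi, lo] at this
    omega

theorem setOpB_h0 (P : BPoset n) (i : Fin n) (γ : SPerm n) (hγ : γ ∈ SigmaB P)
    (hs : γ * simpleB n i ∉ SigmaB P) : qB P i γ = 0 := by
  have hg := (mem_SigmaB_iff P _).1 hγ
  rw [mem_SigmaB_iff] at hs
  push Not at hs
  obtain ⟨x, y, hxy, hlt⟩ := hs
  change P.le (γ.1 (simpleBPerm n i x)) (γ.1 (simpleBPerm n i y)) at hxy
  have h1 := hg _ _ hxy
  have cx := simpleBPerm_cases i x _ rfl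
  have cy := simpleBPerm_cases i y _ rfl
  generalize simpleBPerm n i x = x' at *
  generalize simpleBPerm n i y = y' at *
  rw [← Subtype.coe_le_coe] at h1
  rw [← Subtype.coe_lt_coe] at hlt
  have hneg : ∀ a : SInt n, γ.1 (-a) = -γ.1 a := γ.2
  rw [qB]
  split_ifs with h0
  · rw [← evB_neg]
    refine (QB_ev P _ _ γ).2 ?_
    have hcase : (x'.1 = -1 ∧ y'.1 = 1) ∨ (x'.1 = -1 ∧ y'.1 = 0) ∨ (x'.1 = 0 ∧ y'.1 = 1) := by
      omega
    have hh : (hi i : SInt n).1 = 1 := by simp [hi, h0]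
    rcases hcase with ⟨hx, hy⟩ | ⟨hx, hy⟩ | ⟨hx, hy⟩
    · have e1 : x' = -hi i := Subtype.ext (by rw [hx, SInt.val_neg, hh])
      have e2 : y' = hi i := Subtype.ext (by rw [hy, hh])
      rw [e1, e2] at hxy
      exact hxy
    · have e1 : x' = -hi i := Subtype.ext (by rw [hx, SInt.val_neg, hh])
      have e2 : -y' = y' := Subtype.ext (by rw [SInt.val_neg, hy]; rfl)
      have h2 := (P.le_iff_neg _ _).1 hxy
      rw [← hneg, ← hneg, e2, e1] at h2
      have e3 : - -hi i = hi i := Subtype.ext (by simp)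
      rw [e3] at h2
      rw [e1] at hxy
      exact P.le_trans _ _ _ hxy h2
    · have e1 : y' = hi i := Subtype.ext (by rw [hy, hh])
      have e2 : -x' = x' := Subtype.ext (by rw [SInt.val_neg, hx]; rfl)
      have h2 := (P.le_iff_neg _ _).1 hxy
      rw [← hneg, ← hneg, e2, e1] at h2
      rw [e1] at hxy
      exact P.le_trans _ _ _ h2 hxy
  · refine (QB_ev P _ _ γ).2 ?_
    have hcase : (x'.1 = (i : ℕ) ∧ y'.1 = (i : ℕ) + 1) ∨
        (x'.1 = -((i : ℕ) + 1) ∧ y'.1 = -(i : ℕ)) := by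
      omega
    rcases hcase with ⟨hx, hy⟩ | ⟨hx, hy⟩
    · have e1 : x' = lo i := Subtype.ext hx
      have e2 : y' = hi i := Subtype.ext hy
      rw [e1, e2] at hxy
      exact hxy
    · have e1 : -y' = lo i := Subtype.ext (by rw [SInt.val_neg, hy]; simp [lo])
      have e2 : -x' = hi i := Subtype.ext (by rw [SInt.val_neg, hx]; simp [hi])
      have h2 := (P.le_iff_neg _ _).1 hxy
      rw [← hneg, ← hneg, e1, e2] at h2
      exact h2

theorem coxB_cases (i j : Fin n) (h : (i : ℕ) < j) :
    (coxB n i j = 4 ∧ (j : ℕ) = 1 ∧ (i : ℕ) = 0) ∨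
      (coxB n i j = 3 ∧ (i : ℕ) + 1 = j ∧ (i : ℕ) ≠ 0) ∨
      (coxB n i j = 2 ∧ (i : ℕ) + 1 < j) := by
  simp only [coxB, Matrix.of_apply, Fin.ext_iff]
  (repeat' split) <;> omega

theorem setOpB_braid_lt (P : BPoset n) (i j : Fin n) (h : (i : ℕ) < j) :
    wordProd (fun i => MulOpposite.op (setOp (simpleB n) (DescB n) (SigmaB P) i))
        (CoxeterSystem.alternatingWord i j (coxB n i j)) =
      wordProd (fun i => MulOpposite.op (setOp (simpleB n) (DescB n) (SigmaB P) i))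
        (CoxeterSystem.alternatingWord j i (coxB n i j)) := by
  refine setOp_braid (q := qB P) (fun i γ _ _ hs => setOpB_h1 P i γ hs)
    (fun i γ hγ _ hs => setOpB_h0 P i γ hγ hs) _ _ ?_
  rcases coxB_cases i j h with ⟨h1, h2, h3⟩ | ⟨h1, h2, h3⟩ | ⟨h1, h2⟩ <;> rw [h1]
  · exact wordProd_alt4 _ _ _ (twOpB_braid4 P i j h2 h3)
  · exact wordProd_alt3 _ _ _ (twOpB_braid3 P i j h2 h3)
  · exact wordProd_alt2 _ _ _ (twOpB_comm P i j h2)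

/-- The operators of a `Bₙ` poset module satisfy the relations of `Hᴮₙ(0)`. -/
theorem setOpB_braid (P : BPoset n) (i j : Fin n) (h : i ≠ j) :
    wordProd (fun i => MulOpposite.op (setOp (simpleB n) (DescB n) (SigmaB P) i))
        (CoxeterSystem.alternatingWord i j (coxB n i j)) =
      wordProd (fun i => MulOpposite.op (setOp (simpleB n) (DescB n) (SigmaB P) i))
        (CoxeterSystem.alternatingWord j i (coxB n i j)) := by
  rcases lt_or_gt_of_ne (Fin.ext_iff.not.1 h) with h | h
  · exact setOpB_braid_lt P i j h
  · rw [CoxeterMatrix.symmetric]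
    exact (setOpB_braid_lt P j i h).symm

theorem setOpB_quad (P : BPoset n) (i : Fin n) :
    MulOpposite.op (setOp (simpleB n) (DescB n) (SigmaB P) i) *
      MulOpposite.op (setOp (simpleB n) (DescB n) (SigmaB P) i) =
      -MulOpposite.op (setOp (simpleB n) (DescB n) (SigmaB P) i) := by
  refine setOp_quad i fun γ h => ?_
  by_cases h0 : (i : ℕ) = 0
  · rw [DescB_zero_iff i h0] at h ⊢
    rw [evB_mul (hi i) (-hi i) γ i (by rw [simpleBPerm_val]; simp [hi, h0]), evB_neg]
    have := evB_ne_zero (hi i) (by simp only [hi]; omega) γ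
    omega
  · rw [DescB_iff] at h ⊢
    rw [evB_mul (hi i) (lo i) γ i (by rw [simpleBPerm_val]; simp [hi, lo, h0]),
      evB_mul (lo i) (hi i) γ i (by
        refine simpleBPerm_eq _ _ _ fun z hz => ?_; simp only [lo, hi, true_implies] at hz ⊢; omega)]
    have := evB_ne (lo i) (hi i) (by simp [lo, hi]) γ
    omega

/-- The `Bₙ` poset module `Mᴮ_P` of a `Bₙ` poset `P`: the complex vector space with basis
`Σᴮ_R(P)`. -/
abbrev ModB (P : BPoset n) : Type := SigmaB P →₀ ℂ

/-- The basis element of `Mᴮ_P` given by `γ ∈ Σᴮ_R(P)`. -/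
noncomputable def ModB.basisElt {P : BPoset n} (γ : SigmaB P) : ModB P :=
  Finsupp.single γ (1 : ℂ)

/-- The homomorphism by which `Hᴮₙ(0)` acts from the right on `Mᴮ_P`: the generator `π_i` acts
by the operator `setOp`. -/
noncomputable def ModB.action (P : BPoset n) :
    HB n →ₐ[ℂ] (Module.End ℂ (ModB P))ᵐᵒᵖ :=
  ZeroHecke.lift _
    (fun i => MulOpposite.op (setOp (simpleB n) (DescB n) (SigmaB P) i))
    (setOpB_quad P) (fun i j h _ => setOpB_braid P i j h)

noncomputable instance (P : BPoset n) : Module (HB n)ᵐᵒᵖ (ModB P) :=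
  Module.compHom _ (AlgHom.opComm (ModB.action P)).toRingHom

instance (P : BPoset n) : IsScalarTower ℂ (HB n)ᵐᵒᵖ (ModB P) where
  smul_assoc c x v := by
    change AlgHom.opComm (ModB.action P) (c • x) v = c • AlgHom.opComm (ModB.action P) x v
    rw [map_smul]; rfl

open Classical in
/-- The action of the generators on the basis of `Mᴮ_P`. -/
theorem ModB.gen_smul (P : BPoset n) (i : Fin n) (γ : SigmaB P) :
    MulOpposite.op (ZeroHecke.gen _ i : HB n) • ModB.basisElt γ =
      if DescB n i γ then -ModB.basisElt γ
      else if h : (γ : SPerm n) * simpleB n i ∈ SigmaB P then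
        ModB.basisElt ⟨γ * simpleB n i, h⟩
      else 0 := by
  have h1 : ModB.action P (ZeroHecke.gen _ i) = _ := ZeroHecke.lift_gen _ _ _ _ i
  change (ModB.action P (ZeroHecke.gen _ i)).unop (Finsupp.single γ 1) = _
  rw [h1]
  refine (Finsupp.linearCombination_single ℂ (1 : ℂ) γ).trans ?_
  rw [one_smul]
  rfl

end ModuleB

/-! ### The product of posets and the shuffle of sets of permutations -/

section Product

variable {m n : ℕ}

/-- The map underlying `σ •_B ρ`. -/
def dotFun (σ : SPerm m) (ρ : Equiv.Perm (PInt n)) (i : SInt (m + n)) : SInt (m + n) :=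
  if h₁ : i.1 < -(m : ℤ) then
    ⟨-(ρ ⟨-i.1 - m, by omega⟩).1 - m, by
      have := (ρ ⟨-i.1 - m, by omega⟩).2; push_cast; omega⟩
  else if h₂ : i.1 ≤ m then
    ⟨(σ.1 ⟨i.1, by omega⟩).1, by have := (σ.1 ⟨i.1, by omega⟩).2; push_cast; omega⟩
  else
    ⟨(ρ ⟨i.1 - m, by omega⟩).1 + m, by
      have := (ρ ⟨i.1 - m, by omega⟩).2; push_cast; omega⟩

theorem dotFun_neg (σ : SPerm m) (ρ : Equiv.Perm (PInt n)) (i : SInt (m + n))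
    (h : i.1 < -(m : ℤ)) :
    (dotFun σ ρ i).1 = -(ρ ⟨-i.1 - m, by omega⟩).1 - m := by
  rw [dotFun, dif_pos h]

theorem dotFun_mid (σ : SPerm m) (ρ : Equiv.Perm (PInt n)) (i : SInt (m + n))
    (h₁ : -(m : ℤ) ≤ i.1) (h₂ : i.1 ≤ m) :
    (dotFun σ ρ i).1 = (σ.1 ⟨i.1, h₁, h₂⟩).1 := by
  rw [dotFun, dif_neg (not_lt.2 h₁), dif_pos h₂]

theorem dotFun_pos (σ : SPerm m) (ρ : Equiv.Perm (PInt n)) (i : SInt (m + n))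
    (h : (m : ℤ) < i.1) :
    (dotFun σ ρ i).1 = (ρ ⟨i.1 - m, by omega⟩).1 + m := by
  rw [dotFun, dif_neg (by omega), dif_neg (by omega)]

theorem dotFun_inv (σ : SPerm m) (ρ : Equiv.Perm (PInt n)) (σ' : SPerm m)
    (ρ' : Equiv.Perm (PInt n)) (hσ : ∀ x, σ'.1 (σ.1 x) = x) (hρ : ∀ x, ρ' (ρ x) = x)
    (i : SInt (m + n)) : dotFun σ' ρ' (dotFun σ ρ i) = i := by
  rcases lt_or_ge i.1 (-(m : ℤ)) with h₁ | h₁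
  · have hv := dotFun_neg σ ρ i h₁
    have hb := (ρ ⟨-i.1 - m, by omega⟩).2
    rw [Subtype.ext_iff, dotFun_neg _ _ _ (by omega)]
    have : (⟨-(dotFun σ ρ i).1 - m, by omega⟩ : PInt n) = ρ ⟨-i.1 - m, by omega⟩ :=
      Subtype.ext (by change -(dotFun σ ρ i).1 - (m : ℤ) = _; rw [hv]; ring)
    rw [this, hρ]
    ring
  · rcases le_or_gt i.1 m with h₂ | h₂
    · have hv := dotFun_mid σ ρ i h₁ h₂
      have hb := (σ.1 ⟨i.1, h₁, h₂⟩).2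
      rw [Subtype.ext_iff, dotFun_mid _ _ _ (by omega) (by omega)]
      have : (⟨(dotFun σ ρ i).1, by omega⟩ : SInt m) = σ.1 ⟨i.1, h₁, h₂⟩ :=
        Subtype.ext hv
      rw [this, hσ]
    · have hv := dotFun_pos σ ρ i h₂
      have hb := (ρ ⟨i.1 - m, by omega⟩).2
      rw [Subtype.ext_iff, dotFun_pos _ _ _ (by omega)]
      have : (⟨(dotFun σ ρ i).1 - m, by omega⟩ : PInt n) = ρ ⟨i.1 - m, by omega⟩ :=
        Subtype.ext (by change (dotFun σ ρ i).1 - (m : ℤ) = _; rw [hv]; ring)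
      rw [this, hρ]
      ring

/-- The signed permutation `σ •_B ρ` of `[m + n]` built from a signed permutation `σ` of `[m]`
and a permutation `ρ` of `[n]`. -/
def dotB (σ : SPerm m) (ρ : Equiv.Perm (PInt n)) : SPerm (m + n) :=
  ⟨{ toFun := dotFun σ ρ
     invFun := dotFun σ⁻¹ ρ⁻¹
     left_inv := dotFun_inv _ _ _ _ σ.1.symm_apply_apply ρ.symm_apply_apply
     right_inv := dotFun_inv _ _ _ _ σ.1.apply_symm_apply ρ.apply_symm_apply }, by
    intro i
    change dotFun σ ρ (-i) = -dotFun σ ρ i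
    rw [Subtype.ext_iff, SInt.val_neg]
    rcases lt_or_ge i.1 (-(m : ℤ)) with h₁ | h₁
    · rw [dotFun_neg σ ρ i h₁, dotFun_pos σ ρ (-i) (by rw [SInt.val_neg]; omega)]
      simp only [SInt.val_neg]
      ring
    · rcases le_or_gt i.1 m with h₂ | h₂
      · rw [dotFun_mid σ ρ i h₁ h₂, dotFun_mid σ ρ (-i) (by rw [SInt.val_neg]; omega)
          (by rw [SInt.val_neg]; omega)]
        exact congrArg Subtype.val (σ.2 ⟨i.1, h₁, h₂⟩)
      · rw [dotFun_pos σ ρ i h₂, dotFun_neg σ ρ (-i) (by rw [SInt.val_neg]; omega)]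
        simp only [SInt.val_neg, neg_neg]
        ring⟩

/-- The set `X ⧢_B Y` of all products `(σ •_B ρ) δ`, where `σ ∈ X`, `ρ ∈ Y` and `δ` is a
minimal length right coset representative. -/
def shuffleB (X : Set (SPerm m)) (Y : Set (Equiv.Perm (PInt n))) : Set (SPerm (m + n)) :=
  {w | ∃ σ ∈ X, ∃ ρ ∈ Y, ∃ δ ∈ minReps m n, w = dotB σ ρ * δ}

/-- The order relation of `P₁ ⊔_B P₂`. -/
def sqcupLE (P₁ : BPoset m) (P₂ : APoset n) (i j : SInt (m + n)) : Prop :=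
  (∃ (hi : i.1 < -(m : ℤ)) (hj : j.1 < -(m : ℤ)),
    P₂.le ⟨-j.1 - m, by omega⟩ ⟨-i.1 - m, by omega⟩) ∨
  (∃ (hi : -(m : ℤ) ≤ i.1 ∧ i.1 ≤ m) (hj : -(m : ℤ) ≤ j.1 ∧ j.1 ≤ m),
    P₁.le ⟨i.1, hi⟩ ⟨j.1, hj⟩) ∨
  (∃ (hi : (m : ℤ) < i.1) (hj : (m : ℤ) < j.1),
    P₂.le ⟨i.1 - m, by omega⟩ ⟨j.1 - m, by omega⟩)

/-- The `B_{m+n}` poset `P₁ ⊔_B P₂`. -/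
def sqcupB (P₁ : BPoset m) (P₂ : APoset n) : BPoset (m + n) where
  le := sqcupLE P₁ P₂
  lt i j := sqcupLE P₁ P₂ i j ∧ ¬ sqcupLE P₁ P₂ j i
  lt_iff_le_not_ge _ _ := Iff.rfl
  le_refl i := by
    rcases lt_or_ge i.1 (-(m : ℤ)) with h₁ | h₁
    · exact Or.inl ⟨h₁, h₁, P₂.le_refl _⟩
    · rcases le_or_gt i.1 m with h₂ | h₂
      · exact Or.inr (Or.inl ⟨⟨h₁, h₂⟩, ⟨h₁, h₂⟩, P₁.le_refl _⟩)
      · exact Or.inr (Or.inr ⟨h₂, h₂, P₂.le_refl _⟩)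
  le_trans i j k hij hjk := by
    rcases hij with ⟨hi, hj, h⟩ | ⟨hi, hj, h⟩ | ⟨hi, hj, h⟩ <;>
      rcases hjk with ⟨hj', hk, h'⟩ | ⟨hj', hk, h'⟩ | ⟨hj', hk, h'⟩ <;>
      try (exfalso; omega)
    · exact Or.inl ⟨hi, hk, P₂.le_trans _ _ _ h' h⟩
    · exact Or.inr (Or.inl ⟨hi, hk, P₁.le_trans _ _ _ h h'⟩)
    · exact Or.inr (Or.inr ⟨hi, hk, P₂.le_trans _ _ _ h h'⟩)
  le_antisymm i j hij hji := by
    rcases hij with ⟨hi, hj, h⟩ | ⟨hi, hj, h⟩ | ⟨hi, hj, h⟩ <;>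
      rcases hji with ⟨hj', hi', h'⟩ | ⟨hj', hi', h'⟩ | ⟨hj', hi', h'⟩ <;>
      try (exfalso; omega)
    · have := Subtype.ext_iff.1 (P₂.le_antisymm _ _ h h')
      exact Subtype.ext (by simp only at this; omega)
    · have := Subtype.ext_iff.1 (P₁.le_antisymm _ _ h h')
      exact Subtype.ext this
    · have := Subtype.ext_iff.1 (P₂.le_antisymm _ _ h h')
      exact Subtype.ext (by simp only at this; omega)
  le_iff_neg := by
    have key : ∀ i j : SInt (m + n), sqcupLE P₁ P₂ i j → sqcupLE P₁ P₂ (-j) (-i) := by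
      intro i j h
      rcases h with ⟨hi, hj, h⟩ | ⟨hi, hj, h⟩ | ⟨hi, hj, h⟩
      · refine Or.inr (Or.inr ⟨?_, ?_, h⟩) <;> (rw [SInt.val_neg]; omega)
      · exact Or.inr (Or.inl ⟨by rw [SInt.val_neg]; omega, by rw [SInt.val_neg]; omega,
          (P₁.le_iff_neg _ _).1 h⟩)
      · refine Or.inl ⟨?_, ?_, ?_⟩
        · rw [SInt.val_neg]; omega
        · rw [SInt.val_neg]; omega
        · simpa only [SInt.val_neg, neg_neg] using h
    intro i j
    refine ⟨key i j, fun h => ?_⟩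
    have e : ∀ i : SInt (m + n), - -i = i := fun i => Subtype.ext (neg_neg i.1)
    have := key _ _ h
    rwa [e, e] at this

end Product

end PosetModuleB

namespace PosetModuleB

/-! ### Lengths and reduced words of signed permutations -/

section Words

variable {S R : Type*} [Monoid R]

theorem wordProd_nil (f : S → R) : wordProd f [] = 1 := rfl

theorem wordProd_append (f : S → R) (l l' : List S) :
    wordProd f (l ++ l') = wordProd f l * wordProd f l' := by
  simp [wordProd]

theorem wordProd_singleton (f : S → R) (i : S) : wordProd f [i] = f i := by
  simp [wordProd]

theorem wordProd_cons (f : S → R) (i : S) (l : List S) :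
    wordProd f (i :: l) = f i * wordProd f l := by
  simp [wordProd]

end Words

section LengthB

variable {n : ℕ}

instance (n : ℕ) : Finite (SInt n) := (Set.finite_Icc (-(n : ℤ)) n).to_subtype

theorem SInt.neg_neg (x : SInt n) : - -x = x := Subtype.ext (_root_.neg_neg x.1)

theorem simpleB_apply (i : Fin n) (x : SInt n) : (simpleB n i).1 x = simpleBPerm n i x := rfl

theorem SPerm.mul_apply (u w : SPerm n) (x : SInt n) : (u * w).1 x = u.1 (w.1 x) := rfl

theorem SPerm.inv_apply_self (w : SPerm n) (x : SInt n) : (w⁻¹).1 (w.1 x) = x :=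
  w.1.symm_apply_apply x

theorem SPerm.apply_inv_self (w : SPerm n) (x : SInt n) : w.1 ((w⁻¹).1 x) = x :=
  w.1.apply_symm_apply x

theorem simpleBPerm_simpleBPerm (i : Fin n) (x : SInt n) :
    simpleBPerm n i (simpleBPerm n i x) = x := by
  apply Subtype.ext
  have h1 := simpleBPerm_cases i x _ rfl
  have h2 := simpleBPerm_cases i (simpleBPerm n i x) _ rfl
  omega

theorem simpleB_mul_self (i : Fin n) : simpleB n i * simpleB n i = 1 :=
  Subtype.ext (Equiv.ext (simpleBPerm_simpleBPerm i))

theorem mul_simpleB_cancel (w : SPerm n) (i : Fin n) : w * simpleB n i * simpleB n i = w := by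
  rw [mul_assoc, simpleB_mul_self, mul_one]

theorem simpleB_inv (i : Fin n) : (simpleB n i)⁻¹ = simpleB n i :=
  inv_eq_of_mul_eq_one_left (simpleB_mul_self i)

theorem simpleBPerm_hi (i : Fin n) (h0 : (i : ℕ) ≠ 0) : simpleBPerm n i (hi i) = lo i := by
  apply Subtype.ext; rw [simpleBPerm_val]; simp [hi, lo, h0]

theorem simpleBPerm_lo (i : Fin n) (h0 : (i : ℕ) ≠ 0) : simpleBPerm n i (lo i) = hi i := by
  rw [← simpleBPerm_hi i h0, simpleBPerm_simpleBPerm]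

theorem simpleBPerm_hi_zero (i : Fin n) (h0 : (i : ℕ) = 0) :
    simpleBPerm n i (hi i) = -hi i := by
  apply Subtype.ext; rw [simpleBPerm_val]; simp [hi, h0]

theorem SPerm.apply_neg (w : SPerm n) (x : SInt n) : w.1 (-x) = -w.1 x := w.2 x

/-- Multiplication by a simple generator on the right toggles the descent at its position. -/
theorem DescB_mul_simpleB (i : Fin n) (w : SPerm n) :
    DescB n i (w * simpleB n i) ↔ ¬ DescB n i w := by
  by_cases h0 : (i : ℕ) = 0
  · rw [DescB_zero_iff i h0, DescB_zero_iff i h0,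
      evB_mul (hi i) (-hi i) w i (by rw [simpleBPerm_hi_zero i h0]), evB_neg]
    have := evB_ne_zero (hi i) (by simp only [hi]; omega) w
    omega
  · rw [DescB_iff, DescB_iff, evB_mul (hi i) (lo i) w i (by rw [simpleBPerm_hi i h0]),
      evB_mul (lo i) (hi i) w i (by rw [simpleBPerm_lo i h0])]
    have := evB_ne (lo i) (hi i) (by simp [lo, hi]) w
    omega

theorem not_DescB_iff (i : Fin n) (w : SPerm n) : ¬ DescB n i w ↔ evB (lo i) w < evB (hi i) w := by
  rw [DescB_iff]
  have := evB_ne (lo i) (hi i) (by simp [lo, hi]) w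
  omega

/-- A signed permutation without descents is the identity. -/
theorem eq_one_of_forall_not_DescB (w : SPerm n) (h : ∀ i, ¬ DescB n i w) : w = 1 := by
  have hlow : ∀ k : ℕ, ∀ hk : k ≤ n, (k : ℤ) ≤ evB ⟨k, by omega⟩ w := by
    intro k
    induction k with
    | zero => intro hk; rw [evB_zero _ (by simp)]; simp
    | succ k ih =>
      intro hk
      have h1 := ih (by omega)
      have h2 := (not_DescB_iff ⟨k, by omega⟩ w).1 (h _)
      have e : (hi ⟨k, by omega⟩ : SInt n) = ⟨((k + 1 : ℕ) : ℤ), by omega⟩ := by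
        apply Subtype.ext; simp [hi]
      rw [e] at h2
      simp only [lo] at h2
      push_cast at h2 ⊢
      omega
  have hup : ∀ d : ℕ, ∀ hk : d ≤ n, evB ⟨((n - d : ℕ) : ℤ), by omega⟩ w ≤ ((n - d : ℕ) : ℤ) := by
    intro d
    induction d with
    | zero => intro hk; exact (w.1 _).2.2
    | succ d ih =>
      intro hk
      have h1 := ih (by omega)
      have h2 := (not_DescB_iff ⟨n - (d + 1), by omega⟩ w).1 (h _)
      have e : (hi ⟨n - (d + 1), by omega⟩ : SInt n) = ⟨((n - d : ℕ) : ℤ), by omega⟩ := by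
        apply Subtype.ext; simp only [hi]; omega
      rw [e] at h2
      simp only [lo] at h2
      omega
  have hpos : ∀ x : SInt n, 0 ≤ x.1 → w.1 x = x := by
    intro x hx
    have h1 := hlow x.1.toNat (by omega)
    have h2 := hup (n - x.1.toNat) (by omega)
    have e1 : (⟨(x.1.toNat : ℤ), by omega⟩ : SInt n) = x := Subtype.ext (by simp only; omega)
    have e2 : (⟨((n - (n - x.1.toNat) : ℕ) : ℤ), by omega⟩ : SInt n) = x :=
      Subtype.ext (by simp only; omega)
    rw [e1] at h1
    rw [e2] at h2
    apply Subtype.ext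
    change evB x w = x.1
    omega
  apply Subtype.ext
  ext x
  rcases le_or_gt 0 x.1 with hx | hx
  · rw [hpos x hx]; rfl
  · have := hpos (-x) (by rw [SInt.val_neg]; omega)
    rw [w.2 x] at this
    have h2 : w.1 x = x := by rw [← SInt.neg_neg (w.1 x), this, SInt.neg_neg]
    rw [h2]; rfl

/-- The pairs of positions inverted by a signed permutation, except the pairs of opposite
positions; their number is twice the length. -/
def invsB (w : SPerm n) : Set (SInt n × SInt n) :=
  {p | p.1.1 < p.2.1 ∧ p.1.1 ≠ -p.2.1 ∧ evB p.2 w < evB p.1 w}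

theorem simpleBPerm_lt (i : Fin n) (x y : SInt n) (hxy : x.1 < y.1) (hne : x.1 ≠ -y.1)
    (h1 : ¬ (x = lo i ∧ y = hi i)) (h2 : ¬ (x = -hi i ∧ y = -lo i)) :
    (simpleBPerm n i x).1 < (simpleBPerm n i y).1 := by
  simp only [Subtype.ext_iff, SInt.val_neg, lo, hi] at h1 h2
  have hx := simpleBPerm_cases i x _ rfl
  have hy := simpleBPerm_cases i y _ rfl
  omega

theorem simpleBPerm_neg (i : Fin n) (x : SInt n) : simpleBPerm n i (-x) = -simpleBPerm n i x :=
  (simpleB n i).2 x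

theorem simpleBPerm_lo_ge (i : Fin n) :
    (simpleBPerm n i (hi i)).1 < (simpleBPerm n i (lo i)).1 := by
  have hx := simpleBPerm_cases i (lo i) _ rfl
  have hy := simpleBPerm_cases i (hi i) _ rfl
  have e1 : (lo i : SInt n).1 = (i : ℕ) := rfl
  have e2 : (hi i : SInt n).1 = (i : ℕ) + 1 := rfl
  omega

theorem invsB_mul_simpleB (i : Fin n) (w : SPerm n) (h : ¬ DescB n i w) :
    invsB (w * simpleB n i) = insert (lo i, hi i) (insert (-hi i, -lo i)
      ((fun p => (simpleBPerm n i p.1, simpleBPerm n i p.2)) '' invsB w)) := by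
  have hd := (DescB_iff _ _).1 ((DescB_mul_simpleB i w).2 h)
  have hev : ∀ x, evB x (w * simpleB n i) = evB (simpleBPerm n i x) w :=
    fun x => evB_mul _ _ _ _ rfl
  have hlt := (not_DescB_iff i w).1 h
  ext ⟨x, y⟩
  simp only [Set.mem_insert_iff, Set.mem_image, Prod.mk.injEq, Prod.exists]
  constructor
  · rintro ⟨hxy, hne, hlt'⟩
    by_cases h1 : x = lo i ∧ y = hi i
    · exact Or.inl h1
    by_cases h2 : x = -hi i ∧ y = -lo i
    · exact Or.inr (Or.inl h2)
    refine Or.inr (Or.inr ⟨simpleBPerm n i x, simpleBPerm n i y,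
      ⟨simpleBPerm_lt i x y hxy hne h1 h2, ?_, ?_⟩, simpleBPerm_simpleBPerm i x,
      simpleBPerm_simpleBPerm i y⟩)
    · intro he
      rw [← SInt.val_neg, ← simpleBPerm_neg] at he
      exact hne (congrArg Subtype.val ((simpleBPerm n i).injective (Subtype.ext he)))
    · simpa only [hev] using hlt'
  · rintro (⟨rfl, rfl⟩ | ⟨rfl, rfl⟩ | ⟨a, b, ⟨hab, hne, hlt'⟩, rfl, rfl⟩)
    · exact ⟨by simp [lo, hi], by simp only [lo, hi]; omega, hd⟩
    · refine ⟨by simp [lo, hi], by simp only [SInt.val_neg, lo, hi]; omega, ?_⟩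
      simp only [evB_neg]
      omega
    · simp only at hab hne hlt'
      refine ⟨simpleBPerm_lt i a b hab hne ?_ ?_, ?_, ?_⟩
      · rintro ⟨rfl, rfl⟩; omega
      · rintro ⟨rfl, rfl⟩; rw [evB_neg, evB_neg] at hlt'; omega
      · intro he
        simp only at he
        rw [← SInt.val_neg, ← simpleBPerm_neg] at he
        exact hne (congrArg Subtype.val ((simpleBPerm n i).injective (Subtype.ext he)))
      · simpa only [hev, simpleBPerm_simpleBPerm] using hlt'

theorem ncard_invsB_mul_simpleB (i : Fin n) (w : SPerm n) (h : ¬ DescB n i w) :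
    (invsB (w * simpleB n i)).ncard = (invsB w).ncard + 2 := by
  rw [invsB_mul_simpleB i w h, Set.ncard_insert_of_notMem, Set.ncard_insert_of_notMem,
    Set.ncard_image_of_injective]
  · rintro ⟨a, b⟩ ⟨c, d⟩ hab
    simp only [Prod.mk.injEq, EmbeddingLike.apply_eq_iff_eq] at hab
    simp [hab]
  · rintro ⟨⟨a, b⟩, ⟨hab, -, -⟩, he⟩
    simp only [Prod.mk.injEq] at he
    simp only at hab
    have h1 : a = -simpleBPerm n i (hi i) := by
      rw [← simpleBPerm_neg, ← he.1, simpleBPerm_simpleBPerm]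
    have h2 : b = -simpleBPerm n i (lo i) := by
      rw [← simpleBPerm_neg, ← he.2, simpleBPerm_simpleBPerm]
    have := simpleBPerm_lo_ge i
    rw [h1, h2, SInt.val_neg, SInt.val_neg] at hab
    omega
  · rw [Set.mem_insert_iff]
    rintro (he | ⟨⟨a, b⟩, ⟨hab, -, -⟩, he⟩)
    · simp only [Prod.mk.injEq, Subtype.ext_iff, SInt.val_neg, lo, hi] at he
      omega
    · simp only [Prod.mk.injEq] at he
      simp only at hab
      have h1 : a = simpleBPerm n i (lo i) := by rw [← he.1, simpleBPerm_simpleBPerm]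
      have h2 : b = simpleBPerm n i (hi i) := by rw [← he.2, simpleBPerm_simpleBPerm]
      have := simpleBPerm_lo_ge i
      rw [h1, h2] at hab
      omega

theorem ncard_invsB_one : (invsB (1 : SPerm n)).ncard = 0 := by
  rw [Set.ncard_eq_zero]
  ext p
  simp only [Set.mem_empty_iff_false, iff_false]
  rintro ⟨h1, -, h2⟩
  change p.2.1 < p.1.1 at h2
  omega

theorem ncard_invsB_wordProd_le (l : List (Fin n)) :
    (invsB (wordProd (simpleB n) l)).ncard ≤ 2 * l.length := by
  induction l using List.reverseRecOn with
  | nil => rw [wordProd_nil, ncard_invsB_one]; simp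
  | append_singleton l i ih =>
    rw [wordProd_append, wordProd_singleton, List.length_append, List.length_singleton]
    by_cases h : DescB n i (wordProd (simpleB n) l)
    · have := ncard_invsB_mul_simpleB i (wordProd (simpleB n) l * simpleB n i)
        (fun h' => (DescB_mul_simpleB _ _).1 h' h)
      rw [mul_simpleB_cancel] at this
      omega
    · rw [ncard_invsB_mul_simpleB i _ h]
      omega

theorem exists_word_ncard_invsB (w : SPerm n) :
    ∃ l : List (Fin n), wordProd (simpleB n) l = w ∧ 2 * l.length = (invsB w).ncard := by
  induction hk : (invsB w).ncard using Nat.strong_induction_on generalizing w with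
  | _ k ih =>
    by_cases h : ∀ i, ¬ DescB n i w
    · have := eq_one_of_forall_not_DescB w h
      subst this
      rw [ncard_invsB_one] at hk
      exact ⟨[], rfl, by simpa using hk⟩
    · push Not at h
      obtain ⟨i, h⟩ := h
      have h1 := ncard_invsB_mul_simpleB i (w * simpleB n i)
        (fun h' => (DescB_mul_simpleB _ _).1 h' h)
      rw [mul_simpleB_cancel] at h1
      obtain ⟨l, hl, hl'⟩ := ih _ (by omega) (w * simpleB n i) rfl
      refine ⟨l ++ [i], ?_, ?_⟩
      · rw [wordProd_append, wordProd_singleton, hl, mul_simpleB_cancel]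
      · rw [List.length_append, List.length_singleton]
        omega

theorem two_mul_lengthB (w : SPerm n) : 2 * lengthB w = (invsB w).ncard := by
  obtain ⟨l, hl, hl'⟩ := exists_word_ncard_invsB w
  have h1 : lengthB w ≤ l.length := Nat.sInf_le ⟨l, rfl, hl⟩
  obtain ⟨l', hl1, hl2⟩ := Nat.sInf_mem
    (s := {k | ∃ l : List (Fin n), l.length = k ∧ wordProd (simpleB n) l = w}) ⟨_, l, rfl, hl⟩
  have h2 := ncard_invsB_wordProd_le l'
  rw [hl2, hl1] at h2
  change _ ≤ 2 * lengthB w at h2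
  omega

theorem exists_reduced_word (w : SPerm n) :
    ∃ l : List (Fin n), wordProd (simpleB n) l = w ∧ l.length = lengthB w := by
  obtain ⟨l, hl, hl'⟩ := exists_word_ncard_invsB w
  have := two_mul_lengthB w
  exact ⟨l, hl, by omega⟩

theorem lengthB_le_length (l : List (Fin n)) : lengthB (wordProd (simpleB n) l) ≤ l.length :=
  Nat.sInf_le ⟨l, rfl, rfl⟩

theorem lengthB_mul_of_not_DescB {i : Fin n} {w : SPerm n} (h : ¬ DescB n i w) :
    lengthB (w * simpleB n i) = lengthB w + 1 := by
  have h1 := ncard_invsB_mul_simpleB i w h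
  rw [← two_mul_lengthB, ← two_mul_lengthB] at h1
  omega

theorem lengthB_mul_of_DescB {i : Fin n} {w : SPerm n} (h : DescB n i w) :
    lengthB (w * simpleB n i) + 1 = lengthB w := by
  have := lengthB_mul_of_not_DescB (i := i) (w := w * simpleB n i)
    (fun h' => (DescB_mul_simpleB _ _).1 h' h)
  rw [mul_simpleB_cancel] at this
  exact this.symm

theorem wordProd_simpleB_reverse (l : List (Fin n)) :
    wordProd (simpleB n) l.reverse = (wordProd (simpleB n) l)⁻¹ := by
  induction l with
  | nil => simp [wordProd]
  | cons i l ih =>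
    rw [List.reverse_cons, wordProd_append, wordProd_singleton, ih, wordProd_cons, mul_inv_rev,
      simpleB_inv]

theorem lengthB_inv (w : SPerm n) : lengthB w⁻¹ = lengthB w := by
  have key : ∀ w : SPerm n, lengthB w⁻¹ ≤ lengthB w := fun w => by
    obtain ⟨l, rfl, hl⟩ := exists_reduced_word w
    rw [← hl, ← wordProd_simpleB_reverse, ← List.length_reverse]
    exact lengthB_le_length _
  refine (key w).antisymm ?_
  have := key w⁻¹
  rwa [inv_inv] at this

/-- The initial segments of a reduced word are reduced, and the next letter is not a descent. -/
theorem reduced_of_append_singleton {l : List (Fin n)} {i : Fin n}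
    (h : (l ++ [i]).length = lengthB (wordProd (simpleB n) (l ++ [i]))) :
    l.length = lengthB (wordProd (simpleB n) l) ∧ ¬ DescB n i (wordProd (simpleB n) l) := by
  rw [wordProd_append, wordProd_singleton, List.length_append, List.length_singleton] at h
  have h1 := lengthB_le_length l
  by_cases hd : DescB n i (wordProd (simpleB n) l)
  · have := lengthB_mul_of_DescB hd
    omega
  · have := lengthB_mul_of_not_DescB hd
    exact ⟨by omega, hd⟩

theorem DescB_of_reduced_append_singleton {l : List (Fin n)} {i : Fin n}
    (h : (l ++ [i]).length = lengthB (wordProd (simpleB n) (l ++ [i]))) :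
    DescB n i (wordProd (simpleB n) (l ++ [i])) := by
  rw [wordProd_append, wordProd_singleton, DescB_mul_simpleB]
  exact (reduced_of_append_singleton h).2

end LengthB

/-! ### Independence of the reduced word -/

section Matsumoto

variable {n : ℕ}

theorem exists_mul_alternatingWord_of_lt {i j : Fin n} (hij : (i : ℕ) < j) {w : SPerm n}
    (hi' : DescB n i w) (hj' : DescB n j w) :
    ∃ v, v * wordProd (simpleB n) (CoxeterSystem.alternatingWord i j (coxB n i j)) = w ∧
      v * wordProd (simpleB n) (CoxeterSystem.alternatingWord j i (coxB n i j)) = w ∧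
      lengthB v + coxB n i j = lengthB w := by
  have ev : ∀ (x y : SInt n) (k : Fin n) (γ : SPerm n),
      (∀ z : ℤ, ((x.1 = (k : ℕ) + 1 ∧ (k : ℕ) = 0 ∧ z = -1) ∨
      (x.1 = (k : ℕ) + 1 ∧ (k : ℕ) ≠ 0 ∧ z = (k : ℕ)) ∨
      (x.1 = -((k : ℕ) + 1) ∧ (k : ℕ) = 0 ∧ z = 1) ∨
      (x.1 = -((k : ℕ) + 1) ∧ (k : ℕ) ≠ 0 ∧ z = -(k : ℕ)) ∨
      (x.1 = (k : ℕ) ∧ (k : ℕ) ≠ 0 ∧ z = (k : ℕ) + 1) ∨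
      (x.1 = -(k : ℕ) ∧ (k : ℕ) ≠ 0 ∧ z = -((k : ℕ) + 1)) ∨
      (x.1 ≠ (k : ℕ) + 1 ∧ x.1 ≠ -((k : ℕ) + 1) ∧ (x.1 = (k : ℕ) → (k : ℕ) = 0) ∧
        (x.1 = -(k : ℕ) → (k : ℕ) = 0) ∧ z = x.1)) → z = y.1) →
      evB x (γ * simpleB n k) = evB y γ :=
    fun x y k γ h => evB_mul x y γ k (simpleBPerm_eq k x y h)
  have vlo : ∀ k : Fin n, (lo k : SInt n).1 = (k : ℕ) := fun _ => rfl
  have vhi : ∀ k : Fin n, (hi k : SInt n).1 = (k : ℕ) + 1 := fun _ => rfl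
  have li := vlo i
  have lj := vlo j
  have ui := vhi i
  have uj := vhi j
  rw [DescB_iff] at hi' hj'
  have hi'' := (DescB_iff i w).2 hi'
  rcases coxB_cases i j hij with ⟨h1, h2, h3⟩ | ⟨h1, h2, h3⟩ | ⟨h1, h2⟩ <;> rw [h1]
  · have d0 := (DescB_zero_iff i h3 w).1 hi''
    have hl := lo_succ i j (by omega)
    rw [hl] at hj'
    have a1 : ∀ γ : SPerm n, evB (hi i) (γ * simpleB n i) = -evB (hi i) γ := fun γ => by
      rw [← evB_neg]
      exact ev _ _ _ _ fun z hz => by rw [SInt.val_neg]; omega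
    have b1 : ∀ γ : SPerm n, evB (hi j) (γ * simpleB n i) = evB (hi j) γ := fun γ =>
      ev _ _ _ _ fun z hz => by omega
    have a2 : ∀ γ : SPerm n, evB (hi i) (γ * simpleB n j) = evB (hi j) γ := fun γ =>
      ev _ _ _ _ fun z hz => by omega
    have b2 : ∀ γ : SPerm n, evB (hi j) (γ * simpleB n j) = evB (hi i) γ := fun γ =>
      ev _ _ _ _ fun z hz => by omega
    have l1 := lengthB_mul_of_DescB hi''
    have l2 : _ = lengthB (w * simpleB n i) := lengthB_mul_of_DescB (i := j)
      (by rw [DescB_iff, hl, a1, b1]; omega)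
    have l3 : _ = lengthB (w * simpleB n i * simpleB n j) := lengthB_mul_of_DescB (i := i)
      (by rw [DescB_zero_iff i h3, a2, b1]; omega)
    have l4 : _ = lengthB (w * simpleB n i * simpleB n j * simpleB n i) :=
      lengthB_mul_of_DescB (i := j)
        (by rw [DescB_iff, hl, a1, b1, a2, b2, a1, b1]; omega)
    refine ⟨w * simpleB n i * simpleB n j * simpleB n i * simpleB n j, ?_, ?_, by omega⟩
    · have hb := simpleB_braid4 i j h2 h3
      simp only [CoxeterSystem.alternatingWord, wordProd, List.concat_eq_append, List.nil_append,
        List.cons_append, List.map_cons, List.map_nil, List.prod_cons, List.prod_nil, mul_one]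
      simp only [mul_assoc] at hb
      rw [hb]
      simp only [← mul_assoc, mul_simpleB_cancel]
    · simp only [CoxeterSystem.alternatingWord, wordProd, List.concat_eq_append, List.nil_append,
        List.cons_append, List.map_cons, List.map_nil, List.prod_cons, List.prod_nil, mul_one,
        ← mul_assoc, mul_simpleB_cancel]
  · have hl := lo_succ i j h2
    rw [hl] at hj'
    have a1 : ∀ γ : SPerm n, evB (lo i) (γ * simpleB n i) = evB (hi i) γ := fun γ =>
      ev _ _ _ _ fun z hz => by omega
    have b1 : ∀ γ : SPerm n, evB (hi i) (γ * simpleB n i) = evB (lo i) γ := fun γ =>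
      ev _ _ _ _ fun z hz => by omega
    have c1 : ∀ γ : SPerm n, evB (hi j) (γ * simpleB n i) = evB (hi j) γ := fun γ =>
      ev _ _ _ _ fun z hz => by omega
    have a2 : ∀ γ : SPerm n, evB (lo i) (γ * simpleB n j) = evB (lo i) γ := fun γ =>
      ev _ _ _ _ fun z hz => by omega
    have b2 : ∀ γ : SPerm n, evB (hi i) (γ * simpleB n j) = evB (hi j) γ := fun γ =>
      ev _ _ _ _ fun z hz => by omega
    have l1 := lengthB_mul_of_DescB hi''
    have l2 : _ = lengthB (w * simpleB n i) := lengthB_mul_of_DescB (i := j)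
      (by rw [DescB_iff, hl, b1, c1]; omega)
    have l3 : _ = lengthB (w * simpleB n i * simpleB n j) := lengthB_mul_of_DescB (i := i)
      (by rw [DescB_iff, a2, b2, a1, c1]; omega)
    refine ⟨w * simpleB n i * simpleB n j * simpleB n i, ?_, ?_, by omega⟩
    · simp only [CoxeterSystem.alternatingWord, wordProd, List.concat_eq_append, List.nil_append,
        List.cons_append, List.map_cons, List.map_nil, List.prod_cons, List.prod_nil, mul_one]
      rw [← mul_assoc (simpleB n j), ← simpleB_braid3 i j h2 h3]
      simp only [← mul_assoc, mul_simpleB_cancel]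
    · simp only [CoxeterSystem.alternatingWord, wordProd, List.concat_eq_append, List.nil_append,
        List.cons_append, List.map_cons, List.map_nil, List.prod_cons, List.prod_nil, mul_one,
        ← mul_assoc, mul_simpleB_cancel]
  · have e1 : evB (lo j) (w * simpleB n i) = evB (lo j) w :=
      ev _ _ _ _ fun z hz => by omega
    have e2 : evB (hi j) (w * simpleB n i) = evB (hi j) w :=
      ev _ _ _ _ fun z hz => by omega
    have l1 := lengthB_mul_of_DescB hi''
    have l2 : _ = lengthB (w * simpleB n i) := lengthB_mul_of_DescB (i := j)
      (by rw [DescB_iff, e1, e2]; exact hj')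
    refine ⟨w * simpleB n i * simpleB n j, ?_, ?_, by omega⟩
    · simp only [CoxeterSystem.alternatingWord, wordProd, List.concat_eq_append, List.nil_append,
        List.cons_append, List.map_cons, List.map_nil, List.prod_cons, List.prod_nil, mul_one]
      rw [simpleB_comm i j h2]
      simp only [← mul_assoc, mul_simpleB_cancel]
    · simp only [CoxeterSystem.alternatingWord, wordProd, List.concat_eq_append, List.nil_append,
        List.cons_append, List.map_cons, List.map_nil, List.prod_cons, List.prod_nil, mul_one,
        ← mul_assoc, mul_simpleB_cancel]

/-- A signed permutation with two descents ends in the longest element of the corresponding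
dihedral parabolic subgroup. -/
theorem exists_mul_alternatingWord {i j : Fin n} (hij : i ≠ j) {w : SPerm n}
    (hi' : DescB n i w) (hj' : DescB n j w) :
    ∃ v, v * wordProd (simpleB n) (CoxeterSystem.alternatingWord i j (coxB n i j)) = w ∧
      v * wordProd (simpleB n) (CoxeterSystem.alternatingWord j i (coxB n i j)) = w ∧
      lengthB v + coxB n i j = lengthB w := by
  rcases lt_or_gt_of_ne (Fin.ext_iff.not.1 hij) with h | h
  · exact exists_mul_alternatingWord_of_lt h hi' hj'
  · rw [CoxeterMatrix.symmetric]
    obtain ⟨v, h1, h2, h3⟩ := exists_mul_alternatingWord_of_lt h hj' hi'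
    exact ⟨v, h2, h1, h3⟩

theorem coxB_ge_two {i j : Fin n} (hij : i ≠ j) : 2 ≤ coxB n i j := by
  rcases lt_or_gt_of_ne (Fin.ext_iff.not.1 hij) with h | h
  · rcases coxB_cases i j h with h | h | h <;> omega
  · rw [CoxeterMatrix.symmetric]
    rcases coxB_cases j i h with h | h | h <;> omega

/-- Matsumoto's theorem in type `B`: a family that satisfies the braid relations has the same
product along any two reduced words of a signed permutation. -/
theorem wordProd_eq_of_reduced {R : Type*} [Monoid R] (f : Fin n → R)
    (hf : ∀ i j, i ≠ j → wordProd f (CoxeterSystem.alternatingWord i j (coxB n i j)) =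
      wordProd f (CoxeterSystem.alternatingWord j i (coxB n i j)))
    (l l' : List (Fin n)) (h : wordProd (simpleB n) l = wordProd (simpleB n) l')
    (hl : l.length = lengthB (wordProd (simpleB n) l))
    (hl' : l'.length = lengthB (wordProd (simpleB n) l')) :
    wordProd f l = wordProd f l' := by
  induction hk : l.length using Nat.strong_induction_on generalizing l l' with
  | _ k ih =>
  have same : ∀ (a b : List (Fin n)) (i : Fin n), (a ++ [i]).length = k →
      wordProd (simpleB n) (a ++ [i]) = wordProd (simpleB n) (b ++ [i]) →
      (a ++ [i]).length = lengthB (wordProd (simpleB n) (a ++ [i])) →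
      (b ++ [i]).length = lengthB (wordProd (simpleB n) (b ++ [i])) →
      wordProd f (a ++ [i]) = wordProd f (b ++ [i]) := by
    intro a b i hak hab ha hb
    rw [wordProd_append, wordProd_append f]
    rw [wordProd_append, wordProd_append (simpleB n)] at hab
    rw [List.length_append, List.length_singleton] at hak
    rw [ih a.length (by omega) a b (mul_right_cancel hab) (reduced_of_append_singleton ha).1
      (reduced_of_append_singleton hb).1 rfl]
  rcases List.eq_nil_or_concat' l with rfl | ⟨a, i, rfl⟩
  · have : l' = [] := List.length_eq_zero_iff.1 (by rw [hl', ← h, ← hl]; rfl)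
    rw [this]
  rcases List.eq_nil_or_concat' l' with rfl | ⟨b, j, rfl⟩
  · rw [← h, ← hl] at hl'
    simp at hl'
  by_cases hij : i = j
  · subst hij
    exact same a b i hk h hl hl'
  have hdi := DescB_of_reduced_append_singleton hl
  have hdj := DescB_of_reduced_append_singleton hl'
  rw [← h] at hdj
  obtain ⟨v, h1, h2, h3⟩ := exists_mul_alternatingWord hij hdi hdj
  obtain ⟨c, rfl, hc⟩ := exists_reduced_word v
  obtain ⟨M, hM⟩ : ∃ M, coxB n i j = M + 1 := ⟨coxB n i j - 1, by
    have := coxB_ge_two hij; omega⟩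
  have hf' := hf i j hij
  rw [hM] at h1 h2 h3 hf'
  have e1 : c ++ CoxeterSystem.alternatingWord i j (M + 1) =
      (c ++ CoxeterSystem.alternatingWord j i M) ++ [j] := by
    rw [CoxeterSystem.alternatingWord, List.concat_eq_append, List.append_assoc]
  have e2 : c ++ CoxeterSystem.alternatingWord j i (M + 1) =
      (c ++ CoxeterSystem.alternatingWord i j M) ++ [i] := by
    rw [CoxeterSystem.alternatingWord, List.concat_eq_append, List.append_assoc]
  have lenj : ∀ x y : Fin n, (c ++ CoxeterSystem.alternatingWord x y (M + 1)).length =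
      lengthB (wordProd (simpleB n) (a ++ [i])) := by
    intro x y
    rw [List.length_append, CoxeterSystem.length_alternatingWord, hc, h3]
  rw [← wordProd_append] at h1 h2
  have s1 := same a (c ++ CoxeterSystem.alternatingWord i j M) i hk (by rw [← e2, h2]) hl
    (by rw [← e2, lenj, h2])
  have s2 := same (c ++ CoxeterSystem.alternatingWord j i M) b j
    (by rw [← e1, lenj, ← hl, hk]) (by rw [← e1, h1, h])
    (by rw [← e1, lenj, h1]) hl'
  rw [s1, ← e2, ← s2, ← e1, wordProd_append, wordProd_append f, hf']

end Matsumoto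

/-! ### The parabolic subgroup of block permutations -/

section Parabolic

variable {m n : ℕ}

/-- The inclusion of `[-m, m]` in `[-(m + n), m + n]`. -/
def midB (n : ℕ) (x : SInt m) : SInt (m + n) := ⟨x.1, by have := x.2; push_cast; omega⟩

/-- The shift of `[n]` by `m`, with values in `[-(m + n), m + n]`. -/
def upB (m : ℕ) (x : PInt n) : SInt (m + n) := ⟨x.1 + m, by have := x.2; push_cast; omega⟩

theorem midB_val (x : SInt m) : (midB n x).1 = x.1 := rfl

theorem upB_val (x : PInt n) : (upB m x).1 = x.1 + m := rfl

theorem midB_injective : Function.Injective (midB n : SInt m → SInt (m + n)) := fun x y h => by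
  have := congrArg Subtype.val h
  exact Subtype.ext this

theorem upB_injective : Function.Injective (upB m : PInt n → SInt (m + n)) := fun x y h => by
  have := congrArg Subtype.val h
  rw [upB_val, upB_val] at this
  exact Subtype.ext (by omega)

theorem midB_or_upB (x : SInt (m + n)) :
    (∃ a : SInt m, x = midB n a) ∨ (∃ b : PInt n, x = upB m b) ∨ ∃ b : PInt n, x = -upB m b := by
  have hx := x.2
  push_cast at hx
  by_cases h1 : (m : ℤ) < x.1
  · exact Or.inr (Or.inl ⟨⟨x.1 - m, by omega⟩, Subtype.ext (by rw [upB_val]; simp)⟩)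
  · by_cases h2 : x.1 < -(m : ℤ)
    · exact Or.inr (Or.inr ⟨⟨-x.1 - m, by omega⟩,
        Subtype.ext (by rw [SInt.val_neg, upB_val]; simp)⟩)
    · exact Or.inl ⟨⟨x.1, by omega⟩, rfl⟩

theorem dotB_midB (σ : SPerm m) (ρ : Equiv.Perm (PInt n)) (a : SInt m) :
    (dotB σ ρ).1 (midB n a) = midB n (σ.1 a) :=
  Subtype.ext (dotFun_mid σ ρ (midB n a) a.2.1 a.2.2)

theorem dotB_upB (σ : SPerm m) (ρ : Equiv.Perm (PInt n)) (b : PInt n) :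
    (dotB σ ρ).1 (upB m b) = upB m (ρ b) := by
  have hb := b.2
  apply Subtype.ext
  refine (dotFun_pos σ ρ (upB m b) (by rw [upB_val]; omega)).trans ?_
  have : (⟨(upB m b).1 - m, by rw [upB_val]; omega⟩ : PInt n) = b :=
    Subtype.ext (by simp only [upB_val]; omega)
  rw [this]
  rfl

theorem SPerm.ext_blocks {u w : SPerm (m + n)} (h₁ : ∀ a, u.1 (midB n a) = w.1 (midB n a))
    (h₂ : ∀ b, u.1 (upB m b) = w.1 (upB m b)) : u = w := by
  refine Subtype.ext (Equiv.ext fun x => ?_)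
  rcases midB_or_upB x with ⟨a, rfl⟩ | ⟨b, rfl⟩ | ⟨b, rfl⟩
  · exact h₁ a
  · exact h₂ b
  · rw [SPerm.apply_neg, SPerm.apply_neg, h₂]

theorem dotB_mul (σ σ' : SPerm m) (ρ ρ' : Equiv.Perm (PInt n)) :
    dotB σ ρ * dotB σ' ρ' = dotB (σ * σ') (ρ * ρ') := by
  refine SPerm.ext_blocks (fun a => ?_) (fun b => ?_)
  · rw [SPerm.mul_apply, dotB_midB, dotB_midB, dotB_midB, SPerm.mul_apply]
  · rw [SPerm.mul_apply, dotB_upB, dotB_upB, dotB_upB, Equiv.Perm.mul_apply]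

theorem dotB_one : dotB (1 : SPerm m) (1 : Equiv.Perm (PInt n)) = 1 :=
  SPerm.ext_blocks (dotB_midB 1 1) (dotB_upB 1 1)

theorem dotB_inv (σ : SPerm m) (ρ : Equiv.Perm (PInt n)) : (dotB σ ρ)⁻¹ = dotB σ⁻¹ ρ⁻¹ :=
  inv_eq_of_mul_eq_one_left (by rw [dotB_mul, inv_mul_cancel, inv_mul_cancel, dotB_one])

theorem dotB_injective {σ σ' : SPerm m} {ρ ρ' : Equiv.Perm (PInt n)}
    (h : dotB σ ρ = dotB σ' ρ') : σ = σ' ∧ ρ = ρ' := by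
  constructor
  · refine Subtype.ext (Equiv.ext fun a => midB_injective (n := n) ?_)
    rw [← dotB_midB σ ρ, ← dotB_midB σ' ρ', h]
  · refine Equiv.ext fun b => upB_injective (m := m) ?_
    rw [← dotB_upB σ ρ, ← dotB_upB σ' ρ', h]

theorem simpleB_castAdd (i : Fin m) : simpleB (m + n) (Fin.castAdd n i) = dotB (simpleB m i) 1 := by
  refine SPerm.ext_blocks (fun a => ?_) (fun b => ?_)
  · rw [dotB_midB]
    apply Subtype.ext
    rw [simpleB_apply, simpleB_apply, midB_val, simpleBPerm_val, simpleBPerm_val]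
    rfl
  · rw [dotB_upB]
    apply Subtype.ext
    rw [simpleB_apply]
    have hb := b.2
    have hv := upB_val (m := m) b
    refine simpleBPerm_eq _ _ _ fun z hz => ?_
    rw [Fin.val_castAdd] at hz
    change z = (upB m b).1
    omega

theorem simpleB_shiftNode (j : Fin (n - 1)) :
    simpleB (m + n) (shiftNode m n j) = dotB 1 (simpleA n j) := by
  have hs : ((shiftNode m n j : Fin (m + n)) : ℕ) = m + j + 1 := rfl
  refine SPerm.ext_blocks (fun a => ?_) (fun b => ?_)
  · rw [dotB_midB]
    apply Subtype.ext
    rw [simpleB_apply]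
    have ha := a.2
    have hv := midB_val (n := n) a
    refine simpleBPerm_eq _ _ _ fun z hz => ?_
    change z = (midB n a).1
    omega
  · rw [dotB_upB]
    apply Subtype.ext
    rw [simpleB_apply]
    have hb := b.2
    have hv := upB_val (m := m) b
    have hv' := upB_val (m := m) (simpleA n j b)
    have hc := simpleA_cases j b _ rfl
    refine simpleBPerm_eq _ _ _ fun z hz => ?_
    omega

theorem castAdd_or_shiftNode (i : Fin (m + n)) (h : (i : ℕ) ≠ m) :
    (∃ k, i = Fin.castAdd n k) ∨ ∃ j, i = shiftNode m n j := by
  rcases lt_or_gt_of_ne h with h | h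
  · exact Or.inl ⟨⟨i, h⟩, rfl⟩
  · exact Or.inr ⟨⟨i - m - 1, by omega⟩, Fin.ext (by simp only [shiftNode]; omega)⟩

theorem exists_dotB_of_mem_closure {w : SPerm (m + n)}
    (hw : w ∈ Subgroup.closure {s | ∃ i : Fin (m + n), (i : ℕ) ≠ m ∧ s = simpleB (m + n) i}) :
    ∃ σ ρ, w = dotB σ ρ := by
  induction hw using Subgroup.closure_induction with
  | mem x hx =>
    obtain ⟨i, hi', rfl⟩ := hx
    rcases castAdd_or_shiftNode i hi' with ⟨k, rfl⟩ | ⟨j, rfl⟩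
    · exact ⟨_, _, simpleB_castAdd k⟩
    · exact ⟨_, _, simpleB_shiftNode j⟩
  | one => exact ⟨1, 1, dotB_one.symm⟩
  | mul x y _ _ hx hy =>
    obtain ⟨σ, ρ, rfl⟩ := hx
    obtain ⟨σ', ρ', rfl⟩ := hy
    exact ⟨_, _, dotB_mul _ _ _ _⟩
  | inv x _ hx =>
    obtain ⟨σ, ρ, rfl⟩ := hx
    exact ⟨_, _, dotB_inv _ _⟩

theorem lo_castAdd (i : Fin m) : lo (Fin.castAdd n i) = midB n (lo i) := rfl

theorem hi_castAdd (i : Fin m) : hi (Fin.castAdd n i) = midB n (hi i) := rfl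

theorem lo_shiftNode (j : Fin (n - 1)) :
    lo (shiftNode m n j) = upB m ⟨(j : ℕ) + 1, by omega⟩ :=
  Subtype.ext (by simp only [lo, shiftNode, upB]; push_cast; omega)

theorem hi_shiftNode (j : Fin (n - 1)) :
    hi (shiftNode m n j) = upB m ⟨(j : ℕ) + 2, by omega⟩ :=
  Subtype.ext (by simp only [hi, shiftNode, upB]; push_cast; omega)

theorem midB_lt (a b : SInt m) : midB n a < midB n b ↔ a < b := Iff.rfl

theorem upB_lt (a b : PInt n) : upB m a < upB m b ↔ a < b := by
  rw [← Subtype.coe_lt_coe, ← Subtype.coe_lt_coe, upB_val, upB_val, add_lt_add_iff_right]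

theorem midB_lt_upB (a : SInt m) (b : PInt n) : midB n a < upB m b := by
  rw [← Subtype.coe_lt_coe, upB_val, midB_val]
  have := a.2
  have := b.2
  omega

theorem SInt.neg_lt_neg {N : ℕ} {a b : SInt N} (h : a < b) : -b < -a := by
  rw [← Subtype.coe_lt_coe] at *
  rw [SInt.val_neg, SInt.val_neg]
  omega

theorem neg_upB_lt_midB (a : SInt m) (b : PInt n) : -upB m b < midB n a := by
  rw [← Subtype.coe_lt_coe, SInt.val_neg, upB_val, midB_val]
  have := a.2
  have := b.2
  omega

theorem neg_upB_lt_upB (a b : PInt n) : -upB m b < upB m a := by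
  rw [← Subtype.coe_lt_coe, SInt.val_neg, upB_val, upB_val]
  have := a.2
  have := b.2
  omega

theorem DescB_castAdd_dotB (i : Fin m) (σ : SPerm m) (ρ : Equiv.Perm (PInt n)) :
    DescB (m + n) (Fin.castAdd n i) (dotB σ ρ) ↔ DescB m i σ := by
  rw [DescB, lo_castAdd, hi_castAdd, dotB_midB, dotB_midB, midB_lt, DescB]

theorem DescB_shiftNode_dotB (j : Fin (n - 1)) (σ : SPerm m) (ρ : Equiv.Perm (PInt n)) :
    DescB (m + n) (shiftNode m n j) (dotB σ ρ) ↔ DescA n j ρ := by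
  rw [DescB, lo_shiftNode, hi_shiftNode, dotB_upB, dotB_upB, upB_lt, DescA]

/-! ### Minimal length coset representatives -/

theorem evB_lt_of_not_DescB {N : ℕ} (w : SPerm N) (s t : ℕ)
    (h : ∀ i : Fin N, s ≤ (i : ℕ) → (i : ℕ) < t → ¬ DescB N i w) (x y : SInt N)
    (hx : (s : ℤ) ≤ x.1) (hxy : x.1 < y.1) (hy : y.1 ≤ t) : evB x w < evB y w := by
  obtain ⟨d, hd⟩ : ∃ d : ℕ, y.1 = x.1 + d + 1 := ⟨(y.1 - x.1 - 1).toNat, by omega⟩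
  induction d generalizing y with
  | zero =>
    have hy' := y.2
    have := (not_DescB_iff ⟨x.1.toNat, by omega⟩ w).1
      (h _ (by simp only; omega) (by simp only; omega))
    have e1 : (lo ⟨x.1.toNat, by omega⟩ : SInt N) = x := Subtype.ext (by simp only [lo]; omega)
    have e2 : (hi ⟨x.1.toNat, by omega⟩ : SInt N) = y := Subtype.ext (by simp only [hi]; omega)
    rwa [e1, e2] at this
  | succ d ih =>
    have hy' := y.2
    have h1 := ih ⟨x.1 + d + 1, by omega⟩ (by simp only; omega) (by simp only; omega) rfl
    have := (not_DescB_iff ⟨(x.1 + d + 1).toNat, by omega⟩ w).1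
      (h _ (by simp only; omega) (by simp only; omega))
    have e1 : (lo ⟨(x.1 + d + 1).toNat, by omega⟩ : SInt N) = ⟨x.1 + d + 1, by omega⟩ :=
      Subtype.ext (by simp only [lo]; omega)
    have e2 : (hi ⟨(x.1 + d + 1).toNat, by omega⟩ : SInt N) = y :=
      Subtype.ext (by simp only [hi]; omega)
    rw [e1, e2] at this
    exact h1.trans this

/-- The inverse of `δ` has no descent at the positions other than `m`. -/
def BlockIncreasing (m n : ℕ) (δ : SPerm (m + n)) : Prop :=
  ∀ i : Fin (m + n), (i : ℕ) ≠ m → ¬ DescB (m + n) i δ⁻¹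

theorem BlockIncreasing.midB_lt {δ : SPerm (m + n)} (h : BlockIncreasing m n δ) {a b : SInt m}
    (hab : a < b) : (δ⁻¹).1 (midB n a) < (δ⁻¹).1 (midB n b) := by
  rw [← Subtype.coe_lt_coe] at *
  change evB (midB n a) δ⁻¹ < evB (midB n b) δ⁻¹
  have key : ∀ x y : SInt (m + n), 0 ≤ x.1 → x.1 < y.1 → y.1 ≤ m → evB x δ⁻¹ < evB y δ⁻¹ :=
    fun x y hx hxy hy => evB_lt_of_not_DescB δ⁻¹ 0 m (fun i _ hi' => h i hi'.ne) x y hx hxy hy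
  have ha := a.2
  have hb := b.2
  have va := midB_val (n := n) a
  have vb := midB_val (n := n) b
  have h0 : ∀ x : SInt (m + n), 0 ≤ x.1 → x.1 ≤ m → 0 ≤ evB x δ⁻¹ := by
    intro x hx hx'
    rcases hx.eq_or_lt with h0 | h0
    · rw [evB_zero x h0.symm]
    · have := key ⟨0, by omega⟩ x le_rfl h0 hx'
      rw [evB_zero ⟨0, by omega⟩ rfl] at this
      exact this.le
  rcases le_or_gt 0 a.1 with ha' | ha'
  · exact key _ _ (by omega) (by omega) (by omega)
  · have na := SInt.val_neg (midB n a)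
    have nb := SInt.val_neg (midB n b)
    have ea := evB_neg (midB n a) δ⁻¹
    have eb := evB_neg (midB n b) δ⁻¹
    rcases le_or_gt b.1 0 with hb' | hb'
    · have := key (-midB n b) (-midB n a) (by omega) (by omega) (by omega)
      omega
    · have h1 := h0 (-midB n a) (by omega) (by omega)
      have h2 := h0 (midB n b) (by omega) (by omega)
      have h3 := evB_ne_zero (midB n b) (by omega) δ⁻¹
      omega

theorem BlockIncreasing.upB_lt {δ : SPerm (m + n)} (h : BlockIncreasing m n δ) {a b : PInt n}
    (hab : a < b) : (δ⁻¹).1 (upB m a) < (δ⁻¹).1 (upB m b) := by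
  rw [← Subtype.coe_lt_coe] at *
  have ha := a.2
  have hb := b.2
  have va := upB_val (m := m) a
  have vb := upB_val (m := m) b
  exact evB_lt_of_not_DescB δ⁻¹ (m + 1) (m + n) (fun i hi' _ => h i (by omega)) _ _
    (by push_cast; omega) (by omega) (by push_cast; omega)

theorem BlockIncreasing.midB_le {δ : SPerm (m + n)} (h : BlockIncreasing m n δ) {a b : SInt m} :
    (δ⁻¹).1 (midB n a) ≤ (δ⁻¹).1 (midB n b) ↔ a ≤ b := by
  have : StrictMono fun a => (δ⁻¹).1 (midB n a) := fun _ _ => h.midB_lt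
  exact this.le_iff_le

theorem BlockIncreasing.upB_le {δ : SPerm (m + n)} (h : BlockIncreasing m n δ) {a b : PInt n} :
    (δ⁻¹).1 (upB m a) ≤ (δ⁻¹).1 (upB m b) ↔ a ≤ b := by
  have : StrictMono fun a => (δ⁻¹).1 (upB m a) := fun _ _ => h.upB_lt
  exact this.le_iff_le

theorem dotB_eq_one_of_blockIncreasing {δ : SPerm (m + n)} (h : BlockIncreasing m n δ)
    {σ : SPerm m} {ρ : Equiv.Perm (PInt n)} (h' : BlockIncreasing m n (dotB σ ρ * δ)) :
    dotB σ ρ = 1 := by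
  rw [← inv_inj, inv_one]
  refine eq_one_of_forall_not_DescB _ fun i => ?_
  have key : ∀ x, ((dotB σ ρ * δ)⁻¹).1 x = (δ⁻¹).1 ((dotB σ ρ)⁻¹.1 x) := fun x => by
    rw [mul_inv_rev, SPerm.mul_apply]
  by_cases him : (i : ℕ) = m
  · have hn : 0 < n := by omega
    have e1 : lo i = midB n ⟨(m : ℤ), by omega⟩ := Subtype.ext (by simp [lo, him, midB])
    have e2 : hi i = upB m ⟨1, by omega⟩ := Subtype.ext (by simp only [hi, him, upB]; omega)
    rw [DescB, e1, e2, dotB_inv, dotB_midB, dotB_upB]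
    exact (midB_lt_upB _ _).not_gt
  · have hd := h' i him
    intro hlt
    refine hd ?_
    rw [DescB, key, key]
    rw [DescB, dotB_inv] at hlt
    rw [dotB_inv]
    rcases castAdd_or_shiftNode i him with ⟨k, rfl⟩ | ⟨j, rfl⟩
    · rw [lo_castAdd, hi_castAdd, dotB_midB, dotB_midB] at *
      exact h.midB_lt hlt
    · rw [lo_shiftNode, hi_shiftNode, dotB_upB, dotB_upB] at *
      exact h.upB_lt ((PosetModuleB.upB_lt _ _).1 hlt)

theorem blockIncreasing_of_forall_le {δ : SPerm (m + n)}
    (h : ∀ w ∈ Subgroup.closure {s | ∃ i : Fin (m + n), (i : ℕ) ≠ m ∧ s = simpleB (m + n) i},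
      lengthB δ ≤ lengthB (w * δ)) : BlockIncreasing m n δ := by
  intro i hi' hd
  have h1 := h (simpleB (m + n) i) (Subgroup.subset_closure ⟨i, hi', rfl⟩)
  rw [← lengthB_inv δ, ← lengthB_inv (simpleB (m + n) i * δ), mul_inv_rev, simpleB_inv] at h1
  have := lengthB_mul_of_DescB hd
  omega

theorem exists_minimal_mul (w : SPerm (m + n)) :
    ∃ u ∈ Subgroup.closure {s | ∃ i : Fin (m + n), (i : ℕ) ≠ m ∧ s = simpleB (m + n) i},
      u * w ∈ minReps m n := by
  set K := Subgroup.closure {s | ∃ i : Fin (m + n), (i : ℕ) ≠ m ∧ s = simpleB (m + n) i}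
  set u := Function.argmin (fun u : K => lengthB (u.1 * w))
  refine ⟨u.1, u.2, fun v hv => ?_⟩
  rw [← mul_assoc]
  exact Function.argmin_le (fun u : K => lengthB (u.1 * w)) ⟨v * u.1, K.mul_mem hv u.2⟩

/-- The minimal length representatives are the block increasing signed permutations. -/
theorem mem_minReps_iff (δ : SPerm (m + n)) : δ ∈ minReps m n ↔ BlockIncreasing m n δ := by
  refine ⟨blockIncreasing_of_forall_le, fun h => ?_⟩
  obtain ⟨u, hu, hδ⟩ := exists_minimal_mul δ
  obtain ⟨σ, ρ, rfl⟩ := exists_dotB_of_mem_closure hu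
  have := dotB_eq_one_of_blockIncreasing h (blockIncreasing_of_forall_le hδ)
  rwa [this, one_mul] at hδ

theorem exists_dotB_mul_minReps (w : SPerm (m + n)) :
    ∃ σ ρ, ∃ δ ∈ minReps m n, w = dotB σ ρ * δ := by
  obtain ⟨u, hu, hδ⟩ := exists_minimal_mul w
  obtain ⟨σ, ρ, rfl⟩ := exists_dotB_of_mem_closure hu
  exact ⟨σ⁻¹, ρ⁻¹, _, hδ, by rw [← dotB_inv, inv_mul_cancel_left]⟩

theorem dotB_mul_minReps_injective {σ σ' : SPerm m} {ρ ρ' : Equiv.Perm (PInt n)}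
    {δ δ' : SPerm (m + n)} (hδ : δ ∈ minReps m n) (hδ' : δ' ∈ minReps m n)
    (h : dotB σ ρ * δ = dotB σ' ρ' * δ') : σ = σ' ∧ ρ = ρ' ∧ δ = δ' := by
  rw [mem_minReps_iff] at hδ hδ'
  have e : δ' = dotB (σ'⁻¹ * σ) (ρ'⁻¹ * ρ) * δ := by
    rw [← dotB_mul, ← dotB_inv, mul_assoc, h, inv_mul_cancel_left]
  have h1 := dotB_eq_one_of_blockIncreasing hδ (e ▸ hδ')
  rw [h1, one_mul] at e
  subst e
  obtain ⟨h2, h3⟩ := dotB_injective (mul_right_cancel h)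
  exact ⟨h2, h3, rfl⟩

/-! ### Linear extensions of the product -/

theorem sqcupB_le_midB (P₁ : BPoset m) (P₂ : APoset n) {a b : SInt m} (h : P₁.le a b) :
    (sqcupB P₁ P₂).le (midB n a) (midB n b) :=
  Or.inr (Or.inl ⟨a.2, b.2, h⟩)

theorem sqcupB_le_upB (P₁ : BPoset m) (P₂ : APoset n) {a b : PInt n} (h : P₂.le a b) :
    (sqcupB P₁ P₂).le (upB m a) (upB m b) := by
  have ha := a.2
  have hb := b.2
  refine Or.inr (Or.inr ⟨by rw [upB_val]; omega, by rw [upB_val]; omega, ?_⟩)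
  convert h using 1 <;> exact Subtype.ext (by simp only [upB_val]; omega)

theorem sqcupB_le_cases (P₁ : BPoset m) (P₂ : APoset n) {x y : SInt (m + n)}
    (h : (sqcupB P₁ P₂).le x y) :
    (∃ a b, x = midB n a ∧ y = midB n b ∧ P₁.le a b) ∨
      (∃ a b, x = upB m a ∧ y = upB m b ∧ P₂.le a b) ∨
      ∃ a b, x = -upB m b ∧ y = -upB m a ∧ P₂.le a b := by
  rcases h with ⟨hi', hj', h⟩ | ⟨hi', hj', h⟩ | ⟨hi', hj', h⟩
  · refine Or.inr (Or.inr ⟨_, _, ?_, ?_, h⟩) <;>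
      exact Subtype.ext (by simp only [SInt.val_neg, upB_val]; omega)
  · exact Or.inl ⟨_, _, rfl, rfl, h⟩
  · refine Or.inr (Or.inl ⟨_, _, ?_, ?_, h⟩) <;>
      exact Subtype.ext (by simp only [upB_val]; omega)

theorem dotB_apply_eq_midB {σ : SPerm m} {ρ : Equiv.Perm (PInt n)} {x : SInt (m + n)} {a : SInt m}
    (h : (dotB σ ρ).1 x = midB n a) : x = midB n (σ.1.symm a) := by
  refine (dotB σ ρ).1.injective ?_
  rw [h, dotB_midB, Equiv.apply_symm_apply]

theorem dotB_apply_eq_upB {σ : SPerm m} {ρ : Equiv.Perm (PInt n)} {x : SInt (m + n)} {a : PInt n}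
    (h : (dotB σ ρ).1 x = upB m a) : x = upB m (ρ.symm a) := by
  refine (dotB σ ρ).1.injective ?_
  rw [h, dotB_upB, Equiv.apply_symm_apply]

theorem dotB_apply_eq_neg_upB {σ : SPerm m} {ρ : Equiv.Perm (PInt n)} {x : SInt (m + n)}
    {a : PInt n} (h : (dotB σ ρ).1 x = -upB m a) : x = -upB m (ρ.symm a) := by
  refine (dotB σ ρ).1.injective ?_
  rw [h, SPerm.apply_neg, dotB_upB, Equiv.apply_symm_apply]

theorem dotB_mul_mem_SigmaB_iff (P₁ : BPoset m) (P₂ : APoset n) (σ : SPerm m)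
    (ρ : Equiv.Perm (PInt n)) {δ : SPerm (m + n)} (hδ : δ ∈ minReps m n) :
    dotB σ ρ * δ ∈ SigmaB (sqcupB P₁ P₂) ↔ σ ∈ SigmaB P₁ ∧ ρ ∈ SigmaA P₂ := by
  rw [mem_minReps_iff] at hδ
  rw [mem_SigmaB_iff, mem_SigmaB_iff, mem_SigmaA_iff]
  have hx : ∀ x, (dotB σ ρ * δ).1 ((δ⁻¹).1 x) = (dotB σ ρ).1 x := fun x => by
    rw [SPerm.mul_apply, SPerm.apply_inv_self]
  constructor
  · intro h
    refine ⟨fun a b hab => ?_, fun a b hab => ?_⟩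
    · refine hδ.midB_le.1 (h _ _ ?_)
      rw [hx, hx, dotB_midB, dotB_midB]
      exact sqcupB_le_midB P₁ P₂ hab
    · refine hδ.upB_le.1 (h _ _ ?_)
      rw [hx, hx, dotB_upB, dotB_upB]
      exact sqcupB_le_upB P₁ P₂ hab
  · rintro ⟨h₁, h₂⟩ x y hxy
    rw [← SPerm.inv_apply_self δ x, ← SPerm.inv_apply_self δ y]
    rw [SPerm.mul_apply, SPerm.mul_apply] at hxy
    rcases sqcupB_le_cases P₁ P₂ hxy with ⟨a, b, ha, hb, hab⟩ | ⟨a, b, ha, hb, hab⟩ |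
      ⟨a, b, hb, ha, hab⟩
    · rw [dotB_apply_eq_midB ha, dotB_apply_eq_midB hb, hδ.midB_le]
      exact h₁ _ _ (by simpa using hab)
    · rw [dotB_apply_eq_upB ha, dotB_apply_eq_upB hb, hδ.upB_le]
      exact h₂ _ _ (by simpa using hab)
    · rw [dotB_apply_eq_neg_upB ha, dotB_apply_eq_neg_upB hb, SPerm.apply_neg, SPerm.apply_neg,
        SInt.neg_le_neg_iff, hδ.upB_le]
      exact h₂ _ _ (by simpa using hab)

theorem shuffleB_SigmaB_SigmaA (P₁ : BPoset m) (P₂ : APoset n) :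
    shuffleB (SigmaB P₁) (SigmaA P₂) = SigmaB (sqcupB P₁ P₂) := by
  ext w
  constructor
  · rintro ⟨σ, hσ, ρ, hρ, δ, hδ, rfl⟩
    exact (dotB_mul_mem_SigmaB_iff P₁ P₂ σ ρ hδ).2 ⟨hσ, hρ⟩
  · intro hw
    obtain ⟨σ, ρ, δ, hδ, rfl⟩ := exists_dotB_mul_minReps w
    obtain ⟨hσ, hρ⟩ := (dotB_mul_mem_SigmaB_iff P₁ P₂ σ ρ hδ).1 hw
    exact ⟨σ, hσ, ρ, hρ, δ, hδ, rfl⟩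

theorem bijOn_dotB_mul (P₁ : BPoset m) (P₂ : APoset n) :
    Set.BijOn
      (fun t : SPerm m × Equiv.Perm (PInt n) × SPerm (m + n) => dotB t.1 t.2.1 * t.2.2)
      (SigmaB P₁ ×ˢ SigmaA P₂ ×ˢ minReps m n) (SigmaB (sqcupB P₁ P₂)) := by
  refine ⟨?_, ?_, ?_⟩
  · rintro ⟨σ, ρ, δ⟩ ⟨hσ, hρ, hδ⟩
    exact (dotB_mul_mem_SigmaB_iff P₁ P₂ σ ρ hδ).2 ⟨hσ, hρ⟩
  · rintro ⟨σ, ρ, δ⟩ ⟨-, -, hδ⟩ ⟨σ', ρ', δ'⟩ ⟨-, -, hδ'⟩ h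
    obtain ⟨rfl, rfl, rfl⟩ := dotB_mul_minReps_injective hδ hδ' h
    rfl
  · intro w hw
    rw [← shuffleB_SigmaB_SigmaA] at hw
    obtain ⟨σ, hσ, ρ, hρ, δ, hδ, rfl⟩ := hw
    exact ⟨⟨σ, ρ, δ⟩, ⟨hσ, hρ, hδ⟩, rfl⟩

/-! ### Right multiplication of coset representatives by simple generators -/

theorem simpleB_mul_of_apply {N : ℕ} (w : SPerm N) (i k : Fin N)
    (h : (w.1 (lo k) = lo i ∧ w.1 (hi k) = hi i) ∨ (w.1 (lo k) = -hi i ∧ w.1 (hi k) = -lo i)) :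
    simpleB N i * w = w * simpleB N k := by
  have hik : (i : ℕ) = 0 ↔ (k : ℕ) = 0 := by
    constructor
    · intro hi0
      by_contra hk
      have h1 := evB_ne_zero (lo k) (by simpa [lo] using hk) w
      have h2 := evB_ne_zero (hi k) (by simp only [hi]; omega) w
      rcases h with ⟨h, -⟩ | ⟨-, h⟩
      · exact h1 (by rw [evB, h]; simp [lo, hi0])
      · exact h2 (by rw [evB, h]; simp [lo, hi0])
    · intro hk
      by_contra hi0
      have h1 := evB_zero (lo k) (by simpa [lo] using hk) w
      rw [evB] at h1
      rcases h with ⟨h, -⟩ | ⟨h, -⟩ <;> rw [h] at h1 <;>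
        simp only [lo, hi, SInt.val_neg] at h1 <;> omega
  apply Subtype.ext
  change simpleBPerm N i * w.1 = w.1 * simpleBPerm N k
  unfold simpleBPerm
  by_cases hk : (k : ℕ) = 0
  · rw [if_pos hk, if_pos (hik.2 hk), Equiv.mul_swap_eq_swap_mul, SPerm.apply_neg]
    have h0 : w.1 (lo k) = lo k := by
      apply Subtype.ext
      have := evB_zero (lo k) (by simpa [lo] using hk) w
      rw [evB] at this
      rw [this]
      simp [lo, hk]
    rcases h with ⟨-, h⟩ | ⟨h, -⟩
    · rw [h]
    · rw [h0, Subtype.ext_iff] at h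
      simp only [lo, hi, SInt.val_neg] at h
      omega
  · rw [if_neg hk, if_neg (fun h' => hk (hik.1 h')), ← mul_assoc w.1,
      Equiv.mul_swap_eq_swap_mul w.1, mul_assoc (Equiv.swap _ _) w.1,
      Equiv.mul_swap_eq_swap_mul w.1, SPerm.apply_neg, SPerm.apply_neg, ← mul_assoc]
    rcases h with ⟨h1, h2⟩ | ⟨h1, h2⟩
    · rw [h1, h2]
    · rw [h1, h2, SInt.neg_neg, SInt.neg_neg, Equiv.swap_comm (-hi i), Equiv.swap_comm (hi i)]
      congr 1
      by_cases hl : lo i = -lo i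
      · exact absurd (congrArg Subtype.val hl) (by
          simp only [SInt.val_neg, lo]
          have := fun h' => hk (hik.1 h')
          omega)
      · refine (Equiv.Perm.Disjoint.commute ?_).eq
        intro x
        simp only [Equiv.swap_apply_def, Subtype.ext_iff, SInt.val_neg, lo, hi]
        have := fun h' => hk (hik.1 h')
        split_ifs <;> simp_all <;> omega

theorem simpleB_mul_of_DescB {N : ℕ} (w : SPerm N) (i k : Fin N) (h : ¬ DescB N k w)
    (h' : DescB N k (simpleB N i * w)) : simpleB N i * w = w * simpleB N k := by
  have h1 := (not_DescB_iff k w).1 h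
  refine simpleB_mul_of_apply w i k ?_
  by_contra hne
  rw [not_or] at hne
  have h2 := simpleBPerm_lt i (w.1 (lo k)) (w.1 (hi k)) h1
    (evB_ne_neg (lo k) (hi k) (by simp only [lo, hi]; omega) w) hne.1 hne.2
  exact (Subtype.coe_lt_coe.1 h2).not_gt h'

/-- Deodhar's lemma: right multiplication by a simple generator either yields another minimal
length representative, or amounts to left multiplication by a generator of the parabolic
subgroup. -/
theorem mul_simpleB_of_not_mem_minReps {δ : SPerm (m + n)} (hδ : δ ∈ minReps m n)
    {i : Fin (m + n)} (h : δ * simpleB (m + n) i ∉ minReps m n) :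
    ∃ k : Fin (m + n), (k : ℕ) ≠ m ∧ δ * simpleB (m + n) i = simpleB (m + n) k * δ := by
  rw [mem_minReps_iff] at hδ h
  unfold BlockIncreasing at h
  push Not at h
  obtain ⟨k, hk, hd⟩ := h
  rw [mul_inv_rev, simpleB_inv] at hd
  have := congrArg (·⁻¹) (simpleB_mul_of_DescB _ i k (hδ k hk) hd)
  simp only [mul_inv_rev, simpleB_inv, inv_inv] at this
  exact ⟨k, hk, this⟩

theorem lengthB_simpleB_mul {δ : SPerm (m + n)} (hδ : δ ∈ minReps m n) {k : Fin (m + n)}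
    (hk : (k : ℕ) ≠ m) : lengthB (simpleB (m + n) k * δ) = lengthB δ + 1 := by
  rw [← lengthB_inv, mul_inv_rev, simpleB_inv,
    lengthB_mul_of_not_DescB ((mem_minReps_iff δ).1 hδ k hk), lengthB_inv]

theorem mul_simpleB_mem_minReps_of_DescB {δ : SPerm (m + n)} (hδ : δ ∈ minReps m n)
    {i : Fin (m + n)} (h : DescB (m + n) i δ) : δ * simpleB (m + n) i ∈ minReps m n := by
  by_contra hn
  obtain ⟨k, hk, he⟩ := mul_simpleB_of_not_mem_minReps hδ hn
  have h1 := lengthB_simpleB_mul hδ hk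
  have h2 := lengthB_mul_of_DescB h
  rw [he] at h2
  omega

theorem one_mem_minReps : (1 : SPerm (m + n)) ∈ minReps m n := by
  rw [mem_minReps_iff]
  intro i _
  rw [inv_one, DescB_iff]
  simp [evB, lo, hi]

theorem not_DescB_dotB_mul (σ : SPerm m) (ρ : Equiv.Perm (PInt n)) {δ : SPerm (m + n)}
    {i : Fin (m + n)} (hd : ¬ DescB (m + n) i δ) (h : δ * simpleB (m + n) i ∈ minReps m n) :
    ¬ DescB (m + n) i (dotB σ ρ * δ) := by
  rw [mem_minReps_iff] at h
  have h1 := (not_DescB_iff i δ).1 hd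
  change δ.1 (lo i) < δ.1 (hi i) at h1
  have key : ∀ x, ((δ * simpleB (m + n) i)⁻¹).1 (δ.1 x) = simpleBPerm (m + n) i x := fun x => by
    rw [mul_inv_rev, simpleB_inv, SPerm.mul_apply, SPerm.inv_apply_self, simpleB_apply]
  have h2 : ((δ * simpleB (m + n) i)⁻¹).1 (δ.1 (hi i)) <
      ((δ * simpleB (m + n) i)⁻¹).1 (δ.1 (lo i)) := by
    rw [key, key]
    exact simpleBPerm_lo_ge i
  rw [DescB, SPerm.mul_apply, SPerm.mul_apply, not_lt]
  generalize δ.1 (lo i) = x at *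
  generalize δ.1 (hi i) = y at *
  apply le_of_lt
  rcases midB_or_upB x with ⟨a, rfl⟩ | ⟨a, rfl⟩ | ⟨a, rfl⟩ <;>
    rcases midB_or_upB y with ⟨b, rfl⟩ | ⟨b, rfl⟩ | ⟨b, rfl⟩ <;>
    simp only [SPerm.apply_neg, dotB_midB, dotB_upB] at h2 ⊢
  · exact absurd (h.midB_lt h1) h2.not_gt
  · exact midB_lt_upB _ _
  · exact absurd h1 (neg_upB_lt_midB _ _).not_gt
  · exact absurd h1 (midB_lt_upB _ _).not_gt
  · exact absurd (h.upB_lt ((upB_lt _ _).1 h1)) h2.not_gt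
  · exact absurd h1 (neg_upB_lt_upB _ _).not_gt
  · exact neg_upB_lt_midB _ _
  · exact neg_upB_lt_upB _ _
  · have h3 := SInt.neg_lt_neg h1
    rw [SInt.neg_neg, SInt.neg_neg, upB_lt] at h3
    exact absurd (SInt.neg_lt_neg (h.upB_lt h3)) h2.not_gt

end Parabolic

/-! ### The standard elements of the 0-Hecke algebra of type `B` -/

/-- To prove a property of all elements of a 0-Hecke algebra it suffices to consider scalars,
generators, sums and products. -/
theorem ZeroHecke.induction {S : Type} {M : CoxeterMatrix S} {p : ZeroHecke M → Prop}
    (scalar : ∀ c, p (algebraMap ℂ _ c)) (gen : ∀ s, p (gen M s))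
    (mul : ∀ x y, p x → p y → p (x * y)) (add : ∀ x y, p x → p y → p (x + y))
    (x : ZeroHecke M) : p x := by
  obtain ⟨x, rfl⟩ := RingQuot.mkAlgHom_surjective ℂ (ZeroHeckeRel M) x
  let q : FreeAlgebra ℂ S →ₐ[ℂ] ZeroHecke M := RingQuot.mkAlgHom ℂ (ZeroHeckeRel M)
  change p (q x)
  induction x using FreeAlgebra.induction with
  | grade0 c => rw [q.commutes]; exact scalar c
  | grade1 s => exact gen s
  | mul a b ha hb => rw [map_mul q]; exact mul _ _ ha hb
  | add a b ha hb => rw [map_add q]; exact add _ _ ha hb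

section HeckeElt

variable {n : ℕ}

/-- The element of the 0-Hecke algebra attached to a signed permutation: the product of the
generators along a reduced word. -/
noncomputable def heckeElt (w : SPerm n) : HB n :=
  wordProd (ZeroHecke.gen (coxB n)) (exists_reduced_word w).choose

theorem wordProd_gen_of_reduced (l : List (Fin n))
    (hl : l.length = lengthB (wordProd (simpleB n) l)) :
    wordProd (ZeroHecke.gen (coxB n)) l = heckeElt (wordProd (simpleB n) l) := by
  obtain ⟨h1, h2⟩ := (exists_reduced_word (wordProd (simpleB n) l)).choose_spec
  refine wordProd_eq_of_reduced _ (fun i j hij => ?_) _ _ h1.symm hl (by rw [h1, h2])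
  exact ZeroHecke.gen_braid _ i j hij (by have := coxB_ge_two hij; omega)

theorem exists_reduced_word_heckeElt (w : SPerm n) :
    ∃ l : List (Fin n), wordProd (simpleB n) l = w ∧ l.length = lengthB w ∧
      wordProd (ZeroHecke.gen (coxB n)) l = heckeElt w := by
  obtain ⟨l, rfl, hl⟩ := exists_reduced_word w
  exact ⟨l, rfl, hl, wordProd_gen_of_reduced l hl⟩

theorem heckeElt_one : heckeElt (1 : SPerm n) = 1 := by
  have := wordProd_gen_of_reduced ([] : List (Fin n))
    (by have := lengthB_le_length ([] : List (Fin n)); simp at this ⊢; omega)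
  rw [wordProd_nil, wordProd_nil] at this
  exact this.symm

theorem heckeElt_mul_gen_of_not_DescB {i : Fin n} {w : SPerm n} (h : ¬ DescB n i w) :
    heckeElt w * ZeroHecke.gen (coxB n) i = heckeElt (w * simpleB n i) := by
  obtain ⟨l, rfl, hl, hw⟩ := exists_reduced_word_heckeElt w
  have := wordProd_gen_of_reduced (l ++ [i]) (by
    rw [wordProd_append, wordProd_singleton, lengthB_mul_of_not_DescB h, List.length_append, hl,
      List.length_singleton])
  rw [wordProd_append, wordProd_append, wordProd_singleton, wordProd_singleton, hw] at this
  exact this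

theorem heckeElt_mul_gen_of_DescB {i : Fin n} {w : SPerm n} (h : DescB n i w) :
    heckeElt w * ZeroHecke.gen (coxB n) i = -heckeElt w := by
  have h1 := heckeElt_mul_gen_of_not_DescB (i := i) (w := w * simpleB n i)
    (fun h' => (DescB_mul_simpleB _ _).1 h' h)
  rw [mul_simpleB_cancel] at h1
  rw [← h1, mul_assoc, ZeroHecke.gen_quad, mul_neg]

theorem gen_mul_heckeElt {k : Fin n} {w : SPerm n}
    (h : lengthB (simpleB n k * w) = lengthB w + 1) :
    ZeroHecke.gen (coxB n) k * heckeElt w = heckeElt (simpleB n k * w) := by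
  obtain ⟨l, rfl, hl, hw⟩ := exists_reduced_word_heckeElt w
  have := wordProd_gen_of_reduced (k :: l) (by rw [wordProd_cons, h, List.length_cons, hl])
  rw [wordProd_cons, wordProd_cons, hw] at this
  exact this

end HeckeElt

/-! ### Induced modules -/

section Induced

variable {A B : Type} [Ring A] [Algebra ℂ A] [Ring B] [Algebra ℂ B] (f : A →ₐ[ℂ] B)
  {V : Type} [AddCommGroup V] [Module ℂ V] [Module Aᵐᵒᵖ V]

theorem Induced.tmul_add (v v' : V) (b : B) :
    Induced.tmul f (v + v') b = Induced.tmul f v b + Induced.tmul f v' b := by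
  rw [Induced.tmul, TensorProduct.tmul_add, map_add]
  rfl

theorem Induced.tmul_smul (c : ℂ) (v : V) (b : B) :
    Induced.tmul f (c • v) b = c • Induced.tmul f v b := by
  rw [Induced.tmul, TensorProduct.tmul_smul]
  rfl

theorem Induced.tmul_zero (b : B) : Induced.tmul f (0 : V) b = 0 := by
  rw [Induced.tmul, TensorProduct.tmul_zero, map_zero]

theorem Induced.tmul_neg (v : V) (b : B) : Induced.tmul f v (-b) = -Induced.tmul f v b := by
  rw [Induced.tmul, TensorProduct.neg_tmul, map_neg]
  rfl

theorem Induced.induction {p : Induced f V → Prop} (zero : p 0)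
    (tmul : ∀ v b, p (Induced.tmul f v b)) (add : ∀ x y, p x → p y → p (x + y))
    (x : Induced f V) : p x := by
  obtain ⟨x, rfl⟩ := (inducedRel f V).mkQ_surjective x
  induction x using TensorProduct.induction_on with
  | zero => rw [map_zero]; exact zero
  | tmul b v => exact tmul v b
  | add x y hx hy => rw [map_add]; exact add _ _ hx hy

variable {M : Type} [AddCommGroup M] [Module ℂ M] [Module Bᵐᵒᵖ M] [IsScalarTower ℂ Bᵐᵒᵖ M]

/-- Frobenius reciprocity: an `A`-linear map `V → M` into a right `B`-module extends to the
induced module. -/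
noncomputable def Induced.lift (g : V →ₗ[ℂ] M)
    (hg : ∀ (a : A) (v : V), g (MulOpposite.op a • v) = MulOpposite.op (f a) • g v) :
    Induced f V →ₗ[Bᵐᵒᵖ] M :=
  (inducedRel f V).liftQ
    (TensorProduct.AlgebraTensorModule.lift
      { toFun := fun b => MulOpposite.op b • g
        map_add' := fun b c => by rw [MulOpposite.op_add, add_smul]
        map_smul' := fun c b => by
          rw [RingHom.id_apply, smul_smul, ← MulOpposite.op_unop c, op_smul_eq_mul,
            MulOpposite.op_mul] })
    (by
      rw [inducedRel, Submodule.span_le]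
      rintro _ ⟨a, b, v, rfl⟩
      rw [SetLike.mem_coe, LinearMap.mem_ker, map_sub, sub_eq_zero]
      simp only [TensorProduct.AlgebraTensorModule.lift_tmul, LinearMap.coe_mk, AddHom.coe_mk,
        LinearMap.smul_apply, MulOpposite.op_mul, mul_smul, hg])

theorem Induced.lift_tmul (g : V →ₗ[ℂ] M)
    (hg : ∀ (a : A) (v : V), g (MulOpposite.op a • v) = MulOpposite.op (f a) • g v)
    (v : V) (b : B) : Induced.lift f g hg (Induced.tmul f v b) = MulOpposite.op b • g v := rfl

end Induced

theorem op_algebraMap_smul {A V : Type} [Ring A] [Algebra ℂ A] [AddCommGroup V] [Module ℂ V]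
    [Module Aᵐᵒᵖ V] [IsScalarTower ℂ Aᵐᵒᵖ V] (c : ℂ) (v : V) :
    MulOpposite.op (algebraMap ℂ A c) • v = c • v :=
  algebraMap_smul Aᵐᵒᵖ c v

/-! ### The comparison map -/

section Comparison

variable {m n : ℕ} (P₁ : BPoset m) (P₂ : APoset n)

theorem dotB_mem_SigmaB_iff (σ : SPerm m) (ρ : Equiv.Perm (PInt n)) :
    dotB σ ρ ∈ SigmaB (sqcupB P₁ P₂) ↔ σ ∈ SigmaB P₁ ∧ ρ ∈ SigmaA P₂ := by
  have := dotB_mul_mem_SigmaB_iff P₁ P₂ σ ρ one_mem_minReps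
  rwa [mul_one] at this

/-- The bilinear map that sends a pair of basis elements `σ`, `ρ` to the basis element
`σ •_B ρ`. -/
noncomputable def dotMap : ModB P₁ →ₗ[ℂ] ModA P₂ →ₗ[ℂ] ModB (sqcupB P₁ P₂) :=
  Finsupp.linearCombination ℂ fun γ => Finsupp.linearCombination ℂ fun γ' =>
    ModB.basisElt ⟨dotB γ.1 γ'.1, (dotB_mem_SigmaB_iff P₁ P₂ _ _).2 ⟨γ.2, γ'.2⟩⟩

theorem dotMap_basisElt (γ : SigmaB P₁) (γ' : SigmaA P₂) :
    dotMap P₁ P₂ (ModB.basisElt γ) (ModA.basisElt γ') =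
      ModB.basisElt ⟨dotB γ.1 γ'.1, (dotB_mem_SigmaB_iff P₁ P₂ _ _).2 ⟨γ.2, γ'.2⟩⟩ := by
  simp [dotMap, ModB.basisElt, ModA.basisElt]

variable {P₁ P₂}

theorem ModB.induction {n : ℕ} {P : BPoset n} {p : ModB P → Prop} (zero : p 0)
    (basis : ∀ γ, p (ModB.basisElt γ)) (smul : ∀ (c : ℂ) v, p v → p (c • v))
    (add : ∀ v w, p v → p w → p (v + w)) (v : ModB P) : p v := by
  induction v using Finsupp.induction_linear with
  | zero => exact zero
  | add v w hv hw => exact add v w hv hw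
  | single γ c =>
    have := smul c _ (basis γ)
    rwa [ModB.basisElt, Finsupp.smul_single, smul_eq_mul, mul_one] at this

theorem ModA.induction {n : ℕ} {P : APoset n} {p : ModA P → Prop} (zero : p 0)
    (basis : ∀ γ, p (ModA.basisElt γ)) (smul : ∀ (c : ℂ) v, p v → p (c • v))
    (add : ∀ v w, p v → p w → p (v + w)) (v : ModA P) : p v := by
  induction v using Finsupp.induction_linear with
  | zero => exact zero
  | add v w hv hw => exact add v w hv hw
  | single γ c =>
    have := smul c _ (basis γ)
    rwa [ModA.basisElt, Finsupp.smul_single, smul_eq_mul, mul_one] at this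

theorem dotMap_gen_smul_left (i : Fin m) (v : ModB P₁) (w : ModA P₂) :
    dotMap P₁ P₂ (MulOpposite.op (ZeroHecke.gen (coxB m) i) • v) w =
      MulOpposite.op (ZeroHecke.gen (coxB (m + n)) (Fin.castAdd n i)) • dotMap P₁ P₂ v w := by
  induction v using ModB.induction with
  | zero => simp
  | add v v' hv hv' => rw [smul_add, map_add, LinearMap.add_apply, hv, hv', map_add,
      LinearMap.add_apply, smul_add]
  | smul c v hv => rw [smul_comm, map_smul, LinearMap.smul_apply, hv, map_smul,
      LinearMap.smul_apply, smul_comm]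
  | basis γ =>
  induction w using ModA.induction with
  | zero => simp
  | add w w' hw hw' => rw [map_add, hw, hw', map_add, smul_add]
  | smul c w hw => rw [map_smul, hw, map_smul, smul_comm]
  | basis γ' =>
  have hmem : dotB γ.1 γ'.1 * simpleB (m + n) (Fin.castAdd n i) ∈ SigmaB (sqcupB P₁ P₂) ↔
      γ.1 * simpleB m i ∈ SigmaB P₁ := by
    rw [simpleB_castAdd, dotB_mul, mul_one, dotB_mem_SigmaB_iff]
    exact and_iff_left γ'.2
  rw [dotMap_basisElt, ModB.gen_smul, ModB.gen_smul]
  by_cases hd : DescB m i γ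
  · rw [if_pos hd, if_pos ((DescB_castAdd_dotB _ _ _).2 hd), map_neg, LinearMap.neg_apply,
      dotMap_basisElt]
  · rw [if_neg hd, if_neg (fun h => hd ((DescB_castAdd_dotB _ _ _).1 h))]
    by_cases h : γ.1 * simpleB m i ∈ SigmaB P₁
    · rw [dif_pos h, dif_pos (hmem.2 h), dotMap_basisElt]
      congr 1
      refine Subtype.ext ?_
      change dotB (γ.1 * simpleB m i) γ'.1 = dotB γ.1 γ'.1 * _
      rw [simpleB_castAdd, dotB_mul, mul_one]
    · rw [dif_neg h, dif_neg (fun h' => h (hmem.1 h')), map_zero, LinearMap.zero_apply]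

theorem dotMap_gen_smul_right (j : Fin (n - 1)) (v : ModB P₁) (w : ModA P₂) :
    dotMap P₁ P₂ v (MulOpposite.op (ZeroHecke.gen (CoxeterMatrix.A (n - 1)) j : HA n) • w) =
      MulOpposite.op (ZeroHecke.gen (coxB (m + n)) (shiftNode m n j)) • dotMap P₁ P₂ v w := by
  induction v using ModB.induction with
  | zero => simp
  | add v v' hv hv' => rw [map_add, LinearMap.add_apply, hv, hv', LinearMap.add_apply, smul_add]
  | smul c v hv => rw [map_smul (dotMap P₁ P₂), LinearMap.smul_apply, hv, LinearMap.smul_apply,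
      smul_comm]
  | basis γ =>
  induction w using ModA.induction with
  | zero => simp
  | add w w' hw hw' => rw [smul_add, map_add, hw, hw', map_add, smul_add]
  | smul c w hw => rw [smul_comm, map_smul, hw, map_smul, smul_comm]
  | basis γ' =>
  have hmem : dotB γ.1 γ'.1 * simpleB (m + n) (shiftNode m n j) ∈ SigmaB (sqcupB P₁ P₂) ↔
      γ'.1 * simpleA n j ∈ SigmaA P₂ := by
    rw [simpleB_shiftNode, dotB_mul, mul_one, dotB_mem_SigmaB_iff]
    exact and_iff_right γ.2
  rw [dotMap_basisElt, ModB.gen_smul, ModA.gen_smul]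
  by_cases hd : DescA n j γ'
  · rw [if_pos hd, if_pos ((DescB_shiftNode_dotB _ _ _).2 hd), map_neg, dotMap_basisElt]
  · rw [if_neg hd, if_neg (fun h => hd ((DescB_shiftNode_dotB _ _ _).1 h))]
    by_cases h : γ'.1 * simpleA n j ∈ SigmaA P₂
    · rw [dif_pos h, dif_pos (hmem.2 h), dotMap_basisElt]
      congr 1
      refine Subtype.ext ?_
      change dotB γ.1 (γ'.1 * simpleA n j) = dotB γ.1 γ'.1 * _
      rw [simpleB_shiftNode, dotB_mul, mul_one]
    · rw [dif_neg h, dif_neg (fun h' => h (hmem.1 h')), map_zero]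

theorem dotMap_smul_left (x : HB m) (v : ModB P₁) (w : ModA P₂) :
    dotMap P₁ P₂ (MulOpposite.op x • v) w =
      MulOpposite.op (embB m n x) • dotMap P₁ P₂ v w := by
  induction x using ZeroHecke.induction generalizing v with
  | scalar c =>
    rw [AlgHom.commutes, op_algebraMap_smul, op_algebraMap_smul, map_smul, LinearMap.smul_apply]
  | gen i => rw [embB, ZeroHecke.map_gen]; exact dotMap_gen_smul_left i v w
  | mul x y hx hy => rw [map_mul, MulOpposite.op_mul, MulOpposite.op_mul, mul_smul, mul_smul, hy, hx]
  | add x y hx hy => rw [map_add, MulOpposite.op_add, MulOpposite.op_add, add_smul, add_smul,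
      map_add, LinearMap.add_apply, hx, hy]

theorem dotMap_smul_right (x : HA n) (v : ModB P₁) (w : ModA P₂) :
    dotMap P₁ P₂ v (MulOpposite.op x • w) =
      MulOpposite.op (embA m n x) • dotMap P₁ P₂ v w := by
  induction x using ZeroHecke.induction generalizing w with
  | scalar c => rw [AlgHom.commutes, op_algebraMap_smul, op_algebraMap_smul, map_smul]
  | gen i => rw [embA, ZeroHecke.map_gen]; exact dotMap_gen_smul_right i v w
  | mul x y hx hy => rw [map_mul, MulOpposite.op_mul, MulOpposite.op_mul, mul_smul, mul_smul, hy, hx]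
  | add x y hx hy => rw [map_add, MulOpposite.op_add, MulOpposite.op_add, add_smul, add_smul,
      map_add, hx, hy]

theorem OuterTensor.induction {V W : Type} [AddCommGroup V] [Module ℂ V] [AddCommGroup W]
    [Module ℂ W] {p : OuterTensor V W → Prop} (zero : p 0)
    (tmul : ∀ v w, p (OuterTensor.tmul v w)) (add : ∀ x y, p x → p y → p (x + y))
    (x : OuterTensor V W) : p x :=
  TensorProduct.induction_on (motive := p) x zero tmul add

variable (P₁ P₂) in
/-- The map from the outer tensor product that sends `σ ⊗ ρ` to `σ •_B ρ`. -/
noncomputable def dotLin : OuterTensor (ModB P₁) (ModA P₂) →ₗ[ℂ] ModB (sqcupB P₁ P₂) :=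
  TensorProduct.lift (dotMap P₁ P₂)

theorem dotLin_tmul (v : ModB P₁) (w : ModA P₂) :
    dotLin P₁ P₂ (OuterTensor.tmul v w) = dotMap P₁ P₂ v w :=
  TensorProduct.lift.tmul v w

theorem dotLin_smul (a : HB m ⊗[ℂ] HA n) (v : OuterTensor (ModB P₁) (ModA P₂)) :
    dotLin P₁ P₂ (MulOpposite.op a • v) = MulOpposite.op (embBA m n a) • dotLin P₁ P₂ v := by
  induction v using OuterTensor.induction with
  | zero => simp
  | add v w hv hw => rw [smul_add, map_add, hv, hw, map_add, smul_add]
  | tmul v w =>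
  induction a using TensorProduct.induction_on with
  | zero =>
    rw [map_zero, MulOpposite.op_zero, MulOpposite.op_zero, zero_smul, map_zero]
    exact (zero_smul (HB (m + n))ᵐᵒᵖ (dotLin P₁ P₂ (OuterTensor.tmul v w))).symm
  | add a b ha hb => rw [map_add, MulOpposite.op_add, MulOpposite.op_add, add_smul, add_smul,
      map_add, ha, hb]
  | tmul x y =>
    rw [OuterTensor.op_tmul_smul_tmul, dotLin_tmul, dotLin_tmul, dotMap_smul_right,
      dotMap_smul_left, ← mul_smul, ← MulOpposite.op_mul, embBA,
      Algebra.TensorProduct.lift_tmul]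

variable (P₁ P₂) in
/-- The homomorphism from the induced module to the poset module of the product. -/
noncomputable def inducedToModB :
    Induced (embBA m n) (OuterTensor (ModB P₁) (ModA P₂)) →ₗ[(HB (m + n))ᵐᵒᵖ]
      ModB (sqcupB P₁ P₂) :=
  Induced.lift (embBA m n) (dotLin P₁ P₂) dotLin_smul

theorem wordProd_gen_smul_basisElt (γ : SigmaB P₁) (γ' : SigmaA P₂) (l : List (Fin (m + n)))
    (hl : l.length = lengthB (wordProd (simpleB (m + n)) l))
    (hδ : wordProd (simpleB (m + n)) l ∈ minReps m n) :
    MulOpposite.op (wordProd (ZeroHecke.gen (coxB (m + n))) l) •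
        dotMap P₁ P₂ (ModB.basisElt γ) (ModA.basisElt γ') =
      ModB.basisElt ⟨dotB γ.1 γ'.1 * wordProd (simpleB (m + n)) l,
        (dotB_mul_mem_SigmaB_iff P₁ P₂ _ _ hδ).2 ⟨γ.2, γ'.2⟩⟩ := by
  induction l using List.reverseRecOn with
  | nil =>
    rw [wordProd_nil, MulOpposite.op_one, one_smul, dotMap_basisElt]
    congr 1
  | append_singleton l i ih =>
    obtain ⟨h1, h2⟩ := reduced_of_append_singleton hl
    have hd := DescB_of_reduced_append_singleton hl
    have hδ' := mul_simpleB_mem_minReps_of_DescB hδ hd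
    have hmem := (dotB_mul_mem_SigmaB_iff P₁ P₂ _ _ hδ).2 ⟨γ.2, γ'.2⟩
    rw [wordProd_append (simpleB _), wordProd_singleton] at hδ hδ' hmem
    rw [mul_simpleB_cancel] at hδ'
    rw [← mul_assoc] at hmem
    rw [wordProd_append, wordProd_singleton, MulOpposite.op_mul, mul_smul, ih h1 hδ',
      ModB.gen_smul, if_neg (not_DescB_dotB_mul _ _ h2 hδ), dif_pos hmem]
    congr 1
    refine Subtype.ext ?_
    change dotB γ.1 γ'.1 * wordProd (simpleB (m + n)) l * _ =
      dotB γ.1 γ'.1 * wordProd (simpleB (m + n)) (l ++ [i])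
    rw [wordProd_append, wordProd_singleton, mul_assoc]

theorem inducedToModB_basisElt (γ : SigmaB P₁) (γ' : SigmaA P₂) (l : List (Fin (m + n)))
    (hl : l.length = lengthB (wordProd (simpleB (m + n)) l))
    (hδ : wordProd (simpleB (m + n)) l ∈ minReps m n) (ζ : SigmaB (sqcupB P₁ P₂))
    (hζ : (ζ : SPerm (m + n)) = dotB γ.1 γ'.1 * wordProd (simpleB (m + n)) l) :
    inducedToModB P₁ P₂ (Induced.tmul (embBA m n)
      (OuterTensor.tmul (ModB.basisElt γ) (ModA.basisElt γ'))
      (wordProd (ZeroHecke.gen (coxB (m + n))) l)) = ModB.basisElt ζ := by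
  rw [inducedToModB, Induced.lift_tmul, dotLin_tmul, wordProd_gen_smul_basisElt γ γ' l hl hδ]
  congr 1
  exact Subtype.ext hζ.symm

/-! ### A spanning set of the induced module -/

variable (P₁ P₂) in
/-- The span of the elements `(σ ⊗ ρ) ⊗ π_δ`, where `δ` is a minimal length representative. -/
noncomputable def basisSpan :
    Submodule ℂ (Induced (embBA m n) (OuterTensor (ModB P₁) (ModA P₂))) :=
  Submodule.span ℂ {x | ∃ (γ : SigmaB P₁) (γ' : SigmaA P₂), ∃ δ ∈ minReps m n,
    x = Induced.tmul (embBA m n) (OuterTensor.tmul (ModB.basisElt γ) (ModA.basisElt γ'))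
      (heckeElt δ)}

theorem tmul_heckeElt_mem_basisSpan (v : OuterTensor (ModB P₁) (ModA P₂)) {δ : SPerm (m + n)}
    (hδ : δ ∈ minReps m n) : Induced.tmul (embBA m n) v (heckeElt δ) ∈ basisSpan P₁ P₂ := by
  induction v using OuterTensor.induction with
  | zero => rw [Induced.tmul_zero]; exact zero_mem _
  | add v w hv hw => rw [Induced.tmul_add]; exact add_mem hv hw
  | tmul v w =>
  induction v using ModB.induction with
  | zero =>
    have : OuterTensor.tmul (0 : ModB P₁) w = 0 := TensorProduct.zero_tmul _ _
    rw [this, Induced.tmul_zero]; exact zero_mem _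
  | add v v' hv hv' =>
    have : OuterTensor.tmul (v + v') w = OuterTensor.tmul v w + OuterTensor.tmul v' w :=
      TensorProduct.add_tmul _ _ _
    rw [this, Induced.tmul_add]; exact add_mem hv hv'
  | smul c v hv =>
    have : OuterTensor.tmul (c • v) w = c • OuterTensor.tmul v w :=
      (TensorProduct.smul_tmul' _ _ _).symm
    rw [this, Induced.tmul_smul]; exact Submodule.smul_mem _ _ hv
  | basis γ =>
  induction w using ModA.induction with
  | zero =>
    have : OuterTensor.tmul (ModB.basisElt γ) (0 : ModA P₂) = 0 := TensorProduct.tmul_zero _ _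
    rw [this, Induced.tmul_zero]; exact zero_mem _
  | add w w' hw hw' =>
    have : OuterTensor.tmul (ModB.basisElt γ) (w + w') =
        OuterTensor.tmul (ModB.basisElt γ) w + OuterTensor.tmul (ModB.basisElt γ) w' :=
      TensorProduct.tmul_add _ _ _
    rw [this, Induced.tmul_add]; exact add_mem hw hw'
  | smul c w hw =>
    have : OuterTensor.tmul (ModB.basisElt γ) (c • w) =
        c • OuterTensor.tmul (ModB.basisElt γ) w := TensorProduct.tmul_smul _ _ _
    rw [this, Induced.tmul_smul]; exact Submodule.smul_mem _ _ hw
  | basis γ' => exact Submodule.subset_span ⟨γ, γ', δ, hδ, rfl⟩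

theorem tmul_heckeElt_mul_gen_mem_basisSpan (v : OuterTensor (ModB P₁) (ModA P₂))
    {δ : SPerm (m + n)} (hδ : δ ∈ minReps m n) (i : Fin (m + n)) :
    Induced.tmul (embBA m n) v (heckeElt δ * ZeroHecke.gen (coxB (m + n)) i) ∈
      basisSpan P₁ P₂ := by
  by_cases hd : DescB (m + n) i δ
  · rw [heckeElt_mul_gen_of_DescB hd, Induced.tmul_neg]
    exact neg_mem (tmul_heckeElt_mem_basisSpan v hδ)
  rw [heckeElt_mul_gen_of_not_DescB hd]
  by_cases hi' : δ * simpleB (m + n) i ∈ minReps m n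
  · exact tmul_heckeElt_mem_basisSpan v hi'
  obtain ⟨k, hk, he⟩ := mul_simpleB_of_not_mem_minReps hδ hi'
  rw [he, ← gen_mul_heckeElt (lengthB_simpleB_mul hδ hk)]
  obtain ⟨a, ha⟩ : ∃ a, embBA m n a = ZeroHecke.gen (coxB (m + n)) k := by
    rcases castAdd_or_shiftNode k hk with ⟨k, rfl⟩ | ⟨j, rfl⟩
    · exact ⟨ZeroHecke.gen (coxB m) k ⊗ₜ 1, by
        rw [embBA, Algebra.TensorProduct.lift_tmul, map_one, mul_one, embB, ZeroHecke.map_gen]⟩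
    · exact ⟨1 ⊗ₜ ZeroHecke.gen _ j, by
        rw [embBA, Algebra.TensorProduct.lift_tmul, map_one, one_mul, embA, ZeroHecke.map_gen]⟩
  rw [← ha, ← (Induced.smul_tmul (embBA m n) v a (heckeElt δ) 1).1]
  exact tmul_heckeElt_mem_basisSpan _ hδ

theorem op_smul_mem_basisSpan (b : HB (m + n))
    {x : Induced (embBA m n) (OuterTensor (ModB P₁) (ModA P₂))} (hx : x ∈ basisSpan P₁ P₂) :
    MulOpposite.op b • x ∈ basisSpan P₁ P₂ := by
  induction b using ZeroHecke.induction generalizing x with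
  | scalar c => rw [op_algebraMap_smul]; exact Submodule.smul_mem _ _ hx
  | mul a b ha hb => rw [MulOpposite.op_mul, mul_smul]; exact hb (ha hx)
  | add a b ha hb => rw [MulOpposite.op_add, add_smul]; exact add_mem (ha hx) (hb hx)
  | gen i =>
  induction hx using Submodule.span_induction with
  | zero => rw [smul_zero]; exact zero_mem _
  | add x y _ _ hx hy => rw [smul_add]; exact add_mem hx hy
  | smul c x _ hx => rw [smul_comm]; exact Submodule.smul_mem _ _ hx
  | mem x hx =>
    obtain ⟨γ, γ', δ, hδ, rfl⟩ := hx
    rw [(Induced.smul_tmul (embBA m n) _ 1 (heckeElt δ) _).2]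
    exact tmul_heckeElt_mul_gen_mem_basisSpan _ hδ i

theorem basisSpan_eq_top : basisSpan P₁ P₂ = ⊤ := by
  refine eq_top_iff.2 fun x _ => ?_
  induction x using Induced.induction with
  | zero => exact zero_mem _
  | add x y hx hy => exact add_mem (hx trivial) (hy trivial)
  | tmul v b =>
    have h := (Induced.smul_tmul (embBA m n) v 1 (heckeElt 1) b).2
    rw [heckeElt_one, one_mul] at h
    rw [← h, ← heckeElt_one]
    exact op_smul_mem_basisSpan b (tmul_heckeElt_mem_basisSpan v one_mem_minReps)

theorem inducedToModB_heckeElt (γ : SigmaB P₁) (γ' : SigmaA P₂) {δ : SPerm (m + n)}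
    (hδ : δ ∈ minReps m n) (ζ : SigmaB (sqcupB P₁ P₂))
    (hζ : (ζ : SPerm (m + n)) = dotB γ.1 γ'.1 * δ) :
    inducedToModB P₁ P₂ (Induced.tmul (embBA m n)
      (OuterTensor.tmul (ModB.basisElt γ) (ModA.basisElt γ')) (heckeElt δ)) =
        ModB.basisElt ζ := by
  obtain ⟨l, rfl, hl, hw⟩ := exists_reduced_word_heckeElt δ
  rw [← hw]
  exact inducedToModB_basisElt γ γ' l hl hδ ζ hζ

theorem inducedToModB_bijective : Function.Bijective (inducedToModB P₁ P₂) := by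
  have hfac : ∀ ζ : SigmaB (sqcupB P₁ P₂), ∃ (γ : SigmaB P₁) (γ' : SigmaA P₂) (δ : minReps m n),
      (ζ : SPerm (m + n)) = dotB γ.1 γ'.1 * δ.1 := by
    rintro ⟨ζ, hζ⟩
    rw [← shuffleB_SigmaB_SigmaA] at hζ
    obtain ⟨σ, hσ, ρ, hρ, δ, hδ, rfl⟩ := hζ
    exact ⟨⟨σ, hσ⟩, ⟨ρ, hρ⟩, ⟨δ, hδ⟩, rfl⟩
  choose g g' d hgd using hfac
  let Ξ : ModB (sqcupB P₁ P₂) →ₗ[ℂ] Induced (embBA m n) (OuterTensor (ModB P₁) (ModA P₂)) :=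
    Finsupp.linearCombination ℂ fun ζ => Induced.tmul (embBA m n)
      (OuterTensor.tmul (ModB.basisElt (g ζ)) (ModA.basisElt (g' ζ))) (heckeElt (d ζ).1)
  have hΞ : ∀ ζ, Ξ (ModB.basisElt ζ) = Induced.tmul (embBA m n)
      (OuterTensor.tmul (ModB.basisElt (g ζ)) (ModA.basisElt (g' ζ))) (heckeElt (d ζ).1) :=
    fun ζ => by simp [Ξ, ModB.basisElt]
  have hsmul : ∀ (c : ℂ) x, inducedToModB P₁ P₂ (c • x) = c • inducedToModB P₁ P₂ x := by
    intro c x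
    rw [← op_algebraMap_smul (A := HB (m + n)) c x, map_smul, op_algebraMap_smul]
  constructor
  · refine Function.LeftInverse.injective (g := Ξ) fun x => ?_
    have hx : x ∈ basisSpan P₁ P₂ := by rw [basisSpan_eq_top]; trivial
    induction hx using Submodule.span_induction with
    | zero => rw [map_zero, map_zero]
    | add x y _ _ hx hy => rw [map_add, map_add, hx, hy]
    | smul c x _ hx => rw [hsmul, map_smul, hx]
    | mem x hx =>
      obtain ⟨γ, γ', δ, hδ, rfl⟩ := hx
      have hζ := (dotB_mul_mem_SigmaB_iff P₁ P₂ γ.1 γ'.1 hδ).2 ⟨γ.2, γ'.2⟩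
      rw [inducedToModB_heckeElt γ γ' hδ ⟨_, hζ⟩ rfl, hΞ]
      obtain ⟨h1, h2, h3⟩ := dotB_mul_minReps_injective hδ (d ⟨_, hζ⟩).2 (hgd ⟨_, hζ⟩)
      rw [← Subtype.ext h1, ← Subtype.ext h2, ← h3]
  · intro y
    induction y using ModB.induction with
    | zero => exact ⟨0, map_zero _⟩
    | add y y' hy hy' =>
      obtain ⟨x, rfl⟩ := hy
      obtain ⟨x', rfl⟩ := hy'
      exact ⟨x + x', map_add _ _ _⟩
    | smul c y hy =>
      obtain ⟨x, rfl⟩ := hy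
      exact ⟨c • x, hsmul c x⟩
    | basis ζ => exact ⟨_, inducedToModB_heckeElt (g ζ) (g' ζ) (d ζ).2 ζ (hgd ζ)⟩

end Comparison

end PosetModuleB

theorem mainTheorem4 (m n : ℕ) (P₁ : PosetModuleB.BPoset m) (P₂ : PosetModuleB.APoset n) :
    PosetModuleB.shuffleB (PosetModuleB.SigmaB P₁) (PosetModuleB.SigmaA P₂) =
        PosetModuleB.SigmaB (PosetModuleB.sqcupB P₁ P₂) ∧
      Set.BijOn
        (fun t : PosetModuleB.SPerm m × Equiv.Perm (PosetModuleB.PInt n) ×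
            PosetModuleB.SPerm (m + n) => PosetModuleB.dotB t.1 t.2.1 * t.2.2)
        (PosetModuleB.SigmaB P₁ ×ˢ PosetModuleB.SigmaA P₂ ×ˢ PosetModuleB.minReps m n)
        (PosetModuleB.SigmaB (PosetModuleB.sqcupB P₁ P₂)) ∧
      ∃ Φ : PosetModuleB.Induced (PosetModuleB.embBA m n)
            (PosetModuleB.OuterTensor (PosetModuleB.ModB P₁) (PosetModuleB.ModA P₂))
          ≃ₗ[(PosetModuleB.HB (m + n))ᵐᵒᵖ] PosetModuleB.ModB (PosetModuleB.sqcupB P₁ P₂),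
        ∀ (γ : PosetModuleB.SigmaB P₁) (γ' : PosetModuleB.SigmaA P₂),
          ∀ δ ∈ PosetModuleB.minReps m n,
          ∀ l : List (Fin (m + n)),
            PosetModuleB.wordProd (PosetModuleB.simpleB (m + n)) l = δ →
            l.length = PosetModuleB.lengthB δ →
          ∀ ζ : PosetModuleB.SigmaB (PosetModuleB.sqcupB P₁ P₂),
            (ζ : PosetModuleB.SPerm (m + n)) = PosetModuleB.dotB γ γ' * δ →
            Φ (PosetModuleB.Induced.tmul (PosetModuleB.embBA m n)
                (PosetModuleB.OuterTensor.tmul (PosetModuleB.ModB.basisElt γ)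
                  (PosetModuleB.ModA.basisElt γ'))
                (PosetModuleB.wordProd
                  (PosetModuleB.ZeroHecke.gen (PosetModuleB.coxB (m + n))) l)) =
              PosetModuleB.ModB.basisElt ζ := by
  refine ⟨PosetModuleB.shuffleB_SigmaB_SigmaA P₁ P₂, PosetModuleB.bijOn_dotB_mul P₁ P₂,
    LinearEquiv.ofBijective (PosetModuleB.inducedToModB P₁ P₂)
      PosetModuleB.inducedToModB_bijective, ?_⟩
  rintro γ γ' δ hδ l rfl hl ζ hζ
  exact PosetModuleB.inducedToModB_basisElt γ γ' l hl hδ ζ hζ
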